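/- Let $G=\mathbb Z\times(\mathbb R\rtimes\mathbb Z_2)$ with multiplication $(x,a,n)(y,b,m)=(x+y,\,a+(-1)^n b,\,n+m)$, and let $\lambda$ be its Haar measure (counting $\times$ Lebesgue $\times$ counting). Let $(r_n)_{n\ge 0}$ be a strictly increasing sequence of positive integers with $n^4/r_n\to 0$. Put $\tilde a_0=1$ and, for $n\ge 1$, $$a_n=(2r_{n-1}+1)\tilde a_{n-1},\qquad b_n=(2n-1)\tilde a_{n-1},\qquad \tilde a_n=a_n+b_n+n,$$ $$F_n=(-a_n,a_n]_{\mathbb Z}\times(-a_n,a_n]_{\mathbb R}\times\mathbb Z_2,\quad S_n=(-b_n,b_n]_{\mathbb Z}\times(-b_n,b_n]_{\mathbb R}\times\mathbb Z_2,\quad H_n=\{-r_n,\dots,r_n\}^2,$$ and $\phi_n(i,j)=(2i\tilde a_n,2j\tilde a_n,0)$ for $(i,j)\in\mathbb Z^2$. Suppose that for each $n\ge1$ we are given: * a finite measurable partition $\xi_n$ of $F_n$ such that any two points of an atom are at distance less than $1/n$ (in the maximum metric on $\mathbb Z\times\mathbb R\times\mathbb Z_2$), and such that for every $A\in\xi_n$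 and every $c\in C_{n+1}$ (defined below) the set $Ac$ is $\xi_{n+1}$-measurable; * a finite set $D_n\subset S_n$ such that, with $f_{A,B}(x,y)=\lambda(Ax\cap By)/\lambda(F_n)$, $$\Big|\frac1{|D_n|^2}\sum_{x,y\in D_n}f_{Ag,Bh}(x,y)-\frac1{\lambda(S_n)^2}\int_{S_n}\int_{S_n}f_{Ag,Bh}\,d\lambda\,d\lambda\Big|<\frac1n$$ for all $\xi_n$-measurable $A,B\subset F_n$ and all $g,h\in F_n$ with $AgS_n\subset F_n$ and $BhS_n\subset F_n$; * a map $s_n:H_n\to D_n$ such that for every integer $N>r_n/n^2$ and all $h\ne h'$ in $H_n\cap(H_n-(N-1,0))$, $$\sum_{d,d'\in D_n}\Big|\frac1N\#\{0\le t<N: s_n(h+(t,0))=d,\ s_n(h'+(t,0))=d'\}-\frac1{|D_n|^2}\Big|<\frac1n .$$ Put $C_{n+1}=\{s_n(h)\phi_n(h):h\in H_n\}$. Let $T=(T_g)_{g\in G}$ be the $(C,F)$-action of $G$ associated with $(F_n,C_{n+1})_{n\ge1}$. That is, $X=\bigcup_n X_n$ is the inductive limit of the measure spaces $X_n=F_n\times\prod_{k>n}C_k$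 along the embeddings $(f_n,c_{n+1},c_{n+2},\dots)\mapsto(f_nc_{n+1},c_{n+2},\dots)$, where $C_k$ carries the equidistributed probability and $F_n$ carries $(|C_2|\cdots|C_n|)^{-1}\lambda$. The limit measure is multiplied by a constant so that it becomes a probability $\mu$. For $x=(f_n,c_{n+1},c_{n+2},\dots)\in X_n$ and $n$ large, $T_gx=(gf_nc_{n+1},c_{n+2},\dots)\in X_{n+1}$. Then $\mu$ is a well-defined probability measure, every $T_g$ preserves $\mu$, and the transformation $T_{(1,0,0)}$ is weakly mixing, i.e. $T_{(1,0,0)}\times T_{(1,0,0)}$ is ergodic for $\mu\times\mu$. More precisely, with $h_0=(1,0)$, the sequence $\phi_n(h_0)=(2\tilde a_n,0,0)$ is a mixing sequence for $T$: $$\mu(T_{\phi_n(h_0)}A\cap B)\to\mu(A)\mu(B)\quad\text{for all measurable }A,B\subset X.$$ -/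

import Mathlib

open MeasureTheory Set Filter Topology
open scoped Pointwise ENNReal

namespace CFMix

/-! ### Part 1. The general (C,F)-construction -/

section General

variable {Γ : Type*} [Group Γ] [MeasurableSpace Γ]

/-- The data of a (C,F)-construction in a group `Γ`: sets `F 0, F 1, ...` and finite sets
`C 0, C 1, ...`, where `C n` is the set which is traditionally written `C_{n+1}`: the disjoint
copies `F n * c`, `c ∈ C n`, of `F n` all lie in `F (n+1)`.  The last field is the condition which
makes the action everywhere defined.  (That `F` is a Følner sequence plays no part in the
construction of the space, the measure and the action, so it is not recorded here.) -/
structure CFSeq (Γ : Type*) [Group Γ] [MeasurableSpace Γ] where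
  F : ℕ → Set Γ
  C : ℕ → Finset Γ
  measurableSet_F : ∀ n, MeasurableSet (F n)
  one_lt_card : ∀ n, 1 < (C n).card
  mul_subset : ∀ n, F n * (C n : Set Γ) ⊆ F (n + 1)
  disjoint : ∀ n, ∀ c ∈ C n, ∀ c' ∈ C n, c ≠ c' → Disjoint (F n * {c}) (F n * {c'})
  gap : ∀ g : Γ, ∃ m, ∀ n, m ≤ n → {g} * F n * (C n : Set Γ) ⊆ F (n + 1)

namespace CFSeq

variable (Q : CFSeq Γ)

/-- `Q.IsPath f n` says that `f n, f (n+1), ...` are the partial products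
`f_n, f_n c_{n+1}, f_n c_{n+1} c_{n+2}, ...` of a point `(f_n, c_{n+1}, c_{n+2}, ...)` of
`X_n = F_n × C_{n+1} × C_{n+2} × ...`. -/
def IsPath (f : ℕ → Γ) (n : ℕ) : Prop :=
  ∀ k, n ≤ k → f k ∈ Q.F k ∧ ∃ c ∈ Q.C k, f (k + 1) = f k * c

/-- Two sequences of partial products define the same point of the inductive limit of
`X_0 ⊂ X_1 ⊂ ...` iff they agree eventually. -/
def pathSetoid : Setoid {f : ℕ → Γ // ∃ n, Q.IsPath f n} where
  r f f' := ∀ᶠ k in atTop, f.1 k = f'.1 k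
  iseqv :=
    { refl := fun _ => Eventually.of_forall fun _ => rfl
      symm := fun h => h.mono fun _ hk => hk.symm
      trans := fun h h' => by filter_upwards [h, h'] with k hk hk' using hk.trans hk' }

/-- The space `X = ⋃ X_n` of the (C,F)-action, the inductive limit of the spaces
`X_n = F_n × ∏_{k > n} C_k` along the embeddings
`(f_n, c_{n+1}, c_{n+2}, ...) ↦ (f_n c_{n+1}, c_{n+2}, ...)`. -/
def Space : Type _ := Quotient Q.pathSetoid

/-- `X_n = F_n × C_{n+1} × C_{n+2} × ...`. -/
abbrev Stage (n : ℕ) : Type _ := ↥(Q.F n) × ((k : ℕ) → ↥(Q.C (n + k)))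

/-- The partial products `f_n c_{n+1} ⋯ c_{n+j}` of a point of `X_n`. -/
def partialProd {n : ℕ} (x : Q.Stage n) : ℕ → Γ
  | 0 => x.1
  | j + 1 => partialProd x j * (x.2 j : Γ)

theorem partialProd_mem {n : ℕ} (x : Q.Stage n) (j : ℕ) : Q.partialProd x j ∈ Q.F (n + j) := by
  induction j with
  | zero => exact x.1.2
  | succ j ih => exact Q.mul_subset (n + j) (Set.mul_mem_mul ih (x.2 j).2)

theorem isPath_partialProd {n : ℕ} (x : Q.Stage n) :
    Q.IsPath (fun k => Q.partialProd x (k - n)) n := by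
  intro k hk
  obtain ⟨j, rfl⟩ := Nat.exists_eq_add_of_le hk
  have h1 : n + j - n = j := by omega
  have h2 : n + j + 1 - n = j + 1 := by omega
  simp only [h1, h2]
  exact ⟨Q.partialProd_mem x j, x.2 j, (x.2 j).2, rfl⟩

/-- The canonical map of `X_n` into the inductive limit. -/
def incl (n : ℕ) (x : Q.Stage n) : Q.Space :=
  Quotient.mk Q.pathSetoid ⟨fun k => Q.partialProd x (k - n), n, Q.isPath_partialProd x⟩

/-- A set `E ⊆ X` is measurable iff its trace on every `X_n` is measurable in the product
σ-algebra of `X_n`. -/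
instance : MeasurableSpace Q.Space :=
  ⨅ n, MeasurableSpace.map (Q.incl n) inferInstance

instance (n : ℕ) : Nonempty ↥(Q.C n) := by
  have h : (Q.C n).Nonempty := Finset.card_pos.1 (lt_trans zero_lt_one (Q.one_lt_card n))
  exact ⟨⟨h.choose, h.choose_spec⟩⟩

/-- The measure on `X_n`: the product of `(|C_1| ⋯ |C_n|)⁻¹ • lam` on `F_n` and of the
equidistributed probabilities on `C_{n+1}, C_{n+2}, ...`. -/
noncomputable def stageMeasure (lam : Measure Γ) (n : ℕ) : Measure (Q.Stage n) :=
  (((∏ i ∈ Finset.range n, (Q.C i).card : ℕ) : ℝ≥0∞)⁻¹ •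
      lam.comap (Subtype.val : ↥(Q.F n) → Γ)).prod
    (Measure.infinitePi fun k => (PMF.uniformOfFintype ↥(Q.C (n + k))).toMeasure)

/-- The measure on `X` before normalization: the supremum (inductive limit) of the increasing
sequence of the measures of `X_0 ⊂ X_1 ⊂ ...`. -/
noncomputable def preMeasure (lam : Measure Γ) : Measure Q.Space :=
  ⨆ n, (Q.stageMeasure lam n).map (Q.incl n)

/-- The measure on `X`, normalized to have total mass `1` (when `preMeasure` is finite). -/
noncomputable def measure (lam : Measure Γ) : Measure Q.Space :=
  (Q.preMeasure lam Set.univ)⁻¹ • Q.preMeasure lam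

theorem isPath_smul (g : Γ) {f : ℕ → Γ} {n : ℕ} (hf : Q.IsPath f n) :
    ∃ m, Q.IsPath (fun k => g * f k) m := by
  obtain ⟨m, hm⟩ := Q.gap g
  refine ⟨max m n + 1, fun k hk => ?_⟩
  obtain ⟨j, rfl⟩ : ∃ j, k = j + 1 := ⟨k - 1, by omega⟩
  have hmj : m ≤ j := le_trans (le_max_left m n) (by omega)
  have hnj : n ≤ j := le_trans (le_max_right m n) (by omega)
  obtain ⟨hfj, c, hc, hfc⟩ := hf j hnj
  obtain ⟨-, d, hd, hfd⟩ := hf (j + 1) (by omega)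
  refine ⟨?_, d, hd, ?_⟩
  · change g * f (j + 1) ∈ Q.F (j + 1)
    rw [hfc, ← mul_assoc]
    exact hm j hmj (Set.mul_mem_mul (Set.mul_mem_mul rfl hfj) hc)
  · simp only [hfd, mul_assoc]

/-- The (C,F)-action: `T_g (f_n, c_{n+1}, c_{n+2}, ...) = (g f_n c_{n+1}, c_{n+2}, ...)` for all
large `n`; on the sequences of partial products it is multiplication by `g` on the left. -/
def act (g : Γ) : Q.Space → Q.Space :=
  @Quotient.map _ _ Q.pathSetoid Q.pathSetoid
    (fun f => ⟨fun k => g * f.1 k, f.2.elim fun _ h => Q.isPath_smul g h⟩)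
    (fun _ _ h => h.mono fun _ hk => congrArg (g * ·) hk)

theorem act_one (x : Q.Space) : Q.act 1 x = x := by
  induction x using Quotient.inductionOn with
  | h f => exact Quotient.sound (s := Q.pathSetoid) (Eventually.of_forall fun _ => one_mul _)

theorem act_mul (g h : Γ) (x : Q.Space) : Q.act (g * h) x = Q.act g (Q.act h x) := by
  induction x using Quotient.inductionOn with
  | h f => exact Quotient.sound (s := Q.pathSetoid) (Eventually.of_forall fun _ => mul_assoc _ _ _)

end CFSeq

end General

/-! ### Part 2. Mixing notions -/

/-- `T` is a weakly mixing transformation of the probability space `(X, μ)`: it preserves `μ`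
and `T × T` is ergodic for `μ × μ`. -/
def WeaklyMixing {X : Type*} [MeasurableSpace X] (T : X → X) (μ : Measure X) : Prop :=
  MeasurePreserving T μ μ ∧ Ergodic (Prod.map T T) (μ.prod μ)

/-- `(g_n)` is a mixing sequence for the action `T`: `μ (T_{g_n} A ∩ B) → μ A * μ B` for all
measurable sets `A`, `B`. -/
def IsMixingSequence {Γ X : Type*} [MeasurableSpace X] (T : Γ → X → X) (μ : Measure X)
    (g : ℕ → Γ) : Prop :=
  ∀ A B : Set X, MeasurableSet A → MeasurableSet B →
    Tendsto (fun n => μ (T (g n) '' A ∩ B)) atTop (𝓝 (μ A * μ B))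

/-! ### Part 3. The group `ℤ × (ℝ ⋊ ℤ/2)` -/

/-- The underlying set of the group `G = ℤ × (ℝ ⋊ ℤ/2)`. -/
@[ext] structure G where
  z : ℤ
  t : ℝ
  e : ZMod 2

/-- The sign `(-1)^e`. -/
def sgn (e : ZMod 2) : ℝ := (-1) ^ e.val

theorem sgn_cases (e : ZMod 2) : (e = 0 ∧ sgn e = 1) ∨ (e = 1 ∧ sgn e = -1) := by
  have h : e = 0 ∨ e = 1 := by revert e; decide
  rcases h with rfl | rfl
  · left; simp [sgn]
  · right; refine ⟨rfl, ?_⟩; simp [sgn, ZMod.val_one]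

theorem sgn_add (e f : ZMod 2) : sgn (e + f) = sgn e * sgn f := by
  have h0 : sgn 0 = 1 := by simp [sgn]
  have h1 : sgn 1 = -1 := by simp [sgn, ZMod.val_one]
  have h2 : (1 : ZMod 2) + 1 = 0 := by decide
  rcases sgn_cases e with ⟨rfl, _⟩ | ⟨rfl, _⟩ <;> rcases sgn_cases f with ⟨rfl, _⟩ | ⟨rfl, _⟩ <;>
    simp [h0, h1, h2]

namespace G

/-- `(x, a, n) (y, b, m) = (x + y, a + (-1)^n b, n + m)`. -/
instance : Mul G := ⟨fun g h => ⟨g.z + h.z, g.t + sgn g.e * h.t, g.e + h.e⟩⟩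
instance : One G := ⟨⟨0, 0, 0⟩⟩
instance : Inv G := ⟨fun g => ⟨-g.z, -(sgn g.e * g.t), -g.e⟩⟩

@[simp] theorem mul_z (g h : G) : (g * h).z = g.z + h.z := rfl
@[simp] theorem mul_t (g h : G) : (g * h).t = g.t + sgn g.e * h.t := rfl
@[simp] theorem mul_e (g h : G) : (g * h).e = g.e + h.e := rfl
@[simp] theorem one_z : (1 : G).z = 0 := rfl
@[simp] theorem one_t : (1 : G).t = 0 := rfl
@[simp] theorem one_e : (1 : G).e = 0 := rfl
@[simp] theorem inv_z (g : G) : (g⁻¹).z = -g.z := rfl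
@[simp] theorem inv_t (g : G) : (g⁻¹).t = -(sgn g.e * g.t) := rfl
@[simp] theorem inv_e (g : G) : (g⁻¹).e = -g.e := rfl

instance : Group G :=
  Group.ofLeftAxioms
    (fun a b c => by
      ext <;> simp [sgn_add] <;> ring)
    (fun a => by ext <;> simp [sgn])
    (fun a => by
      have h2 : -a.e = a.e := by
        rcases sgn_cases a.e with ⟨h, _⟩ | ⟨h, _⟩ <;> rw [h] <;> decide
      ext
      · simp
      · rw [G.mul_t, G.inv_t, G.inv_e, h2, G.one_t]; ring
      · exact neg_add_cancel a.e)

instance : MeasurableSpace G :=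
  MeasurableSpace.comap (fun g : G => (g.z, g.t, g.e)) inferInstance

/-- The Haar measure of `G`: counting measure on `ℤ`, Lebesgue measure on `ℝ`, counting measure
on `ℤ/2`. -/
noncomputable def haar : Measure G :=
  Measure.sum fun p : ℤ × ZMod 2 => (volume : Measure ℝ).map fun t => (⟨p.1, t, p.2⟩ : G)

/-- The maximum metric on `ℤ × ℝ × ℤ/2`. -/
noncomputable def gdist (g h : G) : ℝ :=
  max |(g.z : ℝ) - h.z| (max |g.t - h.t| (if g.e = h.e then 0 else 1))

end G

/-! ### Part 4. The sequences `ã_n, a_n, b_n`, the sets and the homomorphisms -/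

/-- `ã_0 = 1`, `ã_n = a_n + b_n + n`, where `a_n = (2 r_{n-1} + 1) ã_{n-1}` and
`b_n = (2 n - 1) ã_{n-1}` for `n ≥ 1`. -/
def ta (r : ℕ → ℕ) : ℕ → ℕ
  | 0 => 1
  | n + 1 => (2 * r n + 1) * ta r n + (2 * n + 1) * ta r n + (n + 1)

/-- `a_n = (2 r_{n-1} + 1) ã_{n-1}` for `n ≥ 1` (the value at `0` is not used). -/
def a (r : ℕ → ℕ) : ℕ → ℕ
  | 0 => 0
  | n + 1 => (2 * r n + 1) * ta r n

/-- `b_n = (2 n - 1) ã_{n-1}` for `n ≥ 1` (the value at `0` is not used). -/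
def b (r : ℕ → ℕ) : ℕ → ℕ
  | 0 => 0
  | n + 1 => (2 * n + 1) * ta r n

theorem ta_succ (r : ℕ → ℕ) (n : ℕ) :
    ta r (n + 1) = a r (n + 1) + b r (n + 1) + (n + 1) := rfl

theorem ta_pos (r : ℕ → ℕ) (n : ℕ) : 0 < ta r n := by
  cases n with
  | zero => exact Nat.one_pos
  | succ n => rw [ta_succ]; omega

/-- `(-N, N]_ℤ × (-N, N]_ℝ × ℤ/2`. -/
def box (N : ℕ) : Set G :=
  {g | g.z ∈ Set.Ioc (-(N : ℤ)) N ∧ g.t ∈ Set.Ioc (-(N : ℝ)) N}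

/-- `H_n = {-r_n, ..., r_n}²`. -/
noncomputable def H (r : ℕ → ℕ) (n : ℕ) : Finset (ℤ × ℤ) :=
  Finset.Icc (-(r n : ℤ)) (r n) ×ˢ Finset.Icc (-(r n : ℤ)) (r n)

/-- `F_n`, for `n ≥ 1`. -/
def F (r : ℕ → ℕ) (n : ℕ) : Set G := box (a r n)

/-- `S_n`, for `n ≥ 1`. -/
def S (r : ℕ → ℕ) (n : ℕ) : Set G := box (b r n)

/-- `φ_n (i, j) = (2 i ã_n, 2 j ã_n, 0)`. -/
def phi (r : ℕ → ℕ) (n : ℕ) (h : ℤ × ℤ) : G :=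
  ⟨2 * h.1 * (ta r n : ℤ), 2 * (h.2 : ℝ) * (ta r n : ℝ), 0⟩

theorem phi_one_zero (r : ℕ → ℕ) (n : ℕ) : phi r n (1, 0) = ⟨2 * (ta r n : ℤ), 0, 0⟩ := by
  simp [phi]

open scoped Classical in
/-- The set `C_{n+1} = {s_n(h) φ_n(h) | h ∈ H_n}`. -/
noncomputable def Cnext (r : ℕ → ℕ) (s : ℕ → ℤ × ℤ → G) (n : ℕ) : Finset G :=
  (H r n).image fun h => s n h * phi r n h

/-- The function `f_{A,B}(x, y) = λ(A x ∩ B y) / λ(F_n)`. -/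
noncomputable def overlap (r : ℕ → ℕ) (n : ℕ) (A B : Set G) (x y : G) : ℝ :=
  (G.haar ((A * {x}) ∩ (B * {y}))).toReal / (G.haar (F r n)).toReal

/-- A set is `ξ`-measurable, for a finite partition `ξ`, if it is a union of atoms of `ξ`. -/
def PartMeas (ξ : Set (Set G)) (A : Set G) : Prop := ∃ P ⊆ ξ, A = ⋃₀ P

/-- All the choices on which the construction depends.  Conditions are imposed for `n ≥ 1`; the
values of `ξ`, `D`, `s` at `0` are irrelevant. -/
structure Params where
  /-- the sequence `r_n` -/
  r : ℕ → ℕ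
  /-- the partitions `ξ_n` of `F_n` -/
  ξ : ℕ → Set (Set G)
  /-- the finite sets `D_n ⊆ S_n` -/
  D : ℕ → Finset G
  /-- the maps `s_n : H_n → D_n` -/
  s : ℕ → ℤ × ℤ → G
  r_pos : ∀ n, 0 < r n
  r_strictMono : StrictMono r
  r_growth : Tendsto (fun n : ℕ => (n : ℝ) ^ 4 / (r n : ℝ)) atTop (𝓝 0)
  /- `ξ_n` is a finite measurable partition of `F_n` -/
  ξ_finite : ∀ n, 1 ≤ n → (ξ n).Finite
  ξ_measurable : ∀ n, 1 ≤ n → ∀ A ∈ ξ n, MeasurableSet A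
  ξ_nonempty : ∀ n, 1 ≤ n → ∀ A ∈ ξ n, A.Nonempty
  ξ_disjoint : ∀ n, 1 ≤ n → (ξ n).PairwiseDisjoint id
  ξ_cover : ∀ n, 1 ≤ n → ⋃₀ ξ n = F r n
  /- the atoms of `ξ_n` are smaller than `1/n` -/
  ξ_small : ∀ n, 1 ≤ n → ∀ A ∈ ξ n, ∀ g ∈ A, ∀ h ∈ A, G.gdist g h < 1 / (n : ℝ)
  /- `A c` is `ξ_{n+1}`-measurable for `A ∈ ξ_n`, `c ∈ C_{n+1}` -/
  ξ_refine : ∀ n, 1 ≤ n → ∀ A ∈ ξ n, ∀ c ∈ Cnext r s n, PartMeas (ξ (n + 1)) (A * {c})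
  D_subset : ∀ n, 1 ≤ n → (D n : Set G) ⊆ S r n
  /- averages over `D_n × D_n` approximate averages over `S_n × S_n` -/
  D_approx : ∀ n, 1 ≤ n → ∀ A B : Set G, PartMeas (ξ n) A → PartMeas (ξ n) B →
    ∀ g ∈ F r n, ∀ h ∈ F r n, A * {g} * S r n ⊆ F r n → B * {h} * S r n ⊆ F r n →
      |(1 / ((D n).card : ℝ) ^ 2) *
            ∑ x ∈ D n, ∑ y ∈ D n, overlap r n (A * {g}) (B * {h}) x y -
          (1 / (G.haar (S r n)).toReal ^ 2) *
            ∫ x in S r n, ∫ y in S r n, overlap r n (A * {g}) (B * {h}) x y ∂G.haar ∂G.haar|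
        < 1 / (n : ℝ)
  s_mem : ∀ n, 1 ≤ n → ∀ h ∈ H r n, s n h ∈ D n
  /- along long horizontal segments, the pairs `(s_n(h + (t,0)), s_n(h' + (t,0)))` are almost
  equidistributed in `D_n × D_n` -/
  s_random : ∀ n, 1 ≤ n → ∀ N : ℕ, (r n : ℝ) / (n : ℝ) ^ 2 < (N : ℝ) →
    ∀ h ∈ H r n, ∀ h' ∈ H r n, h ≠ h' →
      h + ((N : ℤ) - 1, 0) ∈ H r n → h' + ((N : ℤ) - 1, 0) ∈ H r n →
        ∑ x ∈ D n, ∑ y ∈ D n,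
          |(Set.ncard {t : ℕ | t < N ∧ s n (h + ((t : ℤ), 0)) = x ∧
                s n (h' + ((t : ℤ), 0)) = y} : ℝ) / (N : ℝ) -
              1 / ((D n).card : ℝ) ^ 2| < 1 / (n : ℝ)

/-! ### Part 5. The (C,F)-sequence and the action -/

theorem measurableSet_box (N : ℕ) : MeasurableSet (box N) := by
  refine ⟨{p | p.1 ∈ Set.Ioc (-(N : ℤ)) N ∧ p.2.1 ∈ Set.Ioc (-(N : ℝ)) N}, ?_, rfl⟩
  exact (measurable_fst measurableSet_Ioc).inter
    ((measurable_fst.comp measurable_snd) measurableSet_Ioc)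

theorem box_mul {p q : ℕ} {g h : G} (hg : g ∈ box p) (hh : h ∈ box q) : g * h ∈ box (p + q) := by
  obtain ⟨⟨h1, h2⟩, h3, h4⟩ := hg
  obtain ⟨⟨k1, k2⟩, k3, k4⟩ := hh
  refine ⟨⟨?_, ?_⟩, ?_, ?_⟩
  · push_cast; rw [G.mul_z]; linarith
  · push_cast; rw [G.mul_z]; linarith
  · push_cast; rw [G.mul_t]
    rcases sgn_cases g.e with ⟨_, h⟩ | ⟨_, h⟩ <;> rw [h] <;> linarith
  · push_cast; rw [G.mul_t]
    rcases sgn_cases g.e with ⟨_, h⟩ | ⟨_, h⟩ <;> rw [h] <;> linarith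

theorem mul_mem_box {p k : ℕ} {g h : G} (hz : |(g.z : ℝ)| ≤ k) (ht : |g.t| < k)
    (hh : h ∈ box p) : g * h ∈ box (p + k) := by
  obtain ⟨⟨k1, k2⟩, k3, k4⟩ := hh
  obtain ⟨z1, z2⟩ := abs_le.1 hz
  obtain ⟨t1, t2⟩ := abs_lt.1 ht
  have z1' : -(k : ℤ) ≤ g.z := by exact_mod_cast z1
  have z2' : g.z ≤ (k : ℤ) := by exact_mod_cast z2
  refine ⟨⟨?_, ?_⟩, ?_, ?_⟩
  · push_cast; rw [G.mul_z]; linarith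
  · push_cast; rw [G.mul_z]; linarith
  · push_cast; rw [G.mul_t]
    rcases sgn_cases g.e with ⟨_, h⟩ | ⟨_, h⟩ <;> rw [h] <;> linarith
  · push_cast; rw [G.mul_t]
    rcases sgn_cases g.e with ⟨_, h⟩ | ⟨_, h⟩ <;> rw [h] <;> linarith

theorem window_subset (r : ℕ → ℕ) (n : ℕ) {w : G} (hw : w ∈ box (ta r n)) {h : ℤ × ℤ}
    (hh : h ∈ H r n) : w * phi r n h ∈ F r (n + 1) := by
  obtain ⟨⟨h1, h2⟩, h3, h4⟩ := hw
  simp only [H, Finset.mem_product, Finset.mem_Icc] at hh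
  obtain ⟨⟨i1, i2⟩, j1, j2⟩ := hh
  have hp : (0 : ℤ) < ta r n := by exact_mod_cast ta_pos r n
  have hp' : (0 : ℝ) < ta r n := by exact_mod_cast ta_pos r n
  have j1' : -(r n : ℝ) ≤ (h.2 : ℝ) := by exact_mod_cast j1
  have j2' : (h.2 : ℝ) ≤ (r n : ℝ) := by exact_mod_cast j2
  have e1 := mul_le_mul_of_nonneg_right i1 hp.le
  have e2 := mul_le_mul_of_nonneg_right i2 hp.le
  have e3 := mul_le_mul_of_nonneg_right j1' hp'.le
  have e4 := mul_le_mul_of_nonneg_right j2' hp'.le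
  refine ⟨⟨?_, ?_⟩, ?_, ?_⟩
  · simp only [a, G.mul_z, phi]; push_cast; linarith
  · simp only [a, G.mul_z, phi]; push_cast; linarith
  · simp only [a, G.mul_t, phi]; push_cast
    rcases sgn_cases w.e with ⟨_, h⟩ | ⟨_, h⟩ <;> rw [h] <;> linarith
  · simp only [a, G.mul_t, phi]; push_cast
    rcases sgn_cases w.e with ⟨_, h⟩ | ⟨_, h⟩ <;> rw [h] <;> linarith

theorem window_unique_aux {N : ℕ} {x y : ℝ} {i j : ℤ} (hx : x ∈ Set.Ioc (-(N : ℝ)) N)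
    (hy : y ∈ Set.Ioc (-(N : ℝ)) N) (h : x + 2 * i * N = y + 2 * j * N) : i = j := by
  have hN : (0 : ℝ) < N := by linarith [hx.1, hx.2]
  have key : ∀ {x y : ℝ} {i j : ℤ}, x ∈ Set.Ioc (-(N : ℝ)) N → y ∈ Set.Ioc (-(N : ℝ)) N →
      x + 2 * i * N = y + 2 * j * N → i ≤ j := by
    intro x y i j hx hy h
    by_contra hij
    have h1 : (j : ℝ) + 1 ≤ i := by exact_mod_cast (not_le.1 hij)
    have h2 := mul_le_mul_of_nonneg_right h1 hN.le
    linarith [hx.1, hy.2]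
  exact le_antisymm (key hx hy h) (key hy hx h.symm)

theorem window_unique (r : ℕ → ℕ) (n : ℕ) {w w' : G} (hw : w ∈ box (ta r n))
    (hw' : w' ∈ box (ta r n)) {h h' : ℤ × ℤ} (heq : w * phi r n h = w' * phi r n h') :
    h = h' := by
  have ez := congrArg G.z heq
  have et := congrArg G.t heq
  have ee := congrArg G.e heq
  simp only [G.mul_z, G.mul_t, G.mul_e, phi, add_zero] at ez et ee
  have ez' : (w.z : ℝ) + 2 * h.1 * (ta r n : ℕ) = w'.z + 2 * h'.1 * (ta r n : ℕ) := by
    exact_mod_cast ez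
  have c1 : (w.z : ℝ) ∈ Set.Ioc (-((ta r n : ℕ) : ℝ)) (ta r n : ℕ) :=
    ⟨by exact_mod_cast hw.1.1, by exact_mod_cast hw.1.2⟩
  have c2 : (w'.z : ℝ) ∈ Set.Ioc (-((ta r n : ℕ) : ℝ)) (ta r n : ℕ) :=
    ⟨by exact_mod_cast hw'.1.1, by exact_mod_cast hw'.1.2⟩
  refine Prod.ext (window_unique_aux c1 c2 ez') ?_
  rw [ee] at et
  rcases sgn_cases w'.e with ⟨_, hs⟩ | ⟨_, hs⟩ <;> rw [hs] at et
  · exact window_unique_aux hw.2 hw'.2 (by linarith)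
  · exact (window_unique_aux hw'.2 hw.2 (i := h.2) (j := h'.2) (by linarith))

theorem one_mem_box {N : ℕ} (hN : 0 < N) : (1 : G) ∈ box N := by
  have h1 : (0 : ℤ) < N := by exact_mod_cast hN
  have h2 : (0 : ℝ) < N := by exact_mod_cast hN
  refine ⟨⟨?_, ?_⟩, ?_, ?_⟩ <;> simp only [G.one_z, G.one_t] <;> linarith

namespace Params

variable (P : Params)

theorem mul_s_mem {n : ℕ} {k : ℕ} (hk : k ≤ n + 1) {f : G} (hf : f ∈ box (a P.r (n + 1) + k))
    {h : ℤ × ℤ} (hh : h ∈ H P.r (n + 1)) : f * P.s (n + 1) h ∈ box (ta P.r (n + 1)) := by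
  have hs : P.s (n + 1) h ∈ box (b P.r (n + 1)) :=
    P.D_subset (n + 1) (by omega) (P.s_mem (n + 1) (by omega) h hh)
  have h1 := box_mul hf hs
  have hle : a P.r (n + 1) + k + b P.r (n + 1) ≤ ta P.r (n + 1) := by rw [ta_succ]; omega
  have hle1 : ((a P.r (n + 1) + k + b P.r (n + 1) : ℕ) : ℤ) ≤ (ta P.r (n + 1) : ℕ) := by
    exact_mod_cast hle
  have hle2 : ((a P.r (n + 1) + k + b P.r (n + 1) : ℕ) : ℝ) ≤ (ta P.r (n + 1) : ℕ) := by
    exact_mod_cast hle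
  exact ⟨⟨by linarith [h1.1.1], by linarith [h1.1.2]⟩, by linarith [h1.2.1], by linarith [h1.2.2]⟩

theorem a_pos (n : ℕ) : 0 < a P.r (n + 1) := Nat.mul_pos (by omega) (ta_pos _ _)

theorem unique_index {n : ℕ} {f f' : G} (hf : f ∈ F P.r (n + 1)) (hf' : f' ∈ F P.r (n + 1))
    {h h' : ℤ × ℤ} (hh : h ∈ H P.r (n + 1)) (hh' : h' ∈ H P.r (n + 1))
    (heq : f * (P.s (n + 1) h * phi P.r (n + 1) h) =
      f' * (P.s (n + 1) h' * phi P.r (n + 1) h')) : h = h' := by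
  rw [← mul_assoc, ← mul_assoc] at heq
  exact window_unique P.r (n + 1) (P.mul_s_mem (k := 0) (by omega) hf hh)
    (P.mul_s_mem (k := 0) (by omega) hf' hh') heq

/-- The sequence `(F_n, C_{n+1})_{n ≥ 1}`.  The first term is `(F_1, C_2)`: as `X_0 ⊂ X_1`,
starting at `n = 1` gives the same inductive limit. -/
noncomputable def cf : CFSeq G where
  F n := F P.r (n + 1)
  C n := Cnext P.r P.s (n + 1)
  measurableSet_F n := measurableSet_box _
  one_lt_card n := by
    classical
    have h0 : ((0, 0) : ℤ × ℤ) ∈ H P.r (n + 1) := by simp [H]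
    have h1 : ((1, 0) : ℤ × ℤ) ∈ H P.r (n + 1) := by
      have := P.r_pos (n + 1)
      simp only [H, Finset.mem_product, Finset.mem_Icc]
      omega
    refine Finset.one_lt_card.2 ⟨_, Finset.mem_image_of_mem _ h0, _,
      Finset.mem_image_of_mem _ h1, fun heq => ?_⟩
    have h1F : (1 : G) ∈ F P.r (n + 1) := one_mem_box (P.a_pos n)
    have := P.unique_index h1F h1F h0 h1 (by rw [heq])
    simp at this
  mul_subset n := by
    classical
    rintro _ ⟨f, hf, c, hc, rfl⟩
    obtain ⟨h, hh, rfl⟩ := Finset.mem_image.1 (Finset.mem_coe.1 hc)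
    have := window_subset P.r (n + 1) (P.mul_s_mem (k := 0) (by omega) hf hh) hh
    rw [mul_assoc] at this
    exact this
  disjoint n c hc c' hc' hne := by
    classical
    obtain ⟨h, hh, rfl⟩ := Finset.mem_image.1 hc
    obtain ⟨h', hh', rfl⟩ := Finset.mem_image.1 hc'
    refine Set.disjoint_left.2 ?_
    rintro _ ⟨f, hf, _, rfl, rfl⟩ ⟨f', hf', _, rfl, heq⟩
    have := P.unique_index hf' hf hh' hh heq
    subst this
    exact hne rfl
  gap g := by
    classical
    obtain ⟨m, hm⟩ := exists_nat_gt (max |(g.z : ℝ)| |g.t|)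
    have hz : |(g.z : ℝ)| ≤ m := (lt_of_le_of_lt (le_max_left _ _) hm).le
    have ht : |g.t| < m := lt_of_le_of_lt (le_max_right _ _) hm
    refine ⟨m, fun n hn => ?_⟩
    rintro _ ⟨_, ⟨_, rfl, f, hf, rfl⟩, c, hc, rfl⟩
    obtain ⟨h, hh, rfl⟩ := Finset.mem_image.1 (Finset.mem_coe.1 hc)
    have := window_subset P.r (n + 1)
      (P.mul_s_mem (k := m) (by omega) (mul_mem_box hz ht hf) hh) hh
    rw [mul_assoc] at this
    exact this

/-- The space `X` of the action. -/
abbrev X : Type := P.cf.Space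

/-- The probability `μ` on `X`. -/
noncomputable def μ : Measure P.X := P.cf.measure G.haar

/-- The action `T = (T_g)_{g ∈ G}`. -/
noncomputable def T (g : G) : P.X → P.X := P.cf.act g

end Params

end CFMix

/-!
The points `(f_n, c_{n+1}, ...)` of `X_n` with `f_n ∈ A` form the cylinder set `[A]_n`, of measure
proportional to `λ(A ∩ F_n)` (`CFSeq.preMeasure_cyl`). Cylinder sets generate the σ-algebra of `X`
and form a π-system, and `T_g [A]_n = [g A]_n` as long as `g A` stays in `F_n`
(`CFSeq.act_image_cyl`); as `λ` is left invariant, `μ` is invariant. The growth condition makes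
`∑ n / r_{n-1}` finite, hence `μ` finite (`Params.preMeasure_univ_ne_top`).

By a λ-system argument, mixing along `φ_n(1, 0)` may be tested on cylinder sets `[A]_m`, `[B]_m`
with `A`, `B` in a generating π-system, here the sets with thin boundary in the real direction
(`thinBdry`). Such cylinder sets are described at level `n` by subsets `A_n`, `B_n` of `F_n`, with
`λ(A_n) / λ(F_n) → μ([A]_m)`. The set `F_{n+1}` is tiled by windows indexed by `H_n`, and the copy
of `A_n` in the window `h` is translated by `s_n(h)`. Since `φ_n(1, 0)` is central, `T_{φ_n(1,0)}`
moves the window `h` to the window `h + (1, 0)`, so that, up to the last column of windows,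
`μ(T_{φ_n(1,0)} [A]_m ∩ [B]_m)` is the mean over `h` of the overlap of `A_n s_n(h)` and
`B_n s_n(h + (1, 0))` (`Params.abs_μ_real_shift_sub_le`). By the randomness of `s_n` along the rows
of `H_n` this is close to the mean overlap of `A_n x` and `B_n y` over `x, y ∈ D_n`
(`Params.abs_sum_shiftH_sub_avgD_le`), and by the choice of `D_n` to the mean over `x, y ∈ S_n`
(`Params.abs_avgD_sub_avgS_atomApprox_lt`); the latter applies to unions of atoms of `ξ_n`, and
these approximate `A_n`, `B_n` because their boundaries are thin.

It remains to see that the mean over `S_n × S_n` is close to the product of the relative measures.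
By Tonelli's theorem this holds if every point of `F_n` lies in `B_n y` for a proportion of about
`μ([B]_m)` of the `y ∈ S_n`, and an upper bound for this proportion suffices, as it can be applied
to the complement of `A_n x` too (`avgS_overlap_mem_Icc`). Now `B_n = B_{n-1} C_n`, and `S_n` is so
wide that a translate of it meets about `(2 n - 1)²` windows of side `2 ã_{n-1}`, at most `(2 n)²`
of them (`Params.haar_real_hit_le`). The group element `(x, a, 1)` reflects the line, so the windows
which count are not the same in the two cosets of `ℤ × ℝ`, and the bound involves the larger of the
measures of the parts of `B_{n-1}` in the two cosets. These parts are almost equally large: the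
condition on `D_n`, applied to the two cosets themselves, forces `D_n` to be balanced between them
(`Params.fracD_mul_ge`), hence so are the values of `s_n`, and thereby every set of the form
`A C_{n+1}` (`Params.haar_real_sheet_mul_Cnext_le`).

Finally `φ_n(1, 0)` is a power of `(1, 0, 0)`, and a transformation with a mixing sequence of powers
is weakly mixing (`ergodic_prodMap_of_tendsto`).
-/

namespace CFMix

namespace CFSeq

/-! ### Cylinder sets of a (C,F)-space -/

section Cylinders

variable {Γ : Type*} [Group Γ] [MeasurableSpace Γ] (Q : CFSeq Γ)

/-- The cylinder set `[A]_n`: the points of `X_n` whose first coordinate lies in `A`. Only the part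
of `A` inside `F n` matters. -/
def cyl (n : ℕ) (A : Set Γ) : Set Q.Space := Q.incl n '' {x | (x.1 : Γ) ∈ A}

/-- The set `(A ∩ F_m) C_{m+1} ⋯ C_{m+j}`, which describes the cylinder set `[A]_m` at level
`m + j`. -/
def lift (m : ℕ) (A : Set Γ) : ℕ → Set Γ
  | 0 => A ∩ Q.F m
  | j + 1 => lift m A j * (Q.C (m + j) : Set Γ)

variable {Q}

theorem IsPath.mono {f : ℕ → Γ} {n m : ℕ} (h : Q.IsPath f n) (hnm : n ≤ m) : Q.IsPath f m :=
  fun k hk => h k (hnm.trans hk)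

theorem IsPath.exists_stage {f : ℕ → Γ} {n : ℕ} (h : Q.IsPath f n) :
    ∃ x : Q.Stage n, ∀ j, Q.partialProd x j = f (n + j) := by
  choose c hc using fun j : ℕ => (h (n + j) (Nat.le_add_right n j)).2
  refine ⟨(⟨f n, (h n le_rfl).1⟩, fun j => ⟨c j, (hc j).1⟩), fun j => ?_⟩
  induction j with
  | zero => rfl
  | succ j ih =>
    change Q.partialProd _ j * c j = f (n + j + 1)
    rw [ih, (hc j).2]

theorem incl_eq_mk {f : ℕ → Γ} {n : ℕ} {h : ∃ n, Q.IsPath f n} {x : Q.Stage n}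
    (hx : ∀ j, Q.partialProd x j = f (n + j)) :
    Q.incl n x = Quotient.mk Q.pathSetoid ⟨f, h⟩ := by
  refine Quotient.sound (s := Q.pathSetoid) ?_
  filter_upwards [eventually_ge_atTop n] with k hk
  rw [hx, Nat.add_sub_cancel' hk]

/-- The copies `F_n c`, `c ∈ C_n`, are disjoint, so `f` and `c` can be read off from `f c`. -/
theorem mul_inj {n : ℕ} {f f' c c' : Γ} (hf : f ∈ Q.F n) (hf' : f' ∈ Q.F n) (hc : c ∈ Q.C n)
    (hc' : c' ∈ Q.C n) (h : f * c = f' * c') : f = f' ∧ c = c' := by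
  have hcc : c = c' := by
    by_contra hne
    exact Set.disjoint_left.1 (Q.disjoint n c hc c' hc' hne) ⟨f, hf, c, rfl, rfl⟩
      ⟨f', hf', c', rfl, h.symm⟩
  subst hcc
  exact ⟨mul_right_cancel h, rfl⟩

/-- Once the partial products of two points of `X_n` agree, all earlier ones agree by `mul_inj`. -/
theorem incl_injective (n : ℕ) : Function.Injective (Q.incl n) := by
  intro x y hxy
  have hev : ∀ᶠ k in atTop, Q.partialProd x (k - n) = Q.partialProd y (k - n) :=
    Quotient.exact (s := Q.pathSetoid) hxy
  obtain ⟨K, hK⟩ := eventually_atTop.1 hev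
  have step : ∀ j, Q.partialProd x (j + 1) = Q.partialProd y (j + 1) →
      Q.partialProd x j = Q.partialProd y j ∧ (x.2 j : Γ) = y.2 j := fun j hj =>
    mul_inj (Q.partialProd_mem x j) (Q.partialProd_mem y j) (x.2 j).2 (y.2 j).2 hj
  have down : ∀ d j, Q.partialProd x (j + d) = Q.partialProd y (j + d) →
      Q.partialProd x j = Q.partialProd y j := by
    intro d
    induction d with
    | zero => exact fun j h => h
    | succ d ih => exact fun j h => ih j (step (j + d) h).1
  have all : ∀ j, Q.partialProd x j = Q.partialProd y j := by
    intro j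
    refine down K j ?_
    have h := hK (n + (j + K)) (by omega)
    rwa [Nat.add_sub_cancel_left] at h
  refine Prod.ext (Subtype.ext (all 0)) (funext fun j => Subtype.ext (step j (all (j + 1))).2)

theorem mem_cyl_iff {n : ℕ} {A : Set Γ} {p : Q.Space} : p ∈ Q.cyl n A ↔
    ∃ f : ℕ → Γ, ∃ h : Q.IsPath f n, f n ∈ A ∧ Quotient.mk Q.pathSetoid ⟨f, n, h⟩ = p := by
  constructor
  · rintro ⟨x, hx, rfl⟩
    refine ⟨_, Q.isPath_partialProd x, ?_, rfl⟩
    rw [Nat.sub_self]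
    exact hx
  · rintro ⟨f, h, hA, rfl⟩
    obtain ⟨x, hx⟩ := h.exists_stage
    refine ⟨x, ?_, incl_eq_mk hx⟩
    have := hx 0
    change (x.1 : Γ) = f n at this
    exact (this.symm ▸ hA : (x.1 : Γ) ∈ A)

theorem mk_mem_cyl_iff {n : ℕ} {A : Set Γ} {f : ℕ → Γ} (h : Q.IsPath f n) :
    Quotient.mk Q.pathSetoid ⟨f, n, h⟩ ∈ Q.cyl n A ↔ f n ∈ A := by
  refine ⟨?_, fun hA => mem_cyl_iff.2 ⟨f, h, hA, rfl⟩⟩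
  rintro ⟨x, hx, hxe⟩
  obtain ⟨y, hy⟩ := h.exists_stage
  have hxy : x = y := incl_injective n (hxe.trans (incl_eq_mk hy).symm)
  subst hxy
  have := hy 0
  change (x.1 : Γ) = f n at this
  rwa [← this]

theorem cyl_inter (n : ℕ) (A B : Set Γ) : Q.cyl n A ∩ Q.cyl n B = Q.cyl n (A ∩ B) :=
  (Set.image_inter (incl_injective n)).symm

theorem cyl_inter_F (n : ℕ) (A : Set Γ) : Q.cyl n (A ∩ Q.F n) = Q.cyl n A := by
  refine congrArg (Q.incl n '' ·) (Set.ext fun x => ?_)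
  exact ⟨fun h => h.1, fun h => ⟨h, x.1.2⟩⟩

theorem cyl_mono {n : ℕ} {A B : Set Γ} (h : A ⊆ B) : Q.cyl n A ⊆ Q.cyl n B :=
  Set.image_mono fun _ hx => h hx

theorem cyl_iUnion {ι : Sort*} (n : ℕ) (A : ι → Set Γ) :
    Q.cyl n (⋃ i, A i) = ⋃ i, Q.cyl n (A i) := by
  rw [cyl, show {x : Q.Stage n | (x.1 : Γ) ∈ ⋃ i, A i} = ⋃ i, {x | (x.1 : Γ) ∈ A i} by
    ext; simp, Set.image_iUnion]
  rfl

theorem cyl_compl (n : ℕ) (A : Set Γ) : Q.cyl n Aᶜ = Q.cyl n univ \ Q.cyl n A := by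
  rw [cyl, cyl, cyl, ← Set.image_sdiff (incl_injective n)]
  congr 1
  ext
  simp

theorem cyl_eq_succ (n : ℕ) (A : Set Γ) :
    Q.cyl n A = Q.cyl (n + 1) ((A ∩ Q.F n) * (Q.C n : Set Γ)) := by
  ext p
  rw [mem_cyl_iff, mem_cyl_iff]
  constructor
  · rintro ⟨f, h, hA, rfl⟩
    obtain ⟨hF, c, hc, hfc⟩ := h n le_rfl
    exact ⟨f, h.mono n.le_succ, ⟨f n, ⟨hA, hF⟩, c, hc, hfc.symm⟩, rfl⟩
  · rintro ⟨f, h, ⟨a, ⟨hA, hF⟩, c, hc, hac⟩, rfl⟩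
    have hg : Q.IsPath (Function.update f n a) n := by
      intro k hk
      rcases hk.eq_or_lt with rfl | hk
      · refine ⟨by simpa using hF, c, hc, ?_⟩
        simpa using hac.symm
      · rw [Function.update_of_ne (by omega), Function.update_of_ne (by omega)]
        exact h k hk
    refine ⟨_, hg, by simpa using hA, Quotient.sound (s := Q.pathSetoid) ?_⟩
    filter_upwards [eventually_gt_atTop n] with k hk
    exact Function.update_of_ne (by omega) _ _

theorem lift_subset (m : ℕ) (A : Set Γ) (j : ℕ) : Q.lift m A j ⊆ Q.F (m + j) := by
  induction j with
  | zero => exact inter_subset_right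
  | succ j ih => exact (Set.mul_subset_mul_right ih).trans (Q.mul_subset (m + j))

theorem cyl_lift (m : ℕ) (A : Set Γ) (j : ℕ) : Q.cyl (m + j) (Q.lift m A j) = Q.cyl m A := by
  induction j with
  | zero => exact cyl_inter_F m A
  | succ j ih =>
    rw [← ih, cyl_eq_succ (m + j), inter_eq_left.2 (lift_subset m A j)]
    rfl

theorem preimage_incl_cyl (n j : ℕ) (A : Set Γ) :
    Q.incl n ⁻¹' Q.cyl (n + j) A = {x | Q.partialProd x j ∈ A} := by
  ext x
  have h := (Q.isPath_partialProd x).mono (Nat.le_add_right n j)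
  have := mk_mem_cyl_iff (A := A) h
  simp only [Nat.add_sub_cancel_left] at this
  exact this

/-- Every point of `X` lies in some `X_n`. -/
theorem iUnion_cyl_univ : ⋃ n, Q.cyl n univ = univ := by
  refine eq_univ_of_forall fun p => ?_
  induction p using Quotient.inductionOn with
  | h f =>
    obtain ⟨f, n, h⟩ := f
    exact mem_iUnion.2 ⟨n, mem_cyl_iff.2 ⟨f, h, mem_univ _, rfl⟩⟩

theorem monotone_cyl_univ : Monotone fun n => Q.cyl n univ := by
  refine monotone_nat_of_le_succ fun n => ?_
  rw [cyl_eq_succ]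
  exact cyl_mono (subset_univ _)

theorem act_image_eq_preimage (g : Γ) (E : Set Q.Space) : Q.act g '' E = Q.act g⁻¹ ⁻¹' E := by
  refine congrFun (Set.image_eq_preimage_of_inverse (fun x => ?_) (fun x => ?_)) E
  · rw [← act_mul, inv_mul_cancel, act_one]
  · rw [← act_mul, mul_inv_cancel, act_one]

theorem act_image_cyl_subset {g : Γ} {n : ℕ} {A : Set Γ} (hgA : ∀ x ∈ A, g * x ∈ Q.F n) :
    Q.act g '' Q.cyl n A ⊆ Q.cyl n ({g} * A) := by
  rintro _ ⟨p, hp, rfl⟩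
  obtain ⟨f, h, hA, rfl⟩ := mem_cyl_iff.1 hp
  -- Once `g f_n` lies in `F_n`, the later partial products `g f_k` lie in `F_k` as well.
  have hF : ∀ j, g * f (n + j) ∈ Q.F (n + j) := by
    intro j
    induction j with
    | zero => exact hgA _ hA
    | succ j ih =>
      obtain ⟨-, c, hc, hfc⟩ := h (n + j) (Nat.le_add_right n j)
      rw [← add_assoc, hfc, ← mul_assoc]
      exact Q.mul_subset (n + j) (Set.mul_mem_mul ih hc)
  have hg : Q.IsPath (fun k => g * f k) n := by
    intro k hk
    obtain ⟨j, rfl⟩ := Nat.exists_eq_add_of_le hk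
    obtain ⟨-, c, hc, hfc⟩ := h (n + j) hk
    exact ⟨hF j, c, hc, by simp only [hfc, mul_assoc]⟩
  exact mem_cyl_iff.2 ⟨_, hg, ⟨g, rfl, f n, hA, rfl⟩, rfl⟩

/-- As long as `g A` stays inside `F_n`, the action moves `[A]_n` to `[g A]_n`. -/
theorem act_image_cyl {g : Γ} {n : ℕ} {A : Set Γ} (hA : A ⊆ Q.F n)
    (hgA : ∀ x ∈ A, g * x ∈ Q.F n) : Q.act g '' Q.cyl n A = Q.cyl n ({g} * A) := by
  refine (act_image_cyl_subset hgA).antisymm ?_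
  have h := act_image_cyl_subset (Q := Q) (g := g⁻¹) (n := n) (A := {g} * A) (by
    rintro _ ⟨_, rfl, x, hx, rfl⟩
    simpa using hA hx)
  rw [← mul_assoc, Set.singleton_mul_singleton, inv_mul_cancel, Set.singleton_one, one_mul,
    act_image_eq_preimage, inv_inv] at h
  intro p hp
  have hinv : Q.act g (Q.act g⁻¹ p) = p := by rw [← act_mul, mul_inv_cancel, act_one]
  refine ⟨Q.act g⁻¹ p, h ?_, hinv⟩
  rwa [mem_preimage, hinv]

/-- For large `n` the set `g (A ∩ F_n) C_{n+1}` lies in `F_{n+1}`, so the image of `[A]_n` under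
`T_g` can be read off at level `n + 1`. -/
theorem exists_act_image_cyl (g : Γ) : ∃ m, ∀ n, m ≤ n → ∀ A : Set Γ,
    {g} * ((A ∩ Q.F n) * (Q.C n : Set Γ)) ⊆ Q.F (n + 1) ∧
      Q.act g '' Q.cyl n A = Q.cyl (n + 1) ({g} * ((A ∩ Q.F n) * (Q.C n : Set Γ))) := by
  obtain ⟨m, hm⟩ := Q.gap g
  refine ⟨m, fun n hn A => ?_⟩
  have hsub : ∀ x ∈ (A ∩ Q.F n) * (Q.C n : Set Γ), g * x ∈ Q.F (n + 1) := by
    rintro _ ⟨a, ha, c, hc, rfl⟩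
    refine hm n hn ?_
    exact ⟨g * a, ⟨g, rfl, a, ha.2, rfl⟩, c, hc, by simp [mul_assoc]⟩
  constructor
  · rintro _ ⟨_, rfl, x, hx, rfl⟩
    exact hsub x hx
  · rw [cyl_eq_succ n A]
    exact act_image_cyl ((Set.mul_subset_mul_right inter_subset_right).trans (Q.mul_subset n)) hsub

end Cylinders

/-! ### The measurable structure of a (C,F)-space -/

section Measurable

variable {Γ : Type*} [Group Γ] [MeasurableSpace Γ] {Q : CFSeq Γ}

theorem measurableSet_space_iff {E : Set Q.Space} :
    MeasurableSet E ↔ ∀ n, MeasurableSet (Q.incl n ⁻¹' E) := by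
  change MeasurableSet[⨅ n, MeasurableSpace.map (Q.incl n) inferInstance] E ↔ _
  rw [MeasurableSpace.measurableSet_iInf]
  rfl

theorem measurable_incl (n : ℕ) : Measurable (Q.incl n) := fun _ hE =>
  measurableSet_space_iff.1 hE n

/-- A cylinder set can be described at every later level, by a set of the same class `𝓑`. -/
theorem exists_cyl_eq_of_le {𝓑 : Set (Set Γ)} (hF : ∀ n, ∀ A ∈ 𝓑, A ∩ Q.F n ∈ 𝓑)
    (hC : ∀ n, ∀ A ∈ 𝓑, A * (Q.C n : Set Γ) ∈ 𝓑) {m k : ℕ} (hmk : m ≤ k) {A : Set Γ}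
    (hA : A ∈ 𝓑) : ∃ A' ∈ 𝓑, A' ⊆ Q.F k ∧ Q.cyl m A = Q.cyl k A' := by
  obtain ⟨j, rfl⟩ := Nat.exists_eq_add_of_le hmk
  refine ⟨Q.lift m A j, ?_, lift_subset m A j, (cyl_lift m A j).symm⟩
  clear hmk
  induction j with
  | zero => exact hF m A hA
  | succ j ih => exact hC _ _ ih

theorem isPiSystem_cyl {𝓑 : Set (Set Γ)} (hF : ∀ n, ∀ A ∈ 𝓑, A ∩ Q.F n ∈ 𝓑)
    (hC : ∀ n, ∀ A ∈ 𝓑, A * (Q.C n : Set Γ) ∈ 𝓑) (hinter : ∀ A ∈ 𝓑, ∀ B ∈ 𝓑, A ∩ B ∈ 𝓑) :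
    IsPiSystem {E | ∃ n, ∃ A ∈ 𝓑, E = Q.cyl n A} := by
  rintro _ ⟨m, A, hA, rfl⟩ _ ⟨n, B, hB, rfl⟩ -
  obtain ⟨A', hA', -, h1⟩ := exists_cyl_eq_of_le hF hC (le_max_left m n) hA
  obtain ⟨B', hB', -, h2⟩ := exists_cyl_eq_of_le hF hC (le_max_right m n) hB
  exact ⟨_, _, hinter _ hA' _ hB', by rw [h1, h2, cyl_inter]⟩

variable [MeasurableMul Γ]

theorem _root_.MeasurableSet.mul_singleton_right {A : Set Γ} (hA : MeasurableSet A) (c : Γ) :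
    MeasurableSet (A * {c}) := by
  rw [Set.mul_singleton, Set.image_mul_right]
  exact measurable_mul_const _ hA

theorem _root_.MeasurableSet.mul_finset {A : Set Γ} (hA : MeasurableSet A) (C : Finset Γ) :
    MeasurableSet (A * (C : Set Γ)) := by
  rw [← Set.iUnion_mul_right_image]
  refine Finset.measurableSet_biUnion C fun c _ => ?_
  have := hA.mul_singleton_right c
  rwa [Set.mul_singleton] at this

theorem measurableSet_lift (m : ℕ) {A : Set Γ} (hA : MeasurableSet A) (j : ℕ) :
    MeasurableSet (Q.lift m A j) := by
  induction j with
  | zero => exact hA.inter (Q.measurableSet_F m)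
  | succ j ih => exact ih.mul_finset _

variable [MeasurableSingletonClass Γ]

theorem measurable_partialProd (n j : ℕ) :
    Measurable fun x : Q.Stage n => Q.partialProd x j := by
  induction j with
  | zero => exact measurable_subtype_coe.comp measurable_fst
  | succ j ih =>
    have h : Measurable fun p : Γ × ↥(Q.C (n + j)) => p.1 * (p.2 : Γ) :=
      measurable_from_prod_countable_left fun c => measurable_mul_const (c : Γ)
    exact h.comp (ih.prodMk ((measurable_pi_apply j).comp measurable_snd))

theorem measurableSet_cyl (n : ℕ) {A : Set Γ} (hA : MeasurableSet A) :
    MeasurableSet (Q.cyl n A) := by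
  refine measurableSet_space_iff.2 fun k => ?_
  rw [← cyl_lift n A k, Nat.add_comm n k, preimage_incl_cyl]
  exact measurable_partialProd k n (measurableSet_lift n hA k)

/-- The σ-algebra of the inductive limit is generated by the cylinder sets over any class which
generates the σ-algebra of the group. -/
theorem measurableSpace_eq_generateFrom {𝓑 : Set (Set Γ)}
    (hgen : ‹MeasurableSpace Γ› = MeasurableSpace.generateFrom 𝓑) (huniv : univ ∈ 𝓑) :
    (inferInstance : MeasurableSpace Q.Space) =
      MeasurableSpace.generateFrom {E | ∃ n, ∃ A ∈ 𝓑, E = Q.cyl n A} := by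
  set σ := MeasurableSpace.generateFrom {E | ∃ n, ∃ A ∈ 𝓑, E = Q.cyl n A} with hσ
  have hbasic : ∀ n, ∀ A ∈ 𝓑, MeasurableSet[σ] (Q.cyl n A) := fun n A hA =>
    MeasurableSpace.measurableSet_generateFrom ⟨n, A, hA, rfl⟩
  have hcyl : ∀ n, ∀ A, MeasurableSet A → MeasurableSet[σ] (Q.cyl n A) := by
    intro n A hA
    rw [hgen] at hA
    induction A, hA using MeasurableSpace.generateFrom_induction with
    | hC A hA _ => exact hbasic n A hA
    | empty => simp [cyl]
    | compl A _ ih =>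
      rw [cyl_compl]
      exact MeasurableSet.diff (hbasic n _ huniv) ih
    | iUnion A _ ih =>
      rw [cyl_iUnion]
      exact MeasurableSet.iUnion ih
  refine le_antisymm (fun E hE => ?_) ?_
  · -- The coordinates of `X_n` are measurable for the σ-algebra induced by the cylinder sets.
    have hstage : ∀ n, (inferInstance : MeasurableSpace (Q.Stage n)) ≤ σ.comap (Q.incl n) := by
      intro n
      have hpp : ∀ j, ∀ A, MeasurableSet A →
          MeasurableSet[σ.comap (Q.incl n)] {x | Q.partialProd x j ∈ A} := fun j A hA =>
        ⟨_, hcyl (n + j) A hA, preimage_incl_cyl n j A⟩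
      have h1 : Measurable[σ.comap (Q.incl n)] fun x : Q.Stage n => x.1 := by
        refine Measurable.subtype_mk (f := fun x : Q.Stage n => (x.1 : Γ)) ?_
        exact fun A hA => hpp 0 A hA
      have h2 : Measurable[σ.comap (Q.incl n)] fun x : Q.Stage n => x.2 := by
        refine @measurable_pi_iff _ _ _ (σ.comap (Q.incl n)) _ _ |>.2 fun j => ?_
        refine @measurable_to_countable' _ _ _ _ (σ.comap (Q.incl n)) _ fun c => ?_
        have : (fun x : Q.Stage n => x.2 j) ⁻¹' {c} =
            {x | Q.partialProd x (j + 1) ∈ Q.F (n + j) * {(c : Γ)}} := by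
          ext x
          constructor
          · rintro rfl
            exact ⟨_, Q.partialProd_mem x j, _, rfl, rfl⟩
          · rintro ⟨f, hf, _, rfl, h⟩
            exact Subtype.ext
              (mul_inj hf (Q.partialProd_mem x j) c.2 (x.2 j).2 h).2.symm
        rw [this]
        exact hpp (j + 1) _ ((Q.measurableSet_F _).mul_singleton_right _)
      exact sup_le h1.comap_le h2.comap_le
    have hE' : E = ⋃ n, E ∩ Q.cyl n univ := by
      rw [← inter_iUnion, iUnion_cyl_univ, inter_univ]
    rw [hE']
    refine MeasurableSet.iUnion fun n => ?_
    obtain ⟨U, hU, hUE⟩ := hstage n _ (measurableSet_space_iff.1 hE n)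
    have : E ∩ Q.cyl n univ = U ∩ Q.cyl n univ := by
      ext p
      refine and_congr_left ?_
      rintro ⟨x, -, rfl⟩
      exact (Set.ext_iff.1 hUE x).symm
    rw [this]
    exact hU.inter (hcyl n _ MeasurableSet.univ)
  · refine MeasurableSpace.generateFrom_le ?_
    rintro _ ⟨n, A, hA, rfl⟩
    refine measurableSet_cyl n ?_
    rw [hgen]
    exact MeasurableSpace.measurableSet_generateFrom hA

theorem measurable_act (g : Γ) : Measurable (Q.act g) := by
  have hgen := measurableSpace_eq_generateFrom (Q := Q) (𝓑 := {A : Set Γ | MeasurableSet A})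
    MeasurableSpace.generateFrom_measurableSet.symm MeasurableSet.univ
  have hg : Measurable[_, MeasurableSpace.generateFrom
      {E | ∃ n, ∃ A ∈ {A : Set Γ | MeasurableSet A}, E = Q.cyl n A}] (Q.act g) := by
    refine measurable_generateFrom ?_
    rintro _ ⟨n, A, hA, rfl⟩
    obtain ⟨m, hm⟩ := exists_act_image_cyl (Q := Q) g⁻¹
    obtain ⟨A', hA', -, h⟩ := exists_cyl_eq_of_le (Q := Q) (𝓑 := {A : Set Γ | MeasurableSet A})
      (fun n A hA => hA.inter (Q.measurableSet_F n)) (fun n A hA => hA.mul_finset _)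
      (le_max_right m n) hA
    have := (hm _ (le_max_left m n) A').2
    rw [act_image_eq_preimage, inv_inv] at this
    rw [h, this]
    refine measurableSet_cyl _ ?_
    rw [Set.singleton_mul, Set.image_mul_left]
    exact measurable_const_mul _ ((hA'.inter (Q.measurableSet_F _)).mul_finset _)
  rwa [← hgen] at hg

end Measurable

end CFSeq

/-! ### The measure of a (C,F)-space -/

/-- The supremum of an increasing sequence of measures is the setwise supremum. -/
theorem iSup_measure_apply_of_monotone {α : Type*} [MeasurableSpace α] {ν : ℕ → Measure α}
    (hν : Monotone ν) {E : Set α} (hE : MeasurableSet E) : (⨆ n, ν n) E = ⨆ n, ν n E := by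
  -- The setwise supremum is countably additive by monotone convergence for the counting measure.
  let ρ : Measure α := Measure.ofMeasurable (fun s _ => ⨆ n, ν n s) (by simp) (by
    intro f hf hd
    have h := lintegral_iSup (μ := (Measure.count : Measure ℕ)) (f := fun n i => ν n (f i))
      (fun n => measurable_of_countable _) (fun n m hnm i => hν hnm (f i))
    simp only [lintegral_count] at h
    rw [h]
    exact iSup_congr fun n => measure_iUnion hd hf)
  have hρ : ∀ s, MeasurableSet s → ρ s = ⨆ n, ν n s := fun s hs =>
    Measure.ofMeasurable_apply s hs
  refine le_antisymm ?_ (iSup_le fun n => le_iSup ν n E)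
  rw [← hρ E hE]
  have : (⨆ n, ν n) ≤ ρ := iSup_le fun n => Measure.le_iff.2 fun s hs => by
    rw [hρ s hs]
    exact le_iSup (fun n => ν n s) n
  exact this E

namespace CFSeq

theorem mul_finset_eq_biUnion {Γ : Type*} [Group Γ] (A : Set Γ) (C : Finset Γ) :
    A * (C : Set Γ) = ⋃ c ∈ C, A * {c} := by
  ext x
  simp only [Set.mem_mul, Finset.mem_coe, mem_iUnion, mem_singleton_iff, exists_prop]
  constructor
  · rintro ⟨a, ha, c, hc, rfl⟩
    exact ⟨c, hc, a, ha, c, rfl, rfl⟩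
  · rintro ⟨c, hc, a, ha, _, rfl, rfl⟩
    exact ⟨a, ha, _, hc, rfl⟩

section Measure

variable {Γ : Type*} [Group Γ] [MeasurableSpace Γ] {Q : CFSeq Γ} {lam : Measure Γ}

variable (Q) in
/-- The number `|C_1| ⋯ |C_n|`. -/
def cardProd (n : ℕ) : ℕ := ∏ i ∈ Finset.range n, (Q.C i).card

theorem cardProd_pos (n : ℕ) : 0 < Q.cardProd n :=
  Finset.prod_pos fun i _ => zero_lt_one.trans (Q.one_lt_card i)

theorem cardProd_succ (n : ℕ) : Q.cardProd (n + 1) = Q.cardProd n * (Q.C n).card :=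
  Finset.prod_range_succ _ _

theorem cardProd_succ_inv_mul (n : ℕ) :
    (Q.cardProd (n + 1) : ℝ≥0∞)⁻¹ * (Q.C n).card = (Q.cardProd n : ℝ≥0∞)⁻¹ := by
  have h : ((Q.C n).card : ℝ≥0∞) ≠ 0 := by
    have := Q.one_lt_card n
    exact_mod_cast (by omega : (Q.C n).card ≠ 0)
  rw [cardProd_succ, Nat.cast_mul, ENNReal.mul_inv (Or.inr (by simp)) (Or.inr h), mul_assoc,
    ENNReal.inv_mul_cancel h (by simp), mul_one]

theorem partialProd_congr {n j : ℕ} (f : ↥(Q.F n)) {y y' : (k : ℕ) → ↥(Q.C (n + k))}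
    (h : ∀ i < j, y i = y' i) : Q.partialProd (f, y) j = Q.partialProd (f, y') j := by
  induction j with
  | zero => rfl
  | succ j ih =>
    change Q.partialProd (f, y) j * (y j : Γ) = Q.partialProd (f, y') j * (y' j : Γ)
    rw [ih fun i hi => h i (by omega), h j (by omega)]

theorem disjoint_mul_singleton {n : ℕ} {A B : Set Γ} (hA : A ⊆ Q.F n) (hB : B ⊆ Q.F n) {c d : Γ}
    (hc : c ∈ Q.C n) (hd : d ∈ Q.C n) (hcd : c ≠ d) : Disjoint (A * {c}) (B * {d}) :=
  (Q.disjoint n c hc d hd hcd).mono (Set.mul_subset_mul_right hA) (Set.mul_subset_mul_right hB)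

theorem lift_univ_succ_subset (n j : ℕ) : Q.lift n univ (j + 1) ⊆ Q.lift (n + 1) univ j := by
  induction j with
  | zero =>
    refine fun x hx => ⟨mem_univ _, lift_subset n univ 1 hx⟩
  | succ j ih =>
    change Q.lift n univ (j + 1) * (Q.C (n + (j + 1)) : Set Γ) ⊆
      Q.lift (n + 1) univ j * (Q.C (n + 1 + j) : Set Γ)
    rw [show n + 1 + j = n + (j + 1) by omega]
    exact Set.mul_subset_mul_right ih

/-- Under the product measure the `j`-th coordinate is independent of the earlier ones. -/
theorem infinitePi_coord_inter [MeasurableSingletonClass Γ] (n j : ℕ) (c : ↥(Q.C (n + j)))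
    {V : Set ((k : ℕ) → ↥(Q.C (n + k)))}
    (hV : ∀ y y', (∀ i < j, y i = y' i) → y ∈ V → y' ∈ V) :
    (Measure.infinitePi fun k => (PMF.uniformOfFintype ↥(Q.C (n + k))).toMeasure)
        ({y | y j = c} ∩ V) =
      ((Q.C (n + j)).card : ℝ≥0∞)⁻¹ *
        (Measure.infinitePi fun k => (PMF.uniformOfFintype ↥(Q.C (n + k))).toMeasure) V := by
  set P := Measure.infinitePi fun k => (PMF.uniformOfFintype ↥(Q.C (n + k))).toMeasure with hP
  have hind := (ProbabilityTheory.iIndepFun_infinitePi (𝓧 := fun k => ↥(Q.C (n + k)))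
    (P := fun k => (PMF.uniformOfFintype ↥(Q.C (n + k))).toMeasure)
    (X := fun _ ω => ω) (fun _ => measurable_id)).indepFun_finset {j} (Finset.range j)
    (by simp) (fun k => measurable_pi_apply k)
  rw [← hP] at hind
  set W : Set ((i : ↥(Finset.range j)) → ↥(Q.C (n + i))) :=
    {w | ∃ y ∈ V, ∀ i : ↥(Finset.range j), y i = w i} with hW
  have h1 : {y : (k : ℕ) → ↥(Q.C (n + k)) | y j = c} =
      (fun y (i : ↥({j} : Finset ℕ)) => y i) ⁻¹'
        {w : (i : ↥({j} : Finset ℕ)) → ↥(Q.C (n + i)) | w ⟨j, by simp⟩ = c} := rfl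
  have h2 : V = (fun y (i : ↥(Finset.range j)) => y i) ⁻¹' W := by
    ext y
    refine ⟨fun hy => ⟨y, hy, fun _ => rfl⟩, ?_⟩
    rintro ⟨y', hy', h⟩
    exact hV y' y (fun i hi => h ⟨i, Finset.mem_range.2 hi⟩) hy'
  have hm1 : MeasurableSet {w : (i : ↥({j} : Finset ℕ)) → ↥(Q.C (n + i)) |
      w ⟨j, by simp⟩ = c} := Set.Finite.measurableSet (Set.toFinite _)
  have hm2 : MeasurableSet W := Set.Finite.measurableSet (Set.toFinite _)
  have key := hind.measure_inter_preimage_eq_mul _ _ hm1 hm2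
  rw [← h1, ← h2] at key
  rw [key]
  congr 1
  have h3 : P {y | y j = c} = P.map (fun y => y j) {c} := by
    rw [Measure.map_apply (measurable_pi_apply j) (measurableSet_singleton c)]
    rfl
  rw [h3, hP, Measure.infinitePi_map_eval, PMF.toMeasure_apply_singleton _ _
    (measurableSet_singleton c), PMF.uniformOfFintype_apply, Fintype.card_coe]

variable [MeasurableMul Γ]

theorem measure_mul_singleton [lam.IsMulRightInvariant] (A : Set Γ) (c : Γ) :
    lam (A * {c}) = lam A := by
  rw [Set.mul_singleton, Set.image_mul_right, measure_preimage_mul_right]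

theorem measure_singleton_mul [lam.IsMulLeftInvariant] (A : Set Γ) (c : Γ) :
    lam ({c} * A) = lam A := by
  rw [Set.singleton_mul, Set.image_mul_left, measure_preimage_mul]

theorem measure_mul_C [lam.IsMulRightInvariant] {n : ℕ} {A : Set Γ} (hA : MeasurableSet A)
    (hAF : A ⊆ Q.F n) : lam (A * (Q.C n : Set Γ)) = (Q.C n).card * lam A := by
  rw [mul_finset_eq_biUnion, measure_biUnion_finset
    (fun c hc d hd hcd => disjoint_mul_singleton hAF hAF hc hd hcd)
    (fun c _ => hA.mul_singleton_right c)]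
  simp

theorem measure_lift [lam.IsMulRightInvariant] (m j : ℕ) {A : Set Γ} (hA : MeasurableSet A) :
    (Q.cardProd (m + j) : ℝ≥0∞)⁻¹ * lam (Q.lift m A j) =
      (Q.cardProd m : ℝ≥0∞)⁻¹ * lam (A ∩ Q.F m) := by
  induction j with
  | zero => rfl
  | succ j ih =>
    change _ * lam (Q.lift m A j * (Q.C (m + j) : Set Γ)) = _
    rw [measure_mul_C (measurableSet_lift m hA j) (lift_subset m A j), ← mul_assoc, ← add_assoc,
      cardProd_succ_inv_mul, ih]

variable [MeasurableSingletonClass Γ]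

/-- The distribution of the `j`-th partial product under the measure of `X_n` is proportional to
`lam` restricted to `F_n C_{n+1} ⋯ C_{n+j}`. -/
theorem stageMeasure_partialProd [lam.IsMulRightInvariant] (n j : ℕ) {A : Set Γ}
    (hA : MeasurableSet A) : Q.stageMeasure lam n {x | Q.partialProd x j ∈ A} =
      (Q.cardProd (n + j) : ℝ≥0∞)⁻¹ * lam (A ∩ Q.lift n univ j) := by
  induction j generalizing A with
  | zero =>
    have h : {x : Q.Stage n | Q.partialProd x 0 ∈ A} =
        ((Subtype.val : ↥(Q.F n) → Γ) ⁻¹' A) ×ˢ univ := by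
      ext x
      change (x.1 : Γ) ∈ A ↔ _
      simp
    rw [h, stageMeasure, Measure.prod_prod, measure_univ, mul_one, Measure.smul_apply,
      comap_subtype_coe_apply (Q.measurableSet_F n), Subtype.image_preimage_coe, smul_eq_mul]
    simp [cardProd, lift, inter_comm]
  | succ j ih =>
    have hcm : ∀ c : ↥(Q.C (n + j)), ∀ B, MeasurableSet B →
        MeasurableSet {x : Q.Stage n | x.2 j = c ∧ Q.partialProd x j ∈ B} := by
      intro c B hB
      have h : MeasurableSet ((fun x : Q.Stage n => x.2 j) ⁻¹' {c}) :=
        ((measurable_pi_apply j).comp measurable_snd) (measurableSet_singleton c)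
      exact h.inter (measurable_partialProd n j hB)
    have hcoord : ∀ c : ↥(Q.C (n + j)), ∀ B, MeasurableSet B →
        Q.stageMeasure lam n {x | x.2 j = c ∧ Q.partialProd x j ∈ B} =
          ((Q.C (n + j)).card : ℝ≥0∞)⁻¹ * Q.stageMeasure lam n {x | Q.partialProd x j ∈ B} := by
      intro c B hB
      have hm : MeasurableSet {x : Q.Stage n | Q.partialProd x j ∈ B} :=
        measurable_partialProd n j hB
      have hm' := hcm c B hB
      rw [stageMeasure, Measure.prod_apply hm', Measure.prod_apply hm,
        ← lintegral_const_mul _ (measurable_measure_prodMk_left hm)]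
      refine lintegral_congr fun f => ?_
      refine infinitePi_coord_inter n j c (V := {y | Q.partialProd (f, y) j ∈ B}) ?_
      intro y y' h hy
      change Q.partialProd (f, y') j ∈ B
      rw [← partialProd_congr f h]
      exact hy
    have hsplit : {x : Q.Stage n | Q.partialProd x (j + 1) ∈ A} = ⋃ c : ↥(Q.C (n + j)),
        {x | x.2 j = c ∧ Q.partialProd x j ∈ (fun y => y * (c : Γ)) ⁻¹' A} := by
      ext x
      simp only [mem_iUnion, mem_ofPred_eq, mem_preimage, exists_eq_left']
      rfl
    have hAc : ∀ c : Γ, MeasurableSet ((fun y => y * c) ⁻¹' A) := fun c =>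
      measurable_mul_const c hA
    rw [hsplit, measure_iUnion, tsum_fintype]
    rotate_left
    · intro c d hcd
      exact Set.disjoint_left.2 fun x hx hx' => hcd (hx.1.symm.trans hx'.1)
    · intro c
      exact hcm c _ (hAc c)
    have hterm : ∀ c : ↥(Q.C (n + j)), Q.stageMeasure lam n
        {x | x.2 j = c ∧ Q.partialProd x j ∈ (fun y => y * (c : Γ)) ⁻¹' A} =
        (Q.cardProd (n + j + 1) : ℝ≥0∞)⁻¹ * lam (A ∩ (Q.lift n univ j * {(c : Γ)})) := by
      intro c
      rw [hcoord c _ (hAc c), ih (hAc c), ← mul_assoc, cardProd_succ, Nat.cast_mul,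
        ENNReal.mul_inv (Or.inr (by simp)) (Or.inl (by simp)), mul_comm (_⁻¹) (_⁻¹)]
      congr 1
      rw [← measure_mul_singleton (_ ∩ _) (c : Γ)]
      congr 1
      ext x
      simp only [Set.mul_singleton, Set.image_mul_right, mem_preimage, mem_inter_iff,
        inv_mul_cancel_right]
    simp only [hterm]
    rw [← Finset.mul_sum]
    congr 1
    have h := mul_finset_eq_biUnion (Q.lift n univ j) (Q.C (n + j))
    change _ = lam (A ∩ (Q.lift n univ j * (Q.C (n + j) : Set Γ)))
    rw [h, inter_iUnion₂, measure_biUnion_finset]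
    · exact Finset.sum_coe_sort (Q.C (n + j)) fun c => lam (A ∩ (Q.lift n univ j * {c}))
    · intro c hc d hd hcd
      exact (disjoint_mul_singleton (lift_subset n univ j) (lift_subset n univ j) hc hd
        hcd).mono inter_subset_right inter_subset_right
    · exact fun c _ => hA.inter ((measurableSet_lift n MeasurableSet.univ j).mul_singleton_right c)

variable (Q lam) in
/-- The measure of `X_n`, as a measure on `X`. -/
noncomputable def levelMeasure (n : ℕ) : Measure Q.Space := (Q.stageMeasure lam n).map (Q.incl n)

theorem levelMeasure_cyl [lam.IsMulRightInvariant] (n j : ℕ) {A : Set Γ}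
    (hA : MeasurableSet A) : Q.levelMeasure lam n (Q.cyl (n + j) A) =
      (Q.cardProd (n + j) : ℝ≥0∞)⁻¹ * lam (A ∩ Q.lift n univ j) := by
  rw [levelMeasure, Measure.map_apply (measurable_incl n) (measurableSet_cyl _ hA),
    preimage_incl_cyl, stageMeasure_partialProd n j hA]

theorem levelMeasure_univ [lam.IsMulRightInvariant] (n : ℕ) :
    Q.levelMeasure lam n univ = (Q.cardProd n : ℝ≥0∞)⁻¹ * lam (Q.F n) := by
  have h := levelMeasure_cyl (Q := Q) (lam := lam) n 0 MeasurableSet.univ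
  simp only [lift, univ_inter, add_zero] at h
  rw [← h, levelMeasure, Measure.map_apply (measurable_incl n) MeasurableSet.univ,
    Measure.map_apply (measurable_incl n) (measurableSet_cyl _ MeasurableSet.univ)]
  congr 1
  ext x
  exact ⟨fun _ => ⟨x, mem_univ _, rfl⟩, fun _ => mem_univ _⟩

/-- The measure of `X_n` is the restriction to `X_n` of the measure of `X_{n+1}`: both agree on the
cylinder sets. -/
theorem levelMeasure_restrict [lam.IsMulRightInvariant] (hfin : ∀ n, lam (Q.F n) ≠ ∞) (n : ℕ) :
    (Q.levelMeasure lam (n + 1)).restrict (Q.cyl n univ) = Q.levelMeasure lam n := by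
  have hm := measurableSet_cyl (Q := Q) n MeasurableSet.univ
  have hlev : ∀ j, ∀ A : Set Γ, MeasurableSet A →
      Q.levelMeasure lam (n + 1) (Q.cyl (n + 1 + j) A ∩ Q.cyl n univ) =
        Q.levelMeasure lam n (Q.cyl (n + 1 + j) A) := by
    intro j A hA
    have hcast : n + 1 + j = n + (j + 1) := by omega
    have h1 : Q.cyl (n + 1 + j) A ∩ Q.cyl n univ =
        Q.cyl (n + 1 + j) (A ∩ Q.lift n univ (j + 1)) := by
      rw [hcast, ← cyl_lift n univ (j + 1), cyl_inter]
    rw [h1, levelMeasure_cyl _ _ (hA.inter (measurableSet_lift n MeasurableSet.univ _)), hcast,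
      levelMeasure_cyl _ _ hA, inter_assoc, inter_eq_left.2 (lift_univ_succ_subset n j)]
  have hfin' : IsFiniteMeasure (Q.levelMeasure lam n) := by
    refine ⟨?_⟩
    rw [levelMeasure_univ]
    refine ENNReal.mul_lt_top (ENNReal.inv_lt_top.2 ?_) (hfin n).lt_top
    exact_mod_cast cardProd_pos n
  have hany : ∀ m, ∀ A : Set Γ, MeasurableSet A →
      (Q.levelMeasure lam (n + 1)).restrict (Q.cyl n univ) (Q.cyl m A) =
        Q.levelMeasure lam n (Q.cyl m A) := by
    intro m A hA
    obtain ⟨A', hA', -, h⟩ := exists_cyl_eq_of_le (Q := Q) (𝓑 := {A : Set Γ | MeasurableSet A})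
      (fun n A hA => hA.inter (Q.measurableSet_F n)) (fun n A hA => hA.mul_finset _)
      (by omega : m ≤ n + 1 + m) hA
    rw [h, Measure.restrict_apply (measurableSet_cyl _ hA'), hlev m A' hA']
  symm
  refine ext_of_generate_finite _ (measurableSpace_eq_generateFrom (Q := Q)
    (𝓑 := {A : Set Γ | MeasurableSet A}) MeasurableSpace.generateFrom_measurableSet.symm
    MeasurableSet.univ) (isPiSystem_cyl (fun n A hA => hA.inter (Q.measurableSet_F n))
    (fun n A hA => hA.mul_finset _) fun A hA B hB => hA.inter hB) ?_ ?_
  · rintro _ ⟨m, A, hA, rfl⟩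
    exact (hany m A hA).symm
  · have h := hany n univ MeasurableSet.univ
    rw [Measure.restrict_apply_self] at h
    rw [Measure.restrict_apply_univ, h, levelMeasure,
      Measure.map_apply (measurable_incl n) MeasurableSet.univ,
      Measure.map_apply (measurable_incl n) hm]
    congr 1
    ext x
    exact ⟨fun _ => ⟨x, mem_univ _, rfl⟩, fun _ => mem_univ _⟩

theorem monotone_levelMeasure [lam.IsMulRightInvariant] (hfin : ∀ n, lam (Q.F n) ≠ ∞) :
    Monotone (Q.levelMeasure lam) :=
  monotone_nat_of_le_succ fun n => by
    rw [← levelMeasure_restrict hfin n]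
    exact Measure.restrict_le_self

theorem preMeasure_apply [lam.IsMulRightInvariant] (hfin : ∀ n, lam (Q.F n) ≠ ∞)
    {E : Set Q.Space} (hE : MeasurableSet E) :
    Q.preMeasure lam E = ⨆ n, Q.levelMeasure lam n E :=
  iSup_measure_apply_of_monotone (monotone_levelMeasure hfin) hE

theorem preMeasure_cyl [lam.IsMulRightInvariant] (hfin : ∀ n, lam (Q.F n) ≠ ∞) (m : ℕ)
    {A : Set Γ} (hA : MeasurableSet A) :
    Q.preMeasure lam (Q.cyl m A) = (Q.cardProd m : ℝ≥0∞)⁻¹ * lam (A ∩ Q.F m) := by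
  rw [preMeasure_apply hfin (measurableSet_cyl m hA)]
  have hmono : Monotone fun n => Q.levelMeasure lam n (Q.cyl m A) := fun n k hnk =>
    monotone_levelMeasure hfin hnk _
  rw [← hmono.iSup_nat_add m]
  have : ∀ j, Q.levelMeasure lam (j + m) (Q.cyl m A) =
      (Q.cardProd m : ℝ≥0∞)⁻¹ * lam (A ∩ Q.F m) := by
    intro j
    rw [Nat.add_comm j m, ← cyl_lift m A j, ← measure_lift m j hA]
    have := levelMeasure_cyl (Q := Q) (lam := lam) (m + j) 0
      (measurableSet_lift (Q := Q) m hA j)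
    simp only [lift, univ_inter, add_zero] at this
    rw [this, inter_eq_left.2 (lift_subset m A j)]
  simp [this]

theorem preMeasure_univ [lam.IsMulRightInvariant] (hfin : ∀ n, lam (Q.F n) ≠ ∞) :
    Q.preMeasure lam univ = ⨆ n, (Q.cardProd n : ℝ≥0∞)⁻¹ * lam (Q.F n) := by
  rw [preMeasure_apply hfin MeasurableSet.univ]
  simp only [levelMeasure_univ]

theorem isProbabilityMeasure_measure [lam.IsMulRightInvariant] (h0 : lam (Q.F 0) ≠ 0)
    (hfin : ∀ n, lam (Q.F n) ≠ ∞) (htop : Q.preMeasure lam univ ≠ ∞) :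
    IsProbabilityMeasure (Q.measure lam) := by
  refine ⟨?_⟩
  rw [measure, Measure.smul_apply, smul_eq_mul, ENNReal.inv_mul_cancel _ htop]
  rw [preMeasure_univ hfin]
  refine ne_of_gt (lt_of_lt_of_le ?_ (le_iSup _ 0))
  simpa [cardProd, pos_iff_ne_zero] using h0

/-- The action preserves the measure, as left multiplication preserves `lam`. -/
theorem measurePreserving_act [lam.IsMulRightInvariant] [lam.IsMulLeftInvariant]
    (hfin : ∀ n, lam (Q.F n) ≠ ∞) [IsProbabilityMeasure (Q.measure lam)] (g : Γ) :
    MeasurePreserving (Q.act g) (Q.measure lam) (Q.measure lam) := by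
  refine ⟨measurable_act g, ?_⟩
  symm
  refine ext_of_generate_finite _ (measurableSpace_eq_generateFrom (Q := Q)
    (𝓑 := {A : Set Γ | MeasurableSet A}) MeasurableSpace.generateFrom_measurableSet.symm
    MeasurableSet.univ) (isPiSystem_cyl (fun n A hA => hA.inter (Q.measurableSet_F n))
    (fun n A hA => hA.mul_finset _) fun A hA B hB => hA.inter hB) ?_ ?_
  · rintro _ ⟨n, A, hA, rfl⟩
    rw [Measure.map_apply (measurable_act g) (measurableSet_cyl n hA)]
    obtain ⟨m, hm⟩ := exists_act_image_cyl (Q := Q) g⁻¹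
    obtain ⟨A', hA', hsub, h⟩ := exists_cyl_eq_of_le (Q := Q) (𝓑 := {A : Set Γ | MeasurableSet A})
      (fun n A hA => hA.inter (Q.measurableSet_F n)) (fun n A hA => hA.mul_finset _)
      (le_max_right m n) hA
    have hm' : m ≤ max m n := le_max_left m n
    have h' := (hm _ hm' A').2
    rw [act_image_eq_preimage, inv_inv] at h'
    have hmeas : MeasurableSet ((A' ∩ Q.F (max m n)) * (Q.C (max m n) : Set Γ)) :=
      (hA'.inter (Q.measurableSet_F _)).mul_finset _
    have hmeas' : MeasurableSet ({g⁻¹} * ((A' ∩ Q.F (max m n)) * (Q.C (max m n) : Set Γ))) := by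
      rw [Set.singleton_mul, Set.image_mul_left]
      exact measurable_const_mul _ hmeas
    have hF : {g⁻¹} * ((A' ∩ Q.F (max m n)) * (Q.C (max m n) : Set Γ)) ⊆ Q.F (max m n + 1) :=
      (hm _ hm' A').1
    rw [h, h', measure, Measure.smul_apply, Measure.smul_apply, preMeasure_cyl hfin _ hA',
      preMeasure_cyl hfin _ hmeas', inter_eq_left.2 hF, measure_singleton_mul,
      measure_mul_C (hA'.inter (Q.measurableSet_F _)) inter_subset_right, ← mul_assoc,
      cardProd_succ_inv_mul]
  · rw [Measure.map_apply (measurable_act g) MeasurableSet.univ, preimage_univ]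

end Measure

end CFSeq

/-! ### Mixing sequences and weak mixing -/

section Mixing

variable {X : Type*} [MeasurableSpace X] {μ : Measure X}

/-- Setwise convergence of measures dominated by a fixed finite measure may be tested on a
π-system. -/
theorem tendsto_measureReal_of_piSystem [IsFiniteMeasure μ] {ν : ℕ → Measure X} {ρ : Measure X}
    (hν : ∀ n, ν n ≤ μ) [IsFiniteMeasure ρ] {𝓢 : Set (Set X)}
    (hgen : ‹MeasurableSpace X› = MeasurableSpace.generateFrom 𝓢) (hpi : IsPiSystem 𝓢)
    (huniv : Tendsto (fun n => (ν n).real univ) atTop (𝓝 (ρ.real univ)))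
    (h : ∀ A ∈ 𝓢, Tendsto (fun n => (ν n).real A) atTop (𝓝 (ρ.real A)))
    {A : Set X} (hA : MeasurableSet A) :
    Tendsto (fun n => (ν n).real A) atTop (𝓝 (ρ.real A)) := by
  have hfin : ∀ n, IsFiniteMeasure (ν n) := fun n => isFiniteMeasure_of_le μ (hν n)
  induction A, hA using MeasurableSpace.induction_on_inter hgen hpi with
  | empty => simp
  | basic A hA => exact h A hA
  | compl A hA ih =>
    simp only [measureReal_compl hA]
    exact huniv.sub ih
  | iUnion f hd hf ih =>
    simp only [measureReal_def, measure_iUnion hd hf]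
    have hfinite : ∀ (κ : Measure X) [IsFiniteMeasure κ],
        (∑' i, κ (f i)).toReal = ∑' i, (κ (f i)).toReal := fun κ _ =>
      ENNReal.tsum_toReal_eq fun i => measure_ne_top κ _
    simp only [hfinite]
    refine tendsto_tsum_of_dominated_convergence (bound := fun i => (μ (f i)).toReal) ?_ ih ?_
    · refine ENNReal.summable_toReal ?_
      rw [← measure_iUnion hd hf]
      exact measure_ne_top μ _
    · refine Eventually.of_forall fun n i => ?_
      rw [Real.norm_of_nonneg ENNReal.toReal_nonneg]
      exact ENNReal.toReal_mono (measure_ne_top μ _) (hν n _)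

/-- Mixing along a sequence of measure-preserving maps may be tested on a generating π-system. -/
theorem tendsto_measureReal_preimage_inter_of_piSystem [IsProbabilityMeasure μ] {T : ℕ → X → X}
    (hT : ∀ n, MeasurePreserving (T n) μ μ) {𝓢 : Set (Set X)}
    (hgen : ‹MeasurableSpace X› = MeasurableSpace.generateFrom 𝓢) (hpi : IsPiSystem 𝓢)
    (h : ∀ A ∈ 𝓢, ∀ B ∈ 𝓢,
      Tendsto (fun n => μ.real (T n ⁻¹' A ∩ B)) atTop (𝓝 (μ.real A * μ.real B)))
    {A B : Set X} (hA : MeasurableSet A) (hB : MeasurableSet B) :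
    Tendsto (fun n => μ.real (T n ⁻¹' A ∩ B)) atTop (𝓝 (μ.real A * μ.real B)) := by
  have hmeas : ∀ E ∈ 𝓢, MeasurableSet E := fun E hE => by
    rw [hgen]
    exact MeasurableSpace.measurableSet_generateFrom hE
  -- First `B` is general and `A` in the π-system, and then both are general.
  have hone : ∀ A ∈ 𝓢, ∀ B, MeasurableSet B →
      Tendsto (fun n => μ.real (T n ⁻¹' A ∩ B)) atTop (𝓝 (μ.real A * μ.real B)) := by
    intro A hA B hB
    have hAm := hmeas A hA
    have : IsFiniteMeasure (μ A • μ) := Measure.smul_finite μ (measure_ne_top μ A)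
    have key := tendsto_measureReal_of_piSystem (μ := μ)
      (ν := fun n => μ.restrict (T n ⁻¹' A)) (ρ := μ A • μ)
      (fun n => Measure.restrict_le_self) hgen hpi ?_ ?_ hB
    · simpa [measureReal_def, Measure.restrict_apply hB, inter_comm B] using key
    · simp only [measureReal_restrict_apply_univ]
      simp [measureReal_def, (hT _).measure_preimage hAm.nullMeasurableSet]
    · intro E hE
      simpa [measureReal_def, Measure.restrict_apply (hmeas E hE), inter_comm E] using h A hA E hE
  have : IsFiniteMeasure (μ B • μ) := Measure.smul_finite μ (measure_ne_top μ B)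
  have key := tendsto_measureReal_of_piSystem (μ := μ)
    (ν := fun n => (μ.restrict B).map (T n)) (ρ := μ B • μ) (fun n => ?_) hgen hpi ?_ ?_ hA
  · simpa [measureReal_def, Measure.map_apply (hT _).measurable hA,
      Measure.restrict_apply ((hT _).measurable hA), mul_comm] using key
  · refine Measure.le_iff.2 fun E hE => ?_
    rw [Measure.map_apply (hT n).measurable hE,
      ← (hT n).measure_preimage hE.nullMeasurableSet]
    exact Measure.restrict_le_self _
  · simp [measureReal_def, Measure.map_apply (hT _).measurable MeasurableSet.univ]
  · intro E hE
    have := hone E hE B hB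
    simpa [measureReal_def, Measure.map_apply (hT _).measurable (hmeas E hE),
      Measure.restrict_apply ((hT _).measurable (hmeas E hE)), mul_comm] using this

/-- If some sequence of powers of `T` is mixing, then it is mixing for `T × T` as well, and a
`T × T`-invariant set `E` has `μ²(E) = μ²(E)²`. -/
theorem ergodic_prodMap_of_tendsto [IsProbabilityMeasure μ] {T : X → X}
    (hT : MeasurePreserving T μ μ) (k : ℕ → ℕ)
    (h : ∀ A B : Set X, MeasurableSet A → MeasurableSet B →
      Tendsto (fun n => μ.real (T^[k n] ⁻¹' A ∩ B)) atTop (𝓝 (μ.real A * μ.real B))) :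
    Ergodic (Prod.map T T) (μ.prod μ) := by
  have hTT : MeasurePreserving (Prod.map T T) (μ.prod μ) (μ.prod μ) := hT.prod hT
  refine ⟨hTT, ⟨fun E hE hinv => ?_⟩⟩
  have hiter : ∀ n, MeasurePreserving (Prod.map T T)^[n] (μ.prod μ) (μ.prod μ) := fun n =>
    hTT.iterate n
  have key := tendsto_measureReal_preimage_inter_of_piSystem (fun n => hiter (k n))
    generateFrom_prod.symm isPiSystem_prod ?_ hE hE
  · have hconst : ∀ n, (Prod.map T T)^[k n] ⁻¹' E ∩ E = E := by
      intro n
      have : (Prod.map T T)^[k n] ⁻¹' E = E := by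
        induction k n with
        | zero => rfl
        | succ j ih => rw [Function.iterate_succ, preimage_comp, ih, hinv]
      rw [this, inter_self]
    simp only [hconst] at key
    have hsq := tendsto_nhds_unique key tendsto_const_nhds
    have h01 : (μ.prod μ).real E = 0 ∨ (μ.prod μ).real E = 1 := by
      rcases mul_eq_zero.1 (show (μ.prod μ).real E * ((μ.prod μ).real E - 1) = 0 by linarith)
        with h | h
      · exact Or.inl h
      · exact Or.inr (by linarith)
    rw [eventuallyConst_set']
    rcases h01 with h | h
    · left
      exact ae_eq_empty.2 ((measureReal_eq_zero_iff).1 h)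
    · right
      refine eventuallyEq_univ.2 ?_
      rw [mem_ae_iff, prob_compl_eq_zero_iff hE]
      rwa [measureReal_def, ENNReal.toReal_eq_one_iff] at h
  · rintro _ ⟨A₁, hA₁, A₂, hA₂, rfl⟩ _ ⟨B₁, hB₁, B₂, hB₂, rfl⟩
    have := (h A₁ B₁ hA₁ hB₁).mul (h A₂ B₂ hA₂ hB₂)
    simp only [Prod.map_iterate, preimage_prod_map_prod, prod_inter_prod, measureReal_prod_prod]
    convert this using 2
    ring

end Mixing

/-! ### The Haar measure of the group `ℤ × (ℝ ⋊ ℤ/2)` -/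

theorem sgn_mul_self (e : ZMod 2) : sgn e * sgn e = 1 := by
  rcases sgn_cases e with ⟨_, h⟩ | ⟨_, h⟩ <;> rw [h] <;> norm_num

theorem abs_sgn (e : ZMod 2) : |sgn e| = 1 := by
  rcases sgn_cases e with ⟨_, h⟩ | ⟨_, h⟩ <;> rw [h] <;> norm_num

namespace G

theorem measurable_coords : Measurable fun g : G => (g.z, g.t, g.e) := comap_measurable _

theorem measurable_z : Measurable G.z := measurable_coords.fst

theorem measurable_t : Measurable G.t := measurable_coords.snd.fst

theorem measurable_e : Measurable G.e := measurable_coords.snd.snd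

theorem measurable_of_coords {α : Type*} [MeasurableSpace α] {f : α → G}
    (hz : Measurable fun x => (f x).z) (ht : Measurable fun x => (f x).t)
    (he : Measurable fun x => (f x).e) : Measurable f :=
  measurable_comap_iff.2 (hz.prodMk (ht.prodMk he))

instance : MeasurableSingletonClass G := by
  refine ⟨fun g => ?_⟩
  have : ({g} : Set G) = (fun h : G => (h.z, h.t, h.e)) ⁻¹' {(g.z, g.t, g.e)} := by
    ext h
    simp [G.ext_iff]
  rw [this]
  exact measurable_coords (measurableSet_singleton _)

theorem measurable_sgn : Measurable sgn := measurable_of_countable _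

instance : MeasurableMul₂ G :=
  ⟨measurable_of_coords
    ((measurable_z.comp measurable_fst).add (measurable_z.comp measurable_snd))
    ((measurable_t.comp measurable_fst).add
      ((measurable_sgn.comp (measurable_e.comp measurable_fst)).mul
        (measurable_t.comp measurable_snd)))
    ((measurable_of_countable fun p : ZMod 2 × ZMod 2 => p.1 + p.2).comp
      ((measurable_e.comp measurable_fst).prodMk (measurable_e.comp measurable_snd)))⟩

instance : MeasurableInv G :=
  ⟨measurable_of_coords measurable_z.neg
    (((measurable_sgn.comp measurable_e).mul measurable_t).neg)
    ((measurable_of_countable fun e : ZMod 2 => -e).comp measurable_e)⟩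

theorem measurable_mk (k : ℤ) (e : ZMod 2) : Measurable fun t : ℝ => (⟨k, t, e⟩ : G) :=
  measurable_of_coords measurable_const measurable_id measurable_const

theorem haar_apply {A : Set G} (hA : MeasurableSet A) :
    haar A = ∑' p : ℤ × ZMod 2, volume {t : ℝ | (⟨p.1, t, p.2⟩ : G) ∈ A} := by
  rw [haar, Measure.sum_apply _ hA]
  exact tsum_congr fun p => Measure.map_apply (measurable_mk p.1 p.2) hA

instance : SFinite haar := by
  rw [haar]
  infer_instance

/-- A map which permutes the lines `{k} × ℝ × {e}` and is an isometry from line to line preserves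
the Haar measure. -/
theorem measurePreserving_of_lines {f : G → G} (hf : Measurable f) (σ : ℤ × ZMod 2 ≃ ℤ × ZMod 2)
    (ε : ZMod 2 → ZMod 2) (c : ZMod 2 → ℝ)
    (h : ∀ k t e, f ⟨k, t, e⟩ = ⟨(σ (k, e)).1, sgn (ε e) * t + c e, (σ (k, e)).2⟩) :
    MeasurePreserving f haar haar := by
  refine ⟨hf, Measure.ext fun A hA => ?_⟩
  rw [Measure.map_apply hf hA, haar_apply (hf hA), haar_apply hA,
    ← Equiv.tsum_eq σ fun p => volume {t : ℝ | (⟨p.1, t, p.2⟩ : G) ∈ A}]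
  refine tsum_congr fun p => ?_
  have hpre : {t : ℝ | (⟨p.1, t, p.2⟩ : G) ∈ f ⁻¹' A} =
      (fun t => sgn (ε p.2) * t + c p.2) ⁻¹' {t : ℝ | (⟨(σ p).1, t, (σ p).2⟩ : G) ∈ A} := by
    ext t
    exact iff_of_eq (congrArg (· ∈ A) (h p.1 t p.2))
  have hne : sgn (ε p.2) ≠ 0 := by
    rw [← abs_pos, abs_sgn]
    norm_num
  have hcomp : (fun t => sgn (ε p.2) * t + c p.2) =
      (fun t => t + c p.2) ∘ fun t => sgn (ε p.2) * t := rfl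
  rw [hpre, hcomp, preimage_comp, Real.volume_preimage_mul_left hne, measure_preimage_add_right,
    abs_inv, abs_sgn]
  simp

instance : haar.IsMulLeftInvariant := by
  refine ⟨fun g => (measurePreserving_of_lines (measurable_const_mul g)
    ((Equiv.addLeft g.z).prodCongr (Equiv.addLeft g.e)) (fun _ => g.e) (fun _ => g.t)
    fun k t e => ?_).map_eq⟩
  ext <;> simp [add_comm]

instance : haar.IsMulRightInvariant := by
  refine ⟨fun g => (measurePreserving_of_lines (measurable_mul_const g)
    ((Equiv.addRight g.z).prodCongr (Equiv.addRight g.e)) (fun _ => 0) (fun e => sgn e * g.t)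
    fun k t e => ?_).map_eq⟩
  ext <;> simp [sgn]

instance : haar.IsInvInvariant := by
  have h1 : ∀ e : ZMod 2, -sgn e = sgn (e + 1) := fun e => by
    rw [sgn_add]
    simp [sgn, ZMod.val_one]
  refine ⟨(measurePreserving_of_lines measurable_inv
    ((Equiv.neg ℤ).prodCongr (Equiv.neg (ZMod 2))) (fun e => e + 1) (fun _ => 0)
    fun k t e => ?_).map_eq⟩
  ext
  · simp
  · simp [← h1]
  · simp

theorem haar_slab (Z : Finset ℤ) (E : Finset (ZMod 2)) {I : Set ℝ} (hI : MeasurableSet I) :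
    haar {g | g.z ∈ Z ∧ g.e ∈ E ∧ g.t ∈ I} = Z.card * E.card * volume I := by
  have hm : MeasurableSet {g : G | g.z ∈ Z ∧ g.e ∈ E ∧ g.t ∈ I} :=
    (measurable_z (MeasurableSet.of_discrete (s := (Z : Set ℤ)))).inter
      ((measurable_e (MeasurableSet.of_discrete (s := (E : Set (ZMod 2))))).inter
        (measurable_t hI))
  rw [haar_apply hm, tsum_eq_sum (s := Z ×ˢ E)]
  · rw [Finset.sum_congr rfl (g := fun _ => volume I), Finset.sum_const, Finset.card_product,
      nsmul_eq_mul, Nat.cast_mul]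
    rintro ⟨k, e⟩ hp
    have := Finset.mem_product.1 hp
    simp only [mem_ofPred_eq, this.1, this.2, true_and]
    rfl
  · rintro ⟨k, e⟩ hp
    have : {t : ℝ | (⟨k, t, e⟩ : G) ∈ {g : G | g.z ∈ Z ∧ g.e ∈ E ∧ g.t ∈ I}} = ∅ := by
      refine eq_empty_of_forall_notMem fun t ht => hp ?_
      exact Finset.mem_product.2 ⟨ht.1, ht.2.1⟩
    rw [this, measure_empty]

theorem box_eq_slab (N : ℕ) : box N =
    {g : G | g.z ∈ Finset.Ioc (-(N : ℤ)) N ∧ g.e ∈ (Finset.univ : Finset (ZMod 2)) ∧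
      g.t ∈ Ioc (-(N : ℝ)) N} := by
  ext g
  simp [box]

theorem haar_box (N : ℕ) : haar (box N) = ENNReal.ofReal (8 * (N : ℝ) ^ 2) := by
  rw [box_eq_slab, haar_slab _ _ measurableSet_Ioc, Real.volume_Ioc, Int.card_Ioc,
    Finset.card_univ, ZMod.card, ← ENNReal.ofReal_natCast, ← ENNReal.ofReal_natCast,
    ← ENNReal.ofReal_mul (by positivity), ← ENNReal.ofReal_mul (by positivity)]
  congr 1
  have : ((((N : ℤ) - -(N : ℤ)).toNat : ℕ) : ℝ) = 2 * N := by
    have : ((N : ℤ) - -(N : ℤ)).toNat = 2 * N := by omega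
    rw [this]
    push_cast
    ring
  rw [this]
  push_cast
  ring

theorem haar_box_ne_top (N : ℕ) : haar (box N) ≠ ∞ := by
  rw [haar_box]
  exact ENNReal.ofReal_ne_top

theorem haar_real_box (N : ℕ) : haar.real (box N) = 8 * (N : ℝ) ^ 2 := by
  rw [measureReal_def, haar_box, ENNReal.toReal_ofReal (by positivity)]

end G

theorem box_subset_box {M N : ℕ} (h : M ≤ N) : box M ⊆ box N := by
  rintro g ⟨⟨h1, h2⟩, h3, h4⟩
  have hz : (M : ℤ) ≤ N := by exact_mod_cast h
  have hr : (M : ℝ) ≤ N := by exact_mod_cast h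
  exact ⟨⟨by omega, by omega⟩, by linarith, by linarith⟩

/-! ### Sets with small boundary and their approximation by atoms -/

/-- The points of `A` from which one can leave `A` by moving the real coordinate by less than
`δ`. -/
def bdry (δ : ℝ) (A : Set G) : Set G :=
  {x | x ∈ A ∧ ∃ y, y ∉ A ∧ y.z = x.z ∧ y.e = x.e ∧ |x.t - y.t| < δ}

theorem bdry_inter_subset (δ : ℝ) (A B : Set G) : bdry δ (A ∩ B) ⊆ bdry δ A ∪ bdry δ B := by
  rintro x ⟨⟨hA, hB⟩, y, hy, h⟩
  by_cases hyA : y ∈ A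
  · exact Or.inr ⟨hB, y, fun hyB => hy ⟨hyA, hyB⟩, h⟩
  · exact Or.inl ⟨hA, y, hyA, h⟩

/-- Right multiplication by `c` translates each line `{k} × ℝ × {e}` onto another one. -/
theorem bdry_mul_finset_subset (δ : ℝ) (A : Set G) (C : Finset G) :
    bdry δ (A * (C : Set G)) ⊆ bdry δ A * (C : Set G) := by
  rintro _ ⟨⟨a, ha, c, hc, rfl⟩, y, hy, hz, he, ht⟩
  refine ⟨a, ⟨ha, y * c⁻¹, fun hyA => hy ⟨_, hyA, c, hc, by simp⟩, ?_, ?_, ?_⟩, c, hc, rfl⟩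
  · simp only [G.mul_z, G.inv_z] at hz ⊢
    omega
  · have : (y * c⁻¹).e = (a * c * c⁻¹).e := by rw [G.mul_e, he, ← G.mul_e]
    rwa [mul_inv_cancel_right] at this
  · have h1 : (y * c⁻¹).t = y.t - sgn a.e * c.t := by
      have hc : sgn y.e * sgn c.e = sgn a.e := by
        rw [he, G.mul_e, sgn_add, mul_assoc, sgn_mul_self, mul_one]
      rw [G.mul_t, G.inv_t, ← hc]
      ring
    have h2 : a.t - (y * c⁻¹).t = (a * c).t - y.t := by
      rw [h1, G.mul_t]
      ring
    rwa [h2]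

theorem haar_mul_finset_le (A : Set G) (C : Finset G) :
    G.haar (A * (C : Set G)) ≤ C.card * G.haar A := by
  rw [CFSeq.mul_finset_eq_biUnion]
  refine (measure_biUnion_finset_le C _).trans ?_
  simp

theorem haar_bdry_mul_finset_le (δ : ℝ) (A : Set G) (C : Finset G) :
    G.haar (bdry δ (A * (C : Set G))) ≤ C.card * G.haar (bdry δ A) :=
  (measure_mono (bdry_mul_finset_subset δ A C)).trans (haar_mul_finset_le _ C)

theorem haar_bdry_box_le {δ : ℝ} (hδ : 0 ≤ δ) (N : ℕ) :
    G.haar (bdry δ (box N)) ≤ ENNReal.ofReal (8 * N * δ) := by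
  have hsub : bdry δ (box N) ⊆ {g : G | g.z ∈ Finset.Ioc (-(N : ℤ)) N ∧
      g.e ∈ (Finset.univ : Finset (ZMod 2)) ∧
      g.t ∈ Ioc (-(N : ℝ)) (-(N : ℝ) + δ) ∪ Ioc ((N : ℝ) - δ) N} := by
    rintro x ⟨⟨hz, ht⟩, y, hy, hyz, -, hd⟩
    refine ⟨Finset.mem_Ioc.2 hz, Finset.mem_univ _, ?_⟩
    have hyt : ¬ y.t ∈ Ioc (-(N : ℝ)) N := fun h => hy ⟨by rwa [hyz], h⟩
    rw [abs_lt] at hd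
    by_cases h : y.t ≤ -N
    · exact Or.inl ⟨ht.1, by linarith⟩
    · have : (N : ℝ) < y.t := by
        by_contra hcon
        exact hyt ⟨not_le.1 h, not_lt.1 hcon⟩
      exact Or.inr ⟨by linarith, ht.2⟩
  have hvol : volume (Ioc (-(N : ℝ)) (-(N : ℝ) + δ) ∪ Ioc ((N : ℝ) - δ) N) ≤
      ENNReal.ofReal (2 * δ) := by
    refine (measure_union_le _ _).trans ?_
    rw [Real.volume_Ioc, Real.volume_Ioc, ← ENNReal.ofReal_add (by linarith) (by linarith)]
    exact ENNReal.ofReal_le_ofReal (by linarith)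
  refine (measure_mono hsub).trans ?_
  rw [G.haar_slab _ _ (measurableSet_Ioc.union measurableSet_Ioc), Int.card_Ioc,
    Finset.card_univ, ZMod.card]
  refine (mul_le_mul_right hvol _).trans ?_
  have : ((N : ℤ) - -(N : ℤ)).toNat = 2 * N := by omega
  rw [this, ← ENNReal.ofReal_natCast, ← ENNReal.ofReal_natCast,
    ← ENNReal.ofReal_mul (by positivity), ← ENNReal.ofReal_mul (by positivity)]
  refine ENNReal.ofReal_le_ofReal (le_of_eq ?_)
  push_cast
  ring

/-- The half-line `{k} × (-∞, q] × {ε}`. -/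
def ray (k : ℤ) (ε : ZMod 2) (q : ℝ) : Set G := {g | g.z = k ∧ g.e = ε ∧ g.t ≤ q}

theorem haar_bdry_ray_le (δ : ℝ) (k : ℤ) (ε : ZMod 2) (q : ℝ) :
    G.haar (bdry δ (ray k ε q)) ≤ ENNReal.ofReal δ := by
  have hsub : bdry δ (ray k ε q) ⊆ {g : G | g.z ∈ ({k} : Finset ℤ) ∧
      g.e ∈ ({ε} : Finset (ZMod 2)) ∧ g.t ∈ Ioc (q - δ) q} := by
    rintro x ⟨⟨hz, he, ht⟩, y, hy, hyz, hye, hd⟩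
    refine ⟨by simpa using hz, by simpa using he, ?_, ht⟩
    have : q < y.t := not_le.1 fun h => hy ⟨hyz.trans hz, hye.trans he, h⟩
    rw [abs_lt] at hd
    linarith
  refine (measure_mono hsub).trans ?_
  rw [G.haar_slab _ _ measurableSet_Ioc, Real.volume_Ioc]
  simp

/-- The measurable sets whose boundary layer of width `1 / (n + 1)` has measure tending to `0`. -/
def thinBdry : Set (Set G) :=
  {A | MeasurableSet A ∧ Tendsto (fun n : ℕ => G.haar (bdry (1 / ((n : ℝ) + 1)) A)) atTop (𝓝 0)}

theorem tendsto_ofReal_mul_one_div (c : ℝ) :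
    Tendsto (fun n : ℕ => ENNReal.ofReal (c * (1 / ((n : ℝ) + 1)))) atTop (𝓝 0) := by
  have h := (tendsto_one_div_add_atTop_nhds_zero_nat (𝕜 := ℝ)).const_mul c
  have := ENNReal.tendsto_ofReal h
  simpa using this

theorem univ_mem_thinBdry : univ ∈ thinBdry := by
  refine ⟨MeasurableSet.univ, ?_⟩
  have : ∀ δ, bdry δ univ = ∅ := fun δ => by
    ext x
    simp [bdry]
  simp [this]

theorem box_mem_thinBdry (N : ℕ) : box N ∈ thinBdry :=
  ⟨measurableSet_box N, tendsto_of_tendsto_of_tendsto_of_le_of_le tendsto_const_nhds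
    (tendsto_ofReal_mul_one_div (8 * N)) (fun _ => zero_le)
    fun _ => haar_bdry_box_le (by positivity) N⟩

theorem inter_mem_thinBdry {A B : Set G} (hA : A ∈ thinBdry) (hB : B ∈ thinBdry) :
    A ∩ B ∈ thinBdry := by
  refine ⟨hA.1.inter hB.1, ?_⟩
  have h := hA.2.add hB.2
  rw [add_zero] at h
  exact tendsto_of_tendsto_of_tendsto_of_le_of_le tendsto_const_nhds h (fun _ => zero_le)
    fun n => (measure_mono (bdry_inter_subset _ A B)).trans (measure_union_le _ _)

theorem mul_finset_mem_thinBdry {A : Set G} (hA : A ∈ thinBdry) (C : Finset G) :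
    A * (C : Set G) ∈ thinBdry := by
  refine ⟨hA.1.mul_finset C, ?_⟩
  have h := ENNReal.Tendsto.const_mul (a := (C.card : ℝ≥0∞)) hA.2 (Or.inr (by simp))
  rw [mul_zero] at h
  exact tendsto_of_tendsto_of_tendsto_of_le_of_le tendsto_const_nhds h (fun _ => zero_le)
    fun n => haar_bdry_mul_finset_le _ A C

theorem ray_mem_thinBdry (k : ℤ) (ε : ZMod 2) (q : ℝ) : ray k ε q ∈ thinBdry := by
  refine ⟨?_, ?_⟩
  · exact (G.measurable_z (measurableSet_singleton k)).inter
      ((G.measurable_e (measurableSet_singleton ε)).inter (G.measurable_t measurableSet_Iic))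
  · have h := tendsto_ofReal_mul_one_div 1
    simp only [one_mul] at h
    exact tendsto_of_tendsto_of_tendsto_of_le_of_le tendsto_const_nhds h (fun _ => zero_le)
      fun n => haar_bdry_ray_le _ k ε q

theorem generateFrom_thinBdry :
    (inferInstance : MeasurableSpace G) = MeasurableSpace.generateFrom thinBdry := by
  refine le_antisymm ?_ (MeasurableSpace.generateFrom_le fun A hA => hA.1)
  set σ := MeasurableSpace.generateFrom thinBdry
  have hray : ∀ k ε q, MeasurableSet[σ] (ray k ε q) := fun k ε q =>
    MeasurableSpace.measurableSet_generateFrom (ray_mem_thinBdry k ε q)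
  have hz : Measurable[σ] G.z := by
    refine @measurable_to_countable' _ _ _ _ σ _ fun k => ?_
    have : G.z ⁻¹' {k} = ⋃ ε : ZMod 2, ⋃ q : ℕ, ray k ε q := by
      ext g
      obtain ⟨q, hq⟩ := exists_nat_ge g.t
      simp only [mem_preimage, mem_singleton_iff, mem_iUnion]
      exact ⟨fun h => ⟨g.e, q, h, rfl, hq⟩, fun ⟨_, _, h, _⟩ => h⟩
    rw [this]
    exact MeasurableSet.iUnion fun ε => MeasurableSet.iUnion fun q => hray _ _ _
  have he : Measurable[σ] G.e := by
    refine @measurable_to_countable' _ _ _ _ σ _ fun ε => ?_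
    have : G.e ⁻¹' {ε} = ⋃ k : ℤ, ⋃ q : ℕ, ray k ε q := by
      ext g
      obtain ⟨q, hq⟩ := exists_nat_ge g.t
      simp only [mem_preimage, mem_singleton_iff, mem_iUnion]
      exact ⟨fun h => ⟨g.z, q, rfl, h, hq⟩, fun ⟨_, _, _, h, _⟩ => h⟩
    rw [this]
    exact MeasurableSet.iUnion fun ε => MeasurableSet.iUnion fun q => hray _ _ _
  have ht : Measurable[σ] G.t := by
    refine measurable_of_Iic fun q => ?_
    have : G.t ⁻¹' Iic q = ⋃ k : ℤ, ⋃ ε : ZMod 2, ray k ε q := by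
      ext g
      simp only [mem_preimage, mem_Iic, mem_iUnion]
      exact ⟨fun h => ⟨g.z, g.e, rfl, rfl, h⟩, fun ⟨_, _, _, _, h⟩ => h⟩
    rw [this]
    exact MeasurableSet.iUnion fun ε => MeasurableSet.iUnion fun q => hray _ _ _
  change MeasurableSpace.comap (fun g : G => (g.z, g.t, g.e)) inferInstance ≤ σ
  have h := MeasurableSpace.comap_prodMk (mβ := inferInstance) (mγ := inferInstance) G.z
    fun g : G => (g.t, g.e)
  have h' := MeasurableSpace.comap_prodMk (mβ := inferInstance) (mγ := inferInstance) G.t G.e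
  refine (h.trans (congrArg _ h')).trans_le ?_
  exact sup_le hz.comap_le (sup_le ht.comap_le he.comap_le)

namespace Params

variable (P : Params)

/-- The box `I_n ⊆ F_n` of the points which stay in `F_n` when multiplied by `S_n`. It is empty if
`b_n ≥ a_n`. -/
def inner (n : ℕ) : Set G := box (a P.r n - b P.r n)

/-- The union of the atoms of `ξ_n` inside `A ∩ I_n`. -/
def atomApprox (n : ℕ) (A : Set G) : Set G := ⋃₀ {c | c ∈ P.ξ n ∧ c ⊆ A ∩ P.inner n}

theorem atomApprox_subset (n : ℕ) (A : Set G) : P.atomApprox n A ⊆ A ∩ P.inner n :=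
  sUnion_subset fun _ hc => hc.2

theorem partMeas_atomApprox (n : ℕ) (A : Set G) : PartMeas (P.ξ n) (P.atomApprox n A) :=
  ⟨_, fun _ hc => hc.1, rfl⟩

theorem measurableSet_atomApprox {n : ℕ} (hn : 1 ≤ n) (A : Set G) :
    MeasurableSet (P.atomApprox n A) :=
  MeasurableSet.sUnion (((P.ξ_finite n hn).subset fun _ hc => hc.1).countable)
    fun c hc => P.ξ_measurable n hn c hc.1

theorem inner_subset_F (n : ℕ) : P.inner n ⊆ F P.r n := box_subset_box (Nat.sub_le _ _)

theorem inner_mul_S_subset (n : ℕ) : P.inner n * S P.r n ⊆ F P.r n := by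
  rintro _ ⟨x, hx, y, hy, rfl⟩
  by_cases h : b P.r n ≤ a P.r n
  · have := box_mul hx hy
    rwa [Nat.sub_add_cancel h] at this
  · have hx' := hx.2
    rw [Nat.sub_eq_zero_of_le (by omega)] at hx'
    simp at hx'

/-- A point of `A` which is lost in the approximation lies outside `I_n`, or its atom leaves `A` or
`I_n`; in the latter cases it is near the boundary, as atoms are small. -/
theorem sdiff_atomApprox_subset {n : ℕ} (hn : 1 ≤ n) {A : Set G} (hA : A ⊆ F P.r n) :
    A \ P.atomApprox n A ⊆
      F P.r n \ P.inner n ∪ (bdry (1 / (n : ℝ)) A ∪ bdry (1 / (n : ℝ)) (P.inner n)) := by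
  rintro x ⟨hxA, hx⟩
  have hxF := hA hxA
  by_cases hxI : x ∈ P.inner n
  swap
  · exact Or.inl ⟨hxF, hxI⟩
  right
  rw [← P.ξ_cover n hn] at hxF
  obtain ⟨c, hc, hxc⟩ := hxF
  have hnot : ¬ c ⊆ A ∩ P.inner n := fun h => hx ⟨c, ⟨hc, h⟩, hxc⟩
  obtain ⟨y, hyc, hy⟩ := Set.not_subset.1 hnot
  have hd := P.ξ_small n hn c hc x hxc y hyc
  have hn1 : 1 / (n : ℝ) ≤ 1 := by
    rw [div_le_one (by positivity)]
    exact_mod_cast hn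
  simp only [G.gdist, max_lt_iff] at hd
  obtain ⟨hz, ht, he⟩ := hd
  -- The atom has diameter less than `1`, so the discrete coordinates are constant on it.
  have hz' : y.z = x.z := by
    have h1 : |((x.z - y.z : ℤ) : ℝ)| < 1 := by
      push_cast
      exact hz.trans_le hn1
    have h2 : |x.z - y.z| < 1 := by exact_mod_cast h1
    rw [Int.abs_lt_one_iff] at h2
    omega
  have he' : y.e = x.e := by
    by_contra h
    rw [if_neg (Ne.symm h)] at he
    linarith
  by_cases hyA : y ∈ A
  · exact Or.inr ⟨hxI, y, fun h => hy ⟨hyA, h⟩, hz', he', ht⟩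
  · exact Or.inl ⟨hxA, y, hyA, hz', he', ht⟩

end Params

/-! ### Equidistribution of consecutive values of `s_n` -/

/-- The average of `f` over `D × D`. -/
noncomputable def avgD (D : Finset G) (f : G → G → ℝ) : ℝ :=
  (1 / (D.card : ℝ) ^ 2) * ∑ x ∈ D, ∑ y ∈ D, f x y

theorem avgD_mono {D : Finset G} {f g : G → G → ℝ} (h : ∀ x ∈ D, ∀ y ∈ D, f x y ≤ g x y) :
    avgD D f ≤ avgD D g :=
  mul_le_mul_of_nonneg_left
    (Finset.sum_le_sum fun x hx => Finset.sum_le_sum fun y hy => h x hx y hy) (by positivity)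

theorem avgD_const {D : Finset G} (hD : D.Nonempty) (c : ℝ) : avgD D (fun _ _ => c) = c := by
  have : (D.card : ℝ) ≠ 0 := by exact_mod_cast hD.card_pos.ne'
  simp only [avgD, Finset.sum_const, nsmul_eq_mul]
  field_simp

theorem avgD_add_const {D : Finset G} (hD : D.Nonempty) (f : G → G → ℝ) (c : ℝ) :
    avgD D (fun x y => f x y + c) = avgD D f + c := by
  have h := avgD_const hD c
  simp only [avgD, Finset.sum_add_distrib, mul_add] at h ⊢
  rw [h]

/-- The indices `h ∈ H_n` with `h + (1, 0) ∈ H_n`. -/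
noncomputable def shiftH (r : ℕ → ℕ) (n : ℕ) : Finset (ℤ × ℤ) :=
  (H r n).filter fun h => h + (1, 0) ∈ H r n

theorem card_H (r : ℕ → ℕ) (n : ℕ) : (H r n).card = (2 * r n + 1) ^ 2 := by
  rw [H, Finset.card_product, Int.card_Icc, sq]
  congr 1 <;> omega

/-- The set `shiftH` is a union of rows, each of which consists of `2 r_n` indices. -/
theorem sum_shiftH (r : ℕ → ℕ) (n : ℕ) (g : ℤ × ℤ → ℝ) :
    ∑ h ∈ shiftH r n, g h = ∑ j ∈ Finset.Icc (-(r n : ℤ)) (r n),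
      ∑ t ∈ Finset.range (2 * r n), g ((-(r n : ℤ), j) + ((t : ℤ), 0)) := by
  rw [← Finset.sum_product (Finset.Icc (-(r n : ℤ)) (r n)) (Finset.range (2 * r n))
    (fun p => g ((-(r n : ℤ), p.1) + ((p.2 : ℤ), 0)))]
  symm
  refine Finset.sum_nbij' (fun p => (-(r n : ℤ), p.1) + ((p.2 : ℤ), 0))
    (fun h => (h.2, (h.1 + r n).toNat)) ?_ ?_ ?_ ?_ ?_
  · rintro ⟨j, t⟩ hp
    simp only [Finset.mem_product, Finset.mem_Icc, Finset.mem_range] at hp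
    simp only [shiftH, H, Finset.mem_filter, Finset.mem_product, Finset.mem_Icc, Prod.fst_add,
      Prod.snd_add]
    omega
  · rintro ⟨i, j⟩ hp
    simp only [shiftH, H, Finset.mem_filter, Finset.mem_product, Finset.mem_Icc, Prod.fst_add,
      Prod.snd_add] at hp
    simp only [Finset.mem_product, Finset.mem_Icc, Finset.mem_range]
    omega
  · rintro ⟨j, t⟩ -
    simp
  · rintro ⟨i, j⟩ hp
    simp only [shiftH, H, Finset.mem_filter, Finset.mem_product, Finset.mem_Icc, Prod.fst_add,
      Prod.snd_add] at hp
    ext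
    · simp only [Prod.fst_add]
      omega
    · simp
  · intro p _
    rfl

theorem card_shiftH (r : ℕ → ℕ) (n : ℕ) :
    ((shiftH r n).card : ℝ) = (2 * r n + 1) * (2 * r n) := by
  have h := sum_shiftH r n fun _ => 1
  simp only [Finset.sum_const, nsmul_eq_mul, mul_one, Finset.card_range, Int.card_Icc] at h
  rw [h]
  have : ((r n : ℤ) + 1 - -(r n : ℤ)).toNat = 2 * r n + 1 := by omega
  rw [this]
  push_cast
  ring

namespace Params

variable (P : Params)

theorem D_nonempty {n : ℕ} (hn : 1 ≤ n) : (P.D n).Nonempty :=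
  ⟨_, P.s_mem n hn (0, 0) (by simp [H])⟩

/-- The randomness condition on `s_n`, tested against a function with values in `[0, 1]`. -/
theorem abs_row_sub_avgD_le {n : ℕ} (hn : 1 ≤ n) {f : G → G → ℝ} (hf0 : ∀ x y, 0 ≤ f x y)
    (hf1 : ∀ x y, f x y ≤ 1) {N : ℕ} (hN : (P.r n : ℝ) / (n : ℝ) ^ 2 < N) {h h' : ℤ × ℤ}
    (hne : h ≠ h') (hmem : ∀ t < N, h + ((t : ℤ), 0) ∈ H P.r n)
    (hmem' : ∀ t < N, h' + ((t : ℤ), 0) ∈ H P.r n) :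
    |(∑ t ∈ Finset.range N, f (P.s n (h + ((t : ℤ), 0))) (P.s n (h' + ((t : ℤ), 0)))) / N -
      avgD (P.D n) f| ≤ 1 / n := by
  classical
  have hNpos : 0 < N := by
    have : (0 : ℝ) < N := lt_of_le_of_lt (by positivity) hN
    exact_mod_cast this
  have hend : ((((N - 1 : ℕ) : ℤ), 0) : ℤ × ℤ) = ((N : ℤ) - 1, 0) := by
    rw [Nat.cast_sub hNpos]
    rfl
  have hzero : ∀ q : ℤ × ℤ, q + (((0 : ℕ) : ℤ), 0) = q := fun q => add_zero q
  have hrand := P.s_random n hn N hN h (hzero h ▸ hmem 0 hNpos) h'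
    (hzero h' ▸ hmem' 0 hNpos) hne (by rw [← hend]; exact hmem _ (by omega))
    (by rw [← hend]; exact hmem' _ (by omega))
  set cnt : G → G → ℕ := fun x y => Set.ncard {t : ℕ | t < N ∧ P.s n (h + ((t : ℤ), 0)) = x ∧
    P.s n (h' + ((t : ℤ), 0)) = y} with hcnt
  have hsum : ∑ t ∈ Finset.range N, f (P.s n (h + ((t : ℤ), 0))) (P.s n (h' + ((t : ℤ), 0))) =
      ∑ x ∈ P.D n, ∑ y ∈ P.D n, (cnt x y : ℝ) * f x y := by
    rw [← Finset.sum_product (P.D n) (P.D n) (fun p => (cnt p.1 p.2 : ℝ) * f p.1 p.2),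
      ← Finset.sum_fiberwise_of_maps_to (t := P.D n ×ˢ P.D n)
        (g := fun t : ℕ => (P.s n (h + ((t : ℤ), 0)), P.s n (h' + ((t : ℤ), 0))))]
    · refine Finset.sum_congr rfl fun p _ => ?_
      rw [Finset.sum_congr rfl (g := fun _ => f p.1 p.2), Finset.sum_const, nsmul_eq_mul]
      · congr 2
        rw [hcnt, ← Set.ncard_coe_finset]
        congr 1
        ext t
        simp [Prod.ext_iff]
      · intro t ht
        obtain ⟨-, rfl⟩ := Finset.mem_filter.1 ht
        rfl
    · intro t ht
      have ht := Finset.mem_range.1 ht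
      exact Finset.mem_product.2 ⟨P.s_mem n hn _ (hmem t ht), P.s_mem n hn _ (hmem' t ht)⟩
  have hdiff : (∑ t ∈ Finset.range N,
      f (P.s n (h + ((t : ℤ), 0))) (P.s n (h' + ((t : ℤ), 0)))) / N - avgD (P.D n) f =
      ∑ x ∈ P.D n, ∑ y ∈ P.D n,
        ((cnt x y : ℝ) / N - 1 / ((P.D n).card : ℝ) ^ 2) * f x y := by
    rw [hsum, avgD, Finset.sum_div, Finset.mul_sum, ← Finset.sum_sub_distrib]
    refine Finset.sum_congr rfl fun x _ => ?_
    rw [Finset.sum_div, Finset.mul_sum, ← Finset.sum_sub_distrib]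
    refine Finset.sum_congr rfl fun y _ => ?_
    ring
  rw [hdiff]
  refine le_trans ?_ hrand.le
  refine (Finset.abs_sum_le_sum_abs _ _).trans (Finset.sum_le_sum fun x _ => ?_)
  refine (Finset.abs_sum_le_sum_abs _ _).trans (Finset.sum_le_sum fun y _ => ?_)
  rw [abs_mul, abs_of_nonneg (hf0 x y)]
  exact mul_le_of_le_one_right (abs_nonneg _) (hf1 x y)

/-- The pairs `(s_n(h), s_n(h + (1, 0)))` are almost equidistributed in `D_n × D_n`. The error `1 /
(2 r_n + 1)` is the proportion of the indices in the last column, where `h + (1, 0) ∉ H_n`. -/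
theorem abs_sum_shiftH_sub_avgD_le {n : ℕ} (hn : 1 ≤ n) {f : G → G → ℝ}
    (hf0 : ∀ x y, 0 ≤ f x y) (hf1 : ∀ x y, f x y ≤ 1) :
    |(∑ h ∈ shiftH P.r n, f (P.s n h) (P.s n (h + (1, 0)))) / (H P.r n).card -
      avgD (P.D n) f| ≤ 1 / n + 1 / (2 * P.r n + 1) := by
  have hr : (0 : ℝ) < P.r n := by exact_mod_cast P.r_pos n
  have hn' : (1 : ℝ) ≤ n := by exact_mod_cast hn
  set R : ℝ := (P.r n : ℝ) with hR
  set α := avgD (P.D n) f with hα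
  have hα0 : 0 ≤ α := by
    rw [← avgD_const (P.D_nonempty hn) 0]
    exact avgD_mono fun x _ y _ => hf0 x y
  have hα1 : α ≤ 1 := by
    rw [← avgD_const (P.D_nonempty hn) 1]
    exact avgD_mono fun x _ y _ => hf1 x y
  set row : ℤ → ℝ := fun j => ∑ t ∈ Finset.range (2 * P.r n),
    f (P.s n ((-(P.r n : ℤ), j) + ((t : ℤ), 0)))
      (P.s n ((-(P.r n : ℤ), j) + ((t : ℤ), 0) + (1, 0))) with hrow
  have hrowj : ∀ j ∈ Finset.Icc (-(P.r n : ℤ)) (P.r n), |row j - 2 * R * α| ≤ 2 * R * (1 / n) := by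
    intro j hj
    have hj' := Finset.mem_Icc.1 hj
    have hN : (P.r n : ℝ) / (n : ℝ) ^ 2 < ((2 * P.r n : ℕ) : ℝ) := by
      push_cast
      calc (P.r n : ℝ) / (n : ℝ) ^ 2 ≤ P.r n := div_le_self hr.le (one_le_pow₀ hn')
        _ < 2 * P.r n := by linarith
    -- A row is a segment of length `2 r_n`, which exceeds `r_n / n²`.
    have h := P.abs_row_sub_avgD_le hn hf0 hf1 hN (h := (-(P.r n : ℤ), j))
      (h' := (-(P.r n : ℤ), j) + (1, 0)) (by simp) ?_ ?_
    · have hcomm : ∀ t : ℕ, ((-(P.r n : ℤ), j) : ℤ × ℤ) + (1, 0) + ((t : ℤ), 0) =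
          (-(P.r n : ℤ), j) + ((t : ℤ), 0) + (1, 0) := fun t => add_right_comm _ _ _
      simp only [hcomm] at h
      rw [← hα] at h
      push_cast at h
      rw [← hR] at h
      have h2 : row j - 2 * R * α = 2 * R * (row j / (2 * R) - α) := by
        field_simp
      rw [h2, abs_mul, abs_of_pos (by linarith)]
      exact mul_le_mul_of_nonneg_left h (by linarith)
    · intro t ht
      simp only [H, Finset.mem_product, Finset.mem_Icc, Prod.fst_add, Prod.snd_add]
      omega
    · intro t ht
      simp only [H, Finset.mem_product, Finset.mem_Icc, Prod.fst_add, Prod.snd_add]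
      omega
  have hcard : ((Finset.Icc (-(P.r n : ℤ)) (P.r n)).card : ℝ) = 2 * R + 1 := by
    rw [Int.card_Icc, show ((P.r n : ℤ) + 1 - -(P.r n : ℤ)).toNat = 2 * P.r n + 1 by omega]
    push_cast
    rfl
  have htot : |∑ j ∈ Finset.Icc (-(P.r n : ℤ)) (P.r n), row j - (2 * R + 1) * (2 * R * α)| ≤
      (2 * R + 1) * (2 * R * (1 / n)) := by
    rw [← hcard, ← nsmul_eq_mul, ← nsmul_eq_mul, ← Finset.sum_const, ← Finset.sum_const,
      ← Finset.sum_sub_distrib]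
    exact (Finset.abs_sum_le_sum_abs _ _).trans (Finset.sum_le_sum hrowj)
  rw [sum_shiftH, card_H]
  change |(∑ j ∈ Finset.Icc (-(P.r n : ℤ)) (P.r n), row j) / _ - α| ≤ _
  set Tot := ∑ j ∈ Finset.Icc (-(P.r n : ℤ)) (P.r n), row j
  push_cast
  rw [← hR]
  have hpos : 0 < 2 * R + 1 := by linarith
  have hsplit : Tot / (2 * R + 1) ^ 2 - α =
      (Tot - (2 * R + 1) * (2 * R * α)) / (2 * R + 1) ^ 2 - α * (1 / (2 * R + 1)) := by
    field_simp
    ring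
  rw [hsplit]
  refine (abs_sub _ _).trans (add_le_add ?_ ?_)
  · rw [abs_div, abs_of_pos (pow_pos hpos 2), div_le_iff₀ (pow_pos hpos 2)]
    refine htot.trans ?_
    have : (0 : ℝ) ≤ 1 / n := by positivity
    nlinarith [mul_nonneg this hpos.le]
  · rw [abs_of_nonneg (by positivity)]
    exact mul_le_of_le_one_left (by positivity) hα1

end Params

/-! ### Averages over `S_n × S_n` -/

/-- The average of `f` over `S_n × S_n`. -/
noncomputable def avgS (r : ℕ → ℕ) (n : ℕ) (f : G → G → ℝ) : ℝ :=
  (1 / (G.haar (S r n)).toReal ^ 2) * ∫ x in S r n, ∫ y in S r n, f x y ∂G.haar ∂G.haar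

theorem mem_mul_singleton_iff {A : Set G} {x z : G} : z ∈ A * {x} ↔ z * x⁻¹ ∈ A := by
  rw [Set.mul_singleton, Set.image_mul_right, mem_preimage]

theorem measurable_haar_inter_mul {A B : Set G} (hA : MeasurableSet A) (hB : MeasurableSet B) :
    Measurable fun p : G × G => G.haar ((A * {p.1}) ∩ (B * {p.2})) := by
  have hW : MeasurableSet {q : (G × G) × G | q.2 * q.1.1⁻¹ ∈ A ∧ q.2 * q.1.2⁻¹ ∈ B} :=
    ((measurable_snd.mul measurable_fst.fst.inv) hA).inter
      ((measurable_snd.mul measurable_fst.snd.inv) hB)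
  have h := measurable_measure_prodMk_left (ν := G.haar) hW
  have heq : ∀ p : G × G, (A * {p.1}) ∩ (B * {p.2}) =
      Prod.mk p ⁻¹' {q : (G × G) × G | q.2 * q.1.1⁻¹ ∈ A ∧ q.2 * q.1.2⁻¹ ∈ B} := by
    intro p
    ext z
    rw [mem_inter_iff, mem_mul_singleton_iff, mem_mul_singleton_iff]
    rfl
  simpa only [heq] using h

theorem measurable_haar_inter {E B : Set G} (hE : MeasurableSet E) (hB : MeasurableSet B) :
    Measurable fun y : G => G.haar (E ∩ (B * {y})) := by
  have h := (measurable_haar_inter_mul hE hB).comp (measurable_prodMk_left (x := (1 : G)))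
  simpa [Function.comp_def] using h

/-- Tonelli's theorem for the set of pairs `(y, z)` with `z ∈ B y`. -/
theorem lintegral_haar_inter {E B T : Set G} (hB : MeasurableSet B) :
    ∫⁻ y in T, G.haar (E ∩ (B * {y})) ∂G.haar =
      ∫⁻ z in E, G.haar ({y | z * y⁻¹ ∈ B} ∩ T) ∂G.haar := by
  have hW : MeasurableSet {p : G × G | p.2 * p.1⁻¹ ∈ B} :=
    (measurable_snd.mul measurable_fst.inv) hB
  have h1 := Measure.prod_apply (μ := G.haar.restrict T) (ν := G.haar.restrict E) hW
  have h2 := Measure.prod_apply_symm (μ := G.haar.restrict T) (ν := G.haar.restrict E) hW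
  rw [h1] at h2
  calc ∫⁻ y in T, G.haar (E ∩ (B * {y})) ∂G.haar
      = ∫⁻ y in T, G.haar.restrict E (Prod.mk y ⁻¹' {p : G × G | p.2 * p.1⁻¹ ∈ B}) ∂G.haar := by
        refine lintegral_congr fun y => ?_
        rw [Measure.restrict_apply (measurable_prodMk_left hW), inter_comm]
        congr 2
        ext z
        rw [mem_mul_singleton_iff]
        rfl
    _ = _ := h2
    _ = _ := by
        refine lintegral_congr fun z => ?_
        rw [Measure.restrict_apply (measurable_prodMk_right hW)]
        rfl

/-- If no point is covered by more than the amount `K` of the translates `B y`, `y ∈ T`, then the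
total overlap of these translates with `E` is at most `K λ(E)`. -/
theorem setIntegral_haar_inter_le {E B T : Set G} (hE : MeasurableSet E) (hB : MeasurableSet B)
    (hEfin : G.haar E ≠ ∞) {K : ℝ} (hK0 : 0 ≤ K)
    (hK : ∀ z, G.haar ({y | z * y⁻¹ ∈ B} ∩ T) ≤ ENNReal.ofReal K) :
    ∫ y in T, G.haar.real (E ∩ (B * {y})) ∂G.haar ≤ K * G.haar.real E := by
  have hle : ∫⁻ y in T, G.haar (E ∩ (B * {y})) ∂G.haar ≤ ENNReal.ofReal K * G.haar E := by
    rw [lintegral_haar_inter hB]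
    refine (lintegral_mono fun z => hK z).trans ?_
    rw [lintegral_const, Measure.restrict_apply_univ]
  have hfin : ∀ y, G.haar (E ∩ (B * {y})) < ∞ := fun y =>
    (measure_mono inter_subset_left).trans_lt hEfin.lt_top
  simp only [measureReal_def]
  rw [integral_toReal (measurable_haar_inter hE hB).aemeasurable (Eventually.of_forall hfin)]
  calc _ ≤ (ENNReal.ofReal K * G.haar E).toReal :=
        ENNReal.toReal_mono (ENNReal.mul_ne_top ENNReal.ofReal_ne_top hEfin) hle
    _ = _ := by rw [ENNReal.toReal_mul, ENNReal.toReal_ofReal hK0]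

theorem setIntegral_mem_Icc {T : Set G} (hT : MeasurableSet T) (hTfin : G.haar T ≠ ∞)
    {f : G → ℝ} (hf : AEStronglyMeasurable f (G.haar.restrict T)) {lo hi : ℝ}
    (h : ∀ x ∈ T, f x ∈ Icc lo hi) :
    ∫ x in T, f x ∂G.haar ∈ Icc (lo * G.haar.real T) (hi * G.haar.real T) := by
  have hfin : IsFiniteMeasure (G.haar.restrict T) := ⟨by simpa using hTfin.lt_top⟩
  have hint : Integrable f (G.haar.restrict T) := by
    refine Integrable.of_bound hf (max |lo| |hi|) ?_
    filter_upwards [ae_restrict_mem hT] with x hx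
    exact abs_le_max_abs_abs (h x hx).1 (h x hx).2
  constructor
  · have := setIntegral_mono_on (μ := G.haar) (integrable_const lo) hint hT
      fun x hx => (h x hx).1
    simpa [mul_comm] using this
  · have := setIntegral_mono_on (μ := G.haar) hint (integrable_const hi) hT
      fun x hx => (h x hx).2
    simpa [mul_comm] using this

/-- If almost every point is covered by about the same proportion `K` of the translates `B y`,
`y ∈ S_n`, then the average overlap of `A x` and `B y` is about `K λ(A) / λ(F_n)`. It suffices to
bound the proportion from above, since the bound may be applied to `F_n \ A x` as well. -/
theorem avgS_overlap_mem_Icc {r : ℕ → ℕ} {n : ℕ} {A B : Set G} (hAm : MeasurableSet A)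
    (hBm : MeasurableSet B) (hA : ∀ x ∈ S r n, A * {x} ⊆ F r n) (hB : ∀ x ∈ S r n, B * {x} ⊆ F r n)
    (hS : 0 < G.haar.real (S r n)) {K : ℝ} (hK0 : 0 ≤ K)
    (hK : ∀ z, G.haar.real ({y | z * y⁻¹ ∈ B} ∩ S r n) ≤ K * G.haar.real (S r n)) :
    avgS r n (overlap r n A B) ∈
      Icc ((G.haar.real B - K * (G.haar.real (F r n) - G.haar.real A)) / G.haar.real (F r n))
        (K * G.haar.real A / G.haar.real (F r n)) := by
  have hSm : MeasurableSet (S r n) := measurableSet_box _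
  have hFm : MeasurableSet (F r n) := measurableSet_box _
  have hSfin : G.haar (S r n) ≠ ∞ := G.haar_box_ne_top _
  have hFfin : G.haar (F r n) ≠ ∞ := G.haar_box_ne_top _
  have hSfin' : IsFiniteMeasure (G.haar.restrict (S r n)) := ⟨by simpa using hSfin.lt_top⟩
  set s := G.haar.real (S r n) with hs
  set φ := G.haar.real (F r n) with hφ
  have hK' : ∀ z, G.haar ({y | z * y⁻¹ ∈ B} ∩ S r n) ≤ ENNReal.ofReal (K * s) := by
    intro z
    rw [ENNReal.le_ofReal_iff_toReal_le _ (by positivity)]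
    · exact hK z
    · exact ((measure_mono inter_subset_right).trans_lt hSfin.lt_top).ne
  have hover : ∀ x y, overlap r n A B x y = G.haar.real (A * {x} ∩ (B * {y})) / φ := fun _ _ => rfl
  have hrealmul : ∀ (E : Set G) x, G.haar.real (E * {x}) = G.haar.real E := fun E x => by
    rw [measureReal_def, CFSeq.measure_mul_singleton, measureReal_def]
  have hinner : ∀ x ∈ S r n, ∫ y in S r n, overlap r n A B x y ∂G.haar ∈
      Icc (s * (G.haar.real B - K * (φ - G.haar.real A)) / φ) (s * (K * G.haar.real A) / φ) := by
    intro x hx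
    have hEm : MeasurableSet (A * {x}) := hAm.mul_singleton_right x
    have hEF := hA x hx
    have hEfin : G.haar (A * {x}) ≠ ∞ := ((measure_mono hEF).trans_lt hFfin.lt_top).ne
    simp only [hover]
    rw [integral_div]
    have hφ0 : 0 ≤ φ := measureReal_nonneg
    constructor
    · refine div_le_div_of_nonneg_right ?_ hφ0
      -- For the lower bound, apply the upper bound to the complement of `A x` in `F`.
      have hcm : MeasurableSet (F r n \ (A * {x})) := hFm.diff hEm
      have hcfin : G.haar (F r n \ (A * {x})) ≠ ∞ :=
        ((measure_mono sdiff_subset).trans_lt hFfin.lt_top).ne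
      have h1 := setIntegral_haar_inter_le hcm hBm hcfin (by positivity) hK'
      rw [measureReal_sdiff hEF hEm, hrealmul] at h1
      have h2 : ∀ y ∈ S r n, G.haar.real (A * {x} ∩ (B * {y})) =
          G.haar.real B - G.haar.real ((F r n \ (A * {x})) ∩ (B * {y})) := by
        intro y hy
        have hBfin : G.haar (B * {y}) ≠ ∞ :=
          ((measure_mono (hB y hy)).trans_lt hFfin.lt_top).ne
        have hd := measureReal_inter_add_sdiff (μ := G.haar) (s := B * {y}) hEm hBfin
        have hset : (B * {y}) \ (A * {x}) = (F r n \ (A * {x})) ∩ (B * {y}) := by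
          ext z
          constructor
          · exact fun h => ⟨⟨hB y hy h.1, h.2⟩, h.1⟩
          · exact fun h => ⟨h.2, h.1.2⟩
        rw [hset, hrealmul, inter_comm] at hd
        linarith
      rw [setIntegral_congr_fun hSm h2, integral_sub (integrable_const _)]
      · simp only [integral_const, measureReal_restrict_apply_univ, smul_eq_mul]
        rw [← hs]
        nlinarith [h1]
      · refine Integrable.of_bound (C := φ) ?_ (Eventually.of_forall fun y => ?_)
        · exact (measurable_haar_inter hcm hBm).ennreal_toReal.aestronglyMeasurable
        · rw [Real.norm_of_nonneg measureReal_nonneg]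
          exact measureReal_mono (inter_subset_left.trans sdiff_subset) hFfin
    · refine div_le_div_of_nonneg_right ?_ hφ0
      have h1 := setIntegral_haar_inter_le hEm hBm hEfin (by positivity) hK'
      rw [hrealmul] at h1
      linarith
  have hmeas : StronglyMeasurable fun p : G × G => overlap r n A B p.1 p.2 :=
    ((measurable_haar_inter_mul hAm hBm).ennreal_toReal.div_const _).stronglyMeasurable
  have hout := setIntegral_mem_Icc hSm hSfin
    (hmeas.integral_prod_right (ν := G.haar.restrict (S r n))).aestronglyMeasurable hinner
  rw [← hs] at hout
  have hs2 : 0 < 1 / s ^ 2 := by positivity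
  have havg : avgS r n (overlap r n A B) = (1 / s ^ 2) *
      ∫ x in S r n, ∫ y in S r n, overlap r n A B x y ∂G.haar ∂G.haar := rfl
  rw [havg]
  constructor
  · calc _ = (1 / s ^ 2) * (s * (G.haar.real B - K * (φ - G.haar.real A)) / φ * s) := by
          field_simp
      _ ≤ _ := mul_le_mul_of_nonneg_left hout.1 hs2.le
  · calc _ ≤ (1 / s ^ 2) * (s * (K * G.haar.real A) / φ * s) :=
          mul_le_mul_of_nonneg_left hout.2 hs2.le
      _ = _ := by field_simp

/-! ### Counting windows -/

/-- The part of `A` in the coset of `ℤ × ℝ` given by `ε`. -/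
def sheet (ε : ZMod 2) (A : Set G) : Set G := A ∩ {x | x.e = ε}

theorem measurableSet_sheet (ε : ZMod 2) {A : Set G} (hA : MeasurableSet A) :
    MeasurableSet (sheet ε A) :=
  hA.inter (G.measurable_e (measurableSet_singleton ε))

theorem haar_setOf_mul_inv_mem (z : G) (A : Set G) : G.haar {y | z * y⁻¹ ∈ A} = G.haar A := by
  have h : {y | z * y⁻¹ ∈ A} = (fun y => y * z⁻¹) ⁻¹' A⁻¹ := by
    ext y
    simp
  rw [h, measure_preimage_mul_right, Measure.measure_inv]

/-- The integers `i` for which `u - 2 i L` lies in `(-2 k L, 2 k L]`; there are `2 k` of them. -/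
noncomputable def nearby (L : ℕ) (k : ℕ) (u : ℝ) : Finset ℤ :=
  Finset.Ico ⌈u / (2 * L) - k⌉ ⌈u / (2 * L) + k⌉

theorem card_nearby (L k : ℕ) (u : ℝ) : (nearby L k u).card = 2 * k := by
  rw [nearby, Int.card_Ico, Int.ceil_sub_natCast, Int.ceil_add_natCast]
  omega

theorem mem_nearby {L k : ℕ} (hL : 0 < L) {u : ℝ} {i : ℤ}
    (h : u - 2 * i * L ∈ Ioc (-(2 * (k : ℝ) * L)) (2 * k * L)) : i ∈ nearby L k u := by
  have hL' : (0 : ℝ) < 2 * L := by positivity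
  have h1 := h.1
  have h2 := h.2
  refine Finset.mem_Ico.2 ⟨Int.ceil_le.2 ?_, Int.lt_ceil.2 ?_⟩
  · rw [sub_le_iff_le_add, div_le_iff₀ hL']
    linarith
  · rw [← sub_lt_iff_lt_add, lt_div_iff₀ hL']
    linarith

namespace Params

variable (P : Params)

/-- The `y ∈ S_{n+2}` with `z ∈ A C y` are those for which `z y⁻¹` lies in the copy of `A` in some
window. In either of the two cosets of `ℤ × ℝ` only `(2 (n + 2))²` windows are close enough to `z`,
and each of them contributes at most `m`. -/
theorem haar_real_hit_le (n : ℕ) {A : Set G} (hA : A ⊆ F P.r (n + 1)) {m : ℝ}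
    (hm : ∀ ε, G.haar.real (sheet ε A) ≤ m) (z : G) :
    G.haar.real ({y | z * y⁻¹ ∈ A * (Cnext P.r P.s (n + 1) : Set G)} ∩ S P.r (n + 2)) ≤
      2 * (2 * (n + 2 : ℝ)) ^ 2 * m := by
  classical
  set L := ta P.r (n + 1) with hL
  have hLpos : 0 < L := ta_pos _ _
  let c : ℤ × ℤ → G := fun h => P.s (n + 1) h * phi P.r (n + 1) h
  let near : ZMod 2 → Finset (ℤ × ℤ) := fun ε =>
    nearby L (n + 2) (z.z : ℝ) ×ˢ nearby L (n + 2) (sgn ε * z.t)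
  let piece : ZMod 2 → ℤ × ℤ → Set G := fun ε h =>
    {y | z * y⁻¹ ∈ sheet (ε - (P.s (n + 1) h).e) A * {c h}}
  have hsub : {y | z * y⁻¹ ∈ A * (Cnext P.r P.s (n + 1) : Set G)} ∩ S P.r (n + 2) ⊆
      ⋃ ε ∈ (Finset.univ : Finset (ZMod 2)), ⋃ h ∈ near ε, piece ε h := by
    rintro y ⟨⟨x, hx, c', hc', hxc⟩, hy⟩
    obtain ⟨h, hh, rfl⟩ := Finset.mem_image.1 (Finset.mem_coe.1 hc')
    have hw : x * P.s (n + 1) h ∈ box (ta P.r (n + 1)) :=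
      P.mul_s_mem (k := 0) (by omega) (hA hx) hh
    set w := x * P.s (n + 1) h with hwdef
    have hz : w * phi P.r (n + 1) h * y = z := by
      have hxc' : x * (P.s (n + 1) h * phi P.r (n + 1) h) = z * y⁻¹ := hxc
      rw [hwdef, mul_assoc x, hxc', inv_mul_cancel_right]
    have hb : ((b P.r (n + 2) : ℕ) : ℝ) = (2 * n + 3) * L := by
      simp only [b, hL]
      push_cast
      ring
    obtain ⟨⟨w1, w2⟩, w3, w4⟩ := hw
    obtain ⟨⟨y1, y2⟩, y3, y4⟩ := hy
    have w1' : -(L : ℝ) < w.z := by exact_mod_cast w1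
    have w2' : (w.z : ℝ) ≤ L := by exact_mod_cast w2
    have y1' : -((b P.r (n + 2) : ℕ) : ℝ) < y.z := by exact_mod_cast y1
    have y2' : (y.z : ℝ) ≤ (b P.r (n + 2) : ℕ) := by exact_mod_cast y2
    rw [hb] at y1' y2' y3 y4
    simp only [mem_iUnion, exists_prop]
    refine ⟨w.e, Finset.mem_univ _, h, Finset.mem_product.2 ⟨mem_nearby hLpos ?_,
      mem_nearby hLpos ?_⟩, x, ⟨hx, ?_⟩, c h, rfl, hxc⟩
    · have hzz : (z.z : ℝ) = w.z + 2 * h.1 * L + y.z := by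
        rw [← hz]
        simp only [G.mul_z, phi]
        push_cast
        ring
      push_cast
      constructor <;> rw [hzz] <;> linarith
    · have hzt : z.t = w.t + sgn w.e * (2 * h.2 * L) + sgn w.e * y.t := by
        rw [← hz]
        simp only [G.mul_t, G.mul_e, phi, add_zero]
        rfl
      have hsq : sgn w.e * z.t = sgn w.e * w.t + 2 * h.2 * L + y.t := by
        rw [hzt]
        linear_combination (2 * (h.2 : ℝ) * L + y.t) * sgn_mul_self w.e
      rw [hsq]
      push_cast
      rcases sgn_cases w.e with ⟨_, hs⟩ | ⟨_, hs⟩ <;> rw [hs] <;> constructor <;> linarith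
    · change x.e = w.e - (P.s (n + 1) h).e
      rw [hwdef, G.mul_e, add_sub_cancel_right]
  have hAfin : G.haar A ≠ ∞ := ((measure_mono hA).trans_lt (G.haar_box_ne_top _).lt_top).ne
  have hpiece : ∀ ε h, G.haar (piece ε h) = G.haar (sheet (ε - (P.s (n + 1) h).e) A) := by
    intro ε h
    rw [haar_setOf_mul_inv_mem, CFSeq.measure_mul_singleton]
  have hfin : ∀ ε, G.haar (sheet ε A) ≠ ∞ := fun ε =>
    ((measure_mono inter_subset_left).trans_lt hAfin.lt_top).ne
  have hunion : ∀ ε, G.haar.real (⋃ h ∈ near ε, piece ε h) ≤ (2 * (n + 2 : ℝ)) ^ 2 * m := by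
    intro ε
    refine (measureReal_biUnion_finset_le _ _).trans ?_
    refine (Finset.sum_le_card_nsmul _ _ m fun h _ => ?_).trans (le_of_eq ?_)
    · rw [measureReal_def, hpiece]
      exact hm _
    · rw [nsmul_eq_mul, Finset.card_product, card_nearby, card_nearby]
      push_cast
      ring
  refine (measureReal_mono hsub ?_).trans ((measureReal_biUnion_finset_le _ _).trans ?_)
  · refine ((measure_biUnion_finset_le _ _).trans_lt (ENNReal.sum_lt_top.2 fun ε _ =>
      (measure_biUnion_finset_le _ _).trans_lt (ENNReal.sum_lt_top.2 fun h _ => ?_))).ne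
    rw [hpiece]
    exact (hfin _).lt_top
  · refine (Finset.sum_le_card_nsmul _ _ _ fun ε _ => hunion ε).trans (le_of_eq ?_)
    rw [Finset.card_univ, ZMod.card, nsmul_eq_mul]
    push_cast
    ring

end Params

/-! ### Growth of the sets `F_n` and finiteness of the measure -/

namespace Params

variable (P : Params)

theorem tendsto_div_r : Tendsto (fun n : ℕ => (n : ℝ) / P.r n) atTop (𝓝 0) := by
  refine tendsto_of_tendsto_of_tendsto_of_le_of_le tendsto_const_nhds P.r_growth
    (fun n => by positivity) fun n => ?_
  refine div_le_div_of_nonneg_right ?_ (by positivity)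
  rcases Nat.eq_zero_or_pos n with rfl | hn
  · simp
  · have h1 : (1 : ℝ) ≤ n := by exact_mod_cast hn
    exact le_self_pow₀ h1 (by norm_num)

theorem tendsto_one_div_r :
    Tendsto (fun n : ℕ => 1 / (2 * (P.r n : ℝ) + 1)) atTop (𝓝 0) := by
  refine tendsto_of_tendsto_of_tendsto_of_le_of_le' tendsto_const_nhds P.tendsto_div_r
    (Eventually.of_forall fun n => by positivity) ?_
  filter_upwards [eventually_ge_atTop 1] with n hn
  have hr : (0 : ℝ) < P.r n := by exact_mod_cast P.r_pos n
  have hn' : (1 : ℝ) ≤ n := by exact_mod_cast hn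
  exact div_le_div₀ (by linarith) hn' hr (by linarith)

theorem a_cast_succ (n : ℕ) : (a P.r (n + 1) : ℝ) = (2 * P.r n + 1) * ta P.r n := by
  simp [a]

theorem b_cast_succ (n : ℕ) : (b P.r (n + 1) : ℝ) = (2 * n + 1) * ta P.r n := by
  simp [b]

theorem a_cast_pos (n : ℕ) : (0 : ℝ) < a P.r (n + 1) := by exact_mod_cast P.a_pos n

theorem ta_cast_pos (n : ℕ) : (0 : ℝ) < ta P.r n := by exact_mod_cast ta_pos P.r n

theorem b_div_a (n : ℕ) :
    (b P.r (n + 1) : ℝ) / a P.r (n + 1) = (2 * n + 1) / (2 * P.r n + 1) := by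
  rw [a_cast_succ, b_cast_succ, mul_div_mul_right _ _ (P.ta_cast_pos n).ne']

theorem tendsto_b_div_a :
    Tendsto (fun n => (b P.r (n + 1) : ℝ) / a P.r (n + 1)) atTop (𝓝 0) := by
  have h := P.tendsto_div_r.add P.tendsto_one_div_r
  rw [add_zero] at h
  refine tendsto_of_tendsto_of_tendsto_of_le_of_le tendsto_const_nhds h
    (fun n => by positivity) fun n => ?_
  have hr : (0 : ℝ) < P.r n := by exact_mod_cast P.r_pos n
  simp only [b_div_a, add_div]
  gcongr ?_ + _
  rw [div_le_div_iff₀ (by linarith) hr]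
  nlinarith [(Nat.cast_nonneg n : (0 : ℝ) ≤ n)]

/-- The excess of `ã_n / a_n` over `1` is `O(n / r_{n-1})`. -/
theorem ta_div_a_le (n : ℕ) :
    (ta P.r (n + 1) : ℝ) / a P.r (n + 1) ≤ 1 + 3 * (n + 1) / (2 * P.r n) := by
  have hr : (0 : ℝ) < P.r n := by exact_mod_cast P.r_pos n
  have ht := P.ta_cast_pos n
  have ht1 : (1 : ℝ) ≤ ta P.r n := by exact_mod_cast ta_pos P.r n
  have hn : (0 : ℝ) ≤ n := Nat.cast_nonneg n
  have hta : (ta P.r (n + 1) : ℝ) = a P.r (n + 1) + b P.r (n + 1) + (n + 1) := by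
    rw [ta_succ]
    push_cast
    ring
  have ha := P.a_cast_pos n
  rw [div_le_iff₀ ha, hta, add_mul, one_mul, add_assoc]
  gcongr
  rw [a_cast_succ, b_cast_succ]
  have h1 : (3 * (n + 1) / (2 * P.r n) : ℝ) * ((2 * P.r n + 1) * ta P.r n) =
      3 * (n + 1) * ta P.r n + 3 * (n + 1) / (2 * P.r n) * ta P.r n := by
    field_simp
  rw [h1]
  have h2 : 0 ≤ (3 * (n + 1) / (2 * P.r n) : ℝ) * ta P.r n := by positivity
  nlinarith

theorem one_le_ta_div_a (n : ℕ) : 1 ≤ (ta P.r (n + 1) : ℝ) / a P.r (n + 1) := by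
  rw [one_le_div (P.a_cast_pos n)]
  exact_mod_cast (by rw [ta_succ]; omega : a P.r (n + 1) ≤ ta P.r (n + 1))

theorem tendsto_ta_div_a :
    Tendsto (fun n => (ta P.r (n + 1) : ℝ) / a P.r (n + 1)) atTop (𝓝 1) := by
  have h1 : Tendsto (fun n : ℕ => 1 + 3 * ((n : ℝ) / P.r n)) atTop (𝓝 (1 + 3 * 0)) :=
    (P.tendsto_div_r.const_mul 3).const_add 1
  rw [mul_zero, add_zero] at h1
  refine tendsto_of_tendsto_of_tendsto_of_le_of_le' tendsto_const_nhds h1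
    (Eventually.of_forall P.one_le_ta_div_a) ?_
  filter_upwards [eventually_ge_atTop 1] with n hn
  have hr : (0 : ℝ) < P.r n := by exact_mod_cast P.r_pos n
  have hn' : (1 : ℝ) ≤ n := by exact_mod_cast hn
  refine (P.ta_div_a_le n).trans ?_
  gcongr 1 + ?_
  rw [← mul_div_assoc, div_le_div_iff₀ (by linarith) hr]
  nlinarith

/-- This is where the growth of `r_n` enters: `n / r_n ≤ 1 / n ^ 3` for large `n`. -/
theorem summable_excess : Summable fun n : ℕ => (3 * (n + 1) / (2 * P.r n) : ℝ) := by
  have h2 : Summable fun n : ℕ => 3 * (1 / (n : ℝ) ^ 2) :=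
    (Real.summable_one_div_nat_pow.2 (by norm_num)).mul_left 3
  refine Summable.of_norm_bounded_eventually_nat h2 ?_
  filter_upwards [eventually_ge_atTop 1, P.r_growth.eventually (gt_mem_nhds one_pos)] with n hn hlt
  have hr : (0 : ℝ) < P.r n := by exact_mod_cast P.r_pos n
  have hn' : (1 : ℝ) ≤ n := by exact_mod_cast hn
  rw [div_lt_one hr] at hlt
  rw [Real.norm_of_nonneg (by positivity), ← mul_div_assoc, mul_one,
    div_le_div_iff₀ (by linarith) (by positivity)]
  have h3 : (n : ℝ) ^ 3 ≤ (n : ℝ) ^ 4 := pow_le_pow_right₀ hn' (by norm_num)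
  nlinarith [mul_le_mul_of_nonneg_right hn' (sq_nonneg (n : ℝ))]

theorem card_Cnext (n : ℕ) : (Cnext P.r P.s (n + 1)).card = (H P.r (n + 1)).card := by
  classical
  refine Finset.card_image_of_injOn fun h hh h' hh' heq => ?_
  have h1F : (1 : G) ∈ F P.r (n + 1) := one_mem_box (P.a_pos n)
  exact P.unique_index h1F h1F (Finset.mem_coe.1 hh) (Finset.mem_coe.1 hh') (by
    simpa only [one_mul] using heq)

theorem cardProd_cf_succ (n : ℕ) :
    (P.cf.cardProd (n + 1) : ℝ) = P.cf.cardProd n * (2 * P.r (n + 1) + 1) ^ 2 := by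
  rw [CFSeq.cardProd_succ]
  change ((P.cf.cardProd n * (Cnext P.r P.s (n + 1)).card : ℕ) : ℝ) = _
  rw [card_Cnext, card_H]
  push_cast
  rfl

theorem cardProd_cf_pos (n : ℕ) : (0 : ℝ) < P.cf.cardProd n := by
  exact_mod_cast CFSeq.cardProd_pos n

theorem haar_real_F (n : ℕ) : G.haar.real (F P.r n) = 8 * (a P.r n : ℝ) ^ 2 := G.haar_real_box _

theorem haar_real_F_pos (n : ℕ) : 0 < G.haar.real (F P.r (n + 1)) := by
  rw [haar_real_F]
  have := P.a_cast_pos n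
  positivity

theorem haar_F_ne_top (n : ℕ) : G.haar (F P.r n) ≠ ∞ := G.haar_box_ne_top _

/-- The measure of `X_n` grows by the factor `(ã_n / a_n)²` from one level to the next, and the
product of these factors is bounded. -/
theorem haar_real_F_div_cardProd_le (n : ℕ) : G.haar.real (F P.r (n + 1)) / P.cf.cardProd n ≤
    G.haar.real (F P.r 1) *
      Real.exp (∑ i ∈ Finset.range n, 2 * (3 * ((i : ℝ) + 1) / (2 * P.r i))) := by
  induction n with
  | zero => simp [CFSeq.cardProd]
  | succ n ih =>
    have hstep : G.haar.real (F P.r (n + 2)) / P.cf.cardProd (n + 1) =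
        G.haar.real (F P.r (n + 1)) / P.cf.cardProd n *
          ((ta P.r (n + 1) : ℝ) / a P.r (n + 1)) ^ 2 := by
      rw [haar_real_F, haar_real_F, cardProd_cf_succ, a_cast_succ P (n + 1)]
      have h1 := P.a_cast_pos n
      have h2 := P.cardProd_cf_pos n
      have h3 : (0 : ℝ) < 2 * P.r (n + 1) + 1 := by positivity
      field_simp
    have hexp : ((ta P.r (n + 1) : ℝ) / a P.r (n + 1)) ^ 2 ≤
        Real.exp (2 * (3 * ((n : ℝ) + 1) / (2 * P.r n))) := by
      rw [two_mul, Real.exp_add, ← sq]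
      refine pow_le_pow_left₀ (by positivity) ((P.ta_div_a_le n).trans ?_) 2
      rw [add_comm]
      exact Real.add_one_le_exp _
    rw [hstep, Finset.sum_range_succ, Real.exp_add, ← mul_assoc]
    gcongr

theorem inv_cardProd_mul_haar_F (n : ℕ) :
    (P.cf.cardProd n : ℝ≥0∞)⁻¹ * G.haar (P.cf.F n) =
      ENNReal.ofReal (G.haar.real (F P.r (n + 1)) / P.cf.cardProd n) := by
  change (P.cf.cardProd n : ℝ≥0∞)⁻¹ * G.haar (F P.r (n + 1)) = _
  rw [ENNReal.ofReal_div_of_pos (P.cardProd_cf_pos n), ENNReal.ofReal_natCast,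
    measureReal_def, ENNReal.ofReal_toReal (P.haar_F_ne_top _), mul_comm, ENNReal.div_eq_inv_mul,
    mul_comm]

theorem preMeasure_univ_ne_top : P.cf.preMeasure G.haar univ ≠ ∞ := by
  rw [CFSeq.preMeasure_univ fun n => P.haar_F_ne_top (n + 1)]
  refine ne_top_of_le_ne_top (b := ENNReal.ofReal (G.haar.real (F P.r 1) *
    Real.exp (∑' i : ℕ, 2 * (3 * ((i : ℝ) + 1) / (2 * P.r i))))) ENNReal.ofReal_ne_top ?_
  refine iSup_le fun n => ?_
  rw [inv_cardProd_mul_haar_F]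
  refine ENNReal.ofReal_le_ofReal ((P.haar_real_F_div_cardProd_le n).trans ?_)
  gcongr
  exact (P.summable_excess.mul_left 2).sum_le_tsum _ fun i _ => by positivity

instance : IsProbabilityMeasure P.μ :=
  CFSeq.isProbabilityMeasure_measure
    (fun h => (P.haar_real_F_pos 0).ne' (by
      change G.haar (F P.r 1) = 0 at h
      rw [zero_add, measureReal_def, h, ENNReal.toReal_zero]))
    (fun n => P.haar_F_ne_top (n + 1)) P.preMeasure_univ_ne_top

instance : IsProbabilityMeasure (P.cf.measure G.haar) := inferInstanceAs (IsProbabilityMeasure P.μ)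

theorem measurePreserving_T (g : G) : MeasurePreserving (P.T g) P.μ P.μ :=
  CFSeq.measurePreserving_act (fun n => P.haar_F_ne_top (n + 1)) g

/-- The ratio of `μ([A]_n)` and `λ(A)`. -/
noncomputable def density (n : ℕ) : ℝ :=
  (P.cf.preMeasure G.haar univ).toReal⁻¹ * (P.cf.cardProd n : ℝ)⁻¹

theorem density_nonneg (n : ℕ) : 0 ≤ P.density n := by
  unfold density
  positivity

theorem density_succ (n : ℕ) : P.density (n + 1) * (H P.r (n + 1)).card = P.density n := by
  have h : (((H P.r (n + 1)).card : ℕ) : ℝ) = (2 * P.r (n + 1) + 1) ^ 2 := by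
    rw [card_H]
    push_cast
    rfl
  rw [density, density, cardProd_cf_succ, h]
  have h1 := P.cardProd_cf_pos n
  have h3 : (0 : ℝ) < 2 * P.r (n + 1) + 1 := by positivity
  field_simp

theorem μ_real_cyl (n : ℕ) {A : Set G} (hA : MeasurableSet A) (hAF : A ⊆ F P.r (n + 1)) :
    P.μ.real (P.cf.cyl n A) = P.density n * G.haar.real A := by
  have h := CFSeq.preMeasure_cyl (Q := P.cf) (lam := G.haar)
    (fun n => P.haar_F_ne_top (n + 1)) n hA
  have hAF' : A ∩ P.cf.F n = A := inter_eq_left.2 hAF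
  rw [hAF'] at h
  change ((P.cf.preMeasure G.haar univ)⁻¹ • P.cf.preMeasure G.haar).real _ = _
  rw [measureReal_def, Measure.smul_apply, h, smul_eq_mul, ENNReal.toReal_mul, ENNReal.toReal_mul,
    ENNReal.toReal_inv, ENNReal.toReal_inv, ENNReal.toReal_natCast, density, mul_assoc]
  rfl

/-- `μ(X_n)`. -/
noncomputable def levelMass (n : ℕ) : ℝ := P.μ.real (P.cf.cyl n univ)

theorem levelMass_eq (n : ℕ) : P.levelMass n = P.density n * G.haar.real (F P.r (n + 1)) := by
  rw [levelMass, ← CFSeq.cyl_inter_F n univ, univ_inter]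
  exact P.μ_real_cyl n (measurableSet_box _) Subset.rfl

theorem tendsto_levelMass : Tendsto P.levelMass atTop (𝓝 1) := by
  have h := tendsto_measure_iUnion_atTop (μ := P.μ) (CFSeq.monotone_cyl_univ (Q := P.cf))
  rw [CFSeq.iUnion_cyl_univ, measure_univ] at h
  have := (ENNReal.tendsto_toReal ENNReal.one_ne_top).comp h
  rwa [ENNReal.toReal_one] at this

theorem μ_real_cyl_eq (n : ℕ) {A : Set G} (hA : MeasurableSet A) (hAF : A ⊆ F P.r (n + 1)) :
    P.μ.real (P.cf.cyl n A) =
      P.levelMass n * (G.haar.real A / G.haar.real (F P.r (n + 1))) := by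
  have := P.haar_real_F_pos n
  rw [P.μ_real_cyl n hA hAF, levelMass_eq]
  field_simp

end Params

/-! ### The shift by `φ_n(1, 0)` on cylinder sets -/

/-- Elements of `ℤ` are central, so the shift by `φ_n(1, 0)` just permutes the windows. -/
theorem phi_mul_mul_phi (r : ℕ → ℕ) (n : ℕ) (x : G) (h : ℤ × ℤ) :
    phi r n (1, 0) * (x * phi r n h) = x * phi r n (h + (1, 0)) := by
  ext
  · simp only [phi, G.mul_z, Prod.fst_add]
    ring
  · simp [phi, sgn]
  · simp [phi]

namespace Params

variable (P : Params)

/-- The element `c_h = s_n(h) φ_n(h)` of `C_{n+1}`. -/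
noncomputable def shiftElt (n : ℕ) (h : ℤ × ℤ) : G := P.s n h * phi P.r n h

theorem coe_Cnext (n : ℕ) : (Cnext P.r P.s n : Set G) = ⋃ h ∈ H P.r n, {P.shiftElt n h} := by
  classical
  ext x
  simp [Cnext, shiftElt, eq_comm]

theorem mul_Cnext (n : ℕ) (A : Set G) :
    A * (Cnext P.r P.s n : Set G) = ⋃ h ∈ H P.r n, A * {P.shiftElt n h} := by
  rw [coe_Cnext, Set.mul_iUnion₂]

theorem mul_shiftElt_mem {n : ℕ} {x : G} (hx : x ∈ F P.r (n + 1)) {h : ℤ × ℤ}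
    (hh : h ∈ H P.r (n + 1)) : x * P.shiftElt (n + 1) h ∈ F P.r (n + 2) := by
  have := window_subset P.r (n + 1) (P.mul_s_mem (k := 0) (by omega) hx hh) hh
  rwa [mul_assoc] at this

theorem disjoint_mul_shiftElt {n : ℕ} {A B : Set G} (hA : A ⊆ F P.r (n + 1))
    (hB : B ⊆ F P.r (n + 1)) {h h' : ℤ × ℤ} (hh : h ∈ H P.r (n + 1)) (hh' : h' ∈ H P.r (n + 1))
    (hne : h ≠ h') :
    Disjoint (A * {P.shiftElt (n + 1) h}) (B * {P.shiftElt (n + 1) h'}) := by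
  refine Set.disjoint_left.2 ?_
  rintro _ ⟨x, hx, _, rfl, rfl⟩ ⟨y, hy, _, rfl, heq⟩
  exact hne (P.unique_index (hB hy) (hA hx) hh' hh heq).symm

/-- After the shift the copy `A c_h` lies in the window with index `h + (1, 0)`, in which the only
copy of `B` is the one translated by `c_{h + (1, 0)}`. -/
theorem shift_inter_mul_Cnext {n : ℕ} {A B : Set G} (hA : A ⊆ F P.r (n + 1))
    (hB : B ⊆ F P.r (n + 1)) {h : ℤ × ℤ} (hh : h ∈ shiftH P.r (n + 1)) :
    {phi P.r (n + 1) (1, 0)} * (A * {P.shiftElt (n + 1) h}) ∩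
        (B * (Cnext P.r P.s (n + 1) : Set G)) =
      ((A * {P.s (n + 1) h}) ∩ (B * {P.s (n + 1) (h + (1, 0))})) *
        {phi P.r (n + 1) (h + (1, 0))} := by
  obtain ⟨hh0, hh1⟩ := Finset.mem_filter.1 hh
  ext z
  constructor
  · rintro ⟨⟨_, rfl, _, ⟨x, hx, _, rfl, rfl⟩, rfl⟩, hz⟩
    rw [mul_Cnext] at hz
    obtain ⟨h', hh', y, hy, _, rfl, hyz⟩ := mem_iUnion₂.1 hz
    simp only [shiftElt, ← mul_assoc x, phi_mul_mul_phi] at hyz ⊢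
    rw [← mul_assoc y] at hyz
    have hw := P.mul_s_mem (k := 0) (by omega) (hA hx) hh0
    have hw' := P.mul_s_mem (k := 0) (by omega) (hB hy) hh'
    have := window_unique P.r (n + 1) hw' hw hyz
    subst this
    exact ⟨_, ⟨⟨x, hx, _, rfl, rfl⟩, y, hy, _, rfl, mul_right_cancel hyz⟩, _, rfl, rfl⟩
  · rintro ⟨_, ⟨⟨x, hx, _, rfl, rfl⟩, y, hy, _, rfl, hxy⟩, _, rfl, rfl⟩
    have hxy' : y * P.s (n + 1) (h + (1, 0)) = x * P.s (n + 1) h := hxy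
    refine ⟨⟨_, rfl, _, ⟨x, hx, _, rfl, rfl⟩, ?_⟩, ?_⟩
    · simp only [shiftElt, ← mul_assoc x, phi_mul_mul_phi]
    · rw [mul_Cnext]
      refine mem_iUnion₂.2 ⟨_, hh1, y, hy, _, rfl, ?_⟩
      simp only [shiftElt, ← mul_assoc y, hxy']

theorem overlap_nonneg (n : ℕ) (A B : Set G) (x y : G) : 0 ≤ overlap P.r n A B x y := by
  unfold overlap
  positivity

/-- The shift by `φ_n(1, 0)` moves each window to its right neighbour, except for the last column of
windows, which accounts for the error. -/
theorem abs_μ_real_shift_sub_le (n : ℕ) {A B : Set G} (hAm : MeasurableSet A)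
    (hBm : MeasurableSet B) (hA : A ⊆ F P.r (n + 1)) (hB : B ⊆ F P.r (n + 1)) :
    |P.μ.real (P.T (phi P.r (n + 1) (1, 0)) '' P.cf.cyl n A ∩ P.cf.cyl n B) -
      P.levelMass n * ((∑ h ∈ shiftH P.r (n + 1), overlap P.r (n + 1) A B (P.s (n + 1) h)
        (P.s (n + 1) (h + (1, 0)))) / (H P.r (n + 1)).card)| ≤
      P.levelMass n * (1 / (2 * P.r (n + 1) + 1)) := by
  classical
  set g := phi P.r (n + 1) (1, 0) with hg
  set c := P.shiftElt (n + 1) with hc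
  have hTinj : Function.Injective (P.T g) := by
    refine Function.LeftInverse.injective (g := P.cf.act g⁻¹) fun x => ?_
    change P.cf.act g⁻¹ (P.cf.act g x) = x
    rw [← CFSeq.act_mul, inv_mul_cancel, CFSeq.act_one]
  have hAc : ∀ h ∈ H P.r (n + 1), A * {c h} ⊆ F P.r (n + 2) := by
    rintro h hh _ ⟨x, hx, _, rfl, rfl⟩
    exact P.mul_shiftElt_mem (hA hx) hh
  have hAcm : ∀ h, MeasurableSet (A * {c h}) := fun h => hAm.mul_singleton_right _
  have hcylA : P.cf.cyl n A = ⋃ h ∈ H P.r (n + 1), P.cf.cyl (n + 1) (A * {c h}) := by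
    rw [CFSeq.cyl_eq_succ]
    have hAF : A ∩ P.cf.F n = A := inter_eq_left.2 hA
    rw [hAF]
    change P.cf.cyl (n + 1) (A * (Cnext P.r P.s (n + 1) : Set G)) = _
    simp only [mul_Cnext, CFSeq.cyl_iUnion, hc]
  have hcylB : P.cf.cyl n B = P.cf.cyl (n + 1) (B * (Cnext P.r P.s (n + 1) : Set G)) := by
    rw [CFSeq.cyl_eq_succ]
    have hBF : B ∩ P.cf.F n = B := inter_eq_left.2 hB
    rw [hBF]
    rfl
  set U : ℤ × ℤ → Set P.X := fun h => P.T g '' P.cf.cyl (n + 1) (A * {c h}) with hU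
  have hUpre : ∀ h, U h = P.T g⁻¹ ⁻¹' P.cf.cyl (n + 1) (A * {c h}) := fun h =>
    CFSeq.act_image_eq_preimage g _
  have hcylBm : MeasurableSet (P.cf.cyl n B) := CFSeq.measurableSet_cyl n hBm
  have hUm : ∀ h, MeasurableSet (U h) := fun h => by
    rw [hUpre]
    exact (P.measurePreserving_T g⁻¹).measurable (CFSeq.measurableSet_cyl _ (hAcm h))
  have hUreal : ∀ h ∈ H P.r (n + 1), P.μ.real (U h) = P.density (n + 1) * G.haar.real A := by
    intro h hh
    rw [hUpre, measureReal_def, (P.measurePreserving_T g⁻¹).measure_preimage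
      (CFSeq.measurableSet_cyl _ (hAcm h)).nullMeasurableSet, ← measureReal_def,
      P.μ_real_cyl (n + 1) (hAcm h) (hAc h hh), measureReal_def, CFSeq.measure_mul_singleton,
      measureReal_def]
  have hUdisj : ∀ h ∈ H P.r (n + 1), ∀ h' ∈ H P.r (n + 1), h ≠ h' → Disjoint (U h) (U h') := by
    intro h hh h' hh' hne
    refine Set.disjoint_image_of_injective hTinj ?_
    refine Set.disjoint_iff_inter_eq_empty.2 ?_
    rw [CFSeq.cyl_inter, Set.disjoint_iff_inter_eq_empty.1
      (P.disjoint_mul_shiftElt hA hA hh hh' hne)]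
    simp [CFSeq.cyl]
  -- Split `[A]_n` into its copies in the windows and treat each window by itself.
  have hsplit : P.μ.real (P.T g '' P.cf.cyl n A ∩ P.cf.cyl n B) =
      ∑ h ∈ H P.r (n + 1), P.μ.real (U h ∩ P.cf.cyl n B) := by
    rw [hcylA, image_iUnion₂, iUnion₂_inter, measureReal_biUnion_finset]
    · intro h hh h' hh' hne
      exact (hUdisj h hh h' hh' hne).mono inter_subset_left inter_subset_left
    · exact fun h _ => (hUm h).inter hcylBm
  have hφ := P.haar_real_F_pos n
  have hcard : (((H P.r (n + 1)).card : ℕ) : ℝ) = (2 * P.r (n + 1) + 1) ^ 2 := by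
    rw [card_H]
    push_cast
    rfl
  have hR : (0 : ℝ) < 2 * P.r (n + 1) + 1 := by positivity
  have hdens : P.density (n + 1) * G.haar.real (F P.r (n + 1)) =
      P.levelMass n / (2 * P.r (n + 1) + 1) ^ 2 := by
    rw [levelMass_eq, ← P.density_succ n, hcard]
    field_simp
  -- A window outside the last column contributes an overlap.
  have hgood : ∀ h ∈ shiftH P.r (n + 1), P.μ.real (U h ∩ P.cf.cyl n B) =
      P.levelMass n / (2 * P.r (n + 1) + 1) ^ 2 *
        overlap P.r (n + 1) A B (P.s (n + 1) h) (P.s (n + 1) (h + (1, 0))) := by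
    intro h hh
    obtain ⟨hh0, hh1⟩ := Finset.mem_filter.1 hh
    have hgF : ∀ x ∈ A * {c h}, g * x ∈ P.cf.F (n + 1) := by
      rintro _ ⟨x, hx, _, rfl, rfl⟩
      have : g * (x * c h) = x * P.s (n + 1) h * phi P.r (n + 1) (h + (1, 0)) := by
        rw [hg, hc, shiftElt, ← mul_assoc x, phi_mul_mul_phi]
      change g * (x * c h) ∈ F P.r (n + 2)
      rw [this]
      exact window_subset P.r (n + 1) (P.mul_s_mem (k := 0) (by omega) (hA hx) hh0) hh1
    have hUh : U h = P.cf.cyl (n + 1) ({g} * (A * {c h})) :=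
      CFSeq.act_image_cyl (hAc h hh0) hgF
    have hm : MeasurableSet ({g} * (A * {c h}) ∩ (B * (Cnext P.r P.s (n + 1) : Set G))) := by
      rw [P.shift_inter_mul_Cnext hA hB hh]
      exact ((hAm.mul_singleton_right _).inter (hBm.mul_singleton_right _)).mul_singleton_right _
    have hsub : {g} * (A * {c h}) ∩ (B * (Cnext P.r P.s (n + 1) : Set G)) ⊆ F P.r (n + 2) := by
      refine inter_subset_left.trans ?_
      rintro _ ⟨_, rfl, x, hx, rfl⟩
      exact hgF x hx
    rw [hUh, hcylB, CFSeq.cyl_inter, P.μ_real_cyl (n + 1) hm hsub,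
      P.shift_inter_mul_Cnext hA hB hh, measureReal_def, CFSeq.measure_mul_singleton, overlap,
      ← hdens]
    have : (G.haar (F P.r (n + 1))).toReal ≠ 0 := hφ.ne'
    rw [measureReal_def]
    field_simp
  -- A window of the last column is estimated by its measure.
  have hbad : ∀ h ∈ (H P.r (n + 1)) \ shiftH P.r (n + 1), P.μ.real (U h ∩ P.cf.cyl n B) ≤
      P.levelMass n / (2 * P.r (n + 1) + 1) ^ 2 := by
    intro h hh
    refine (measureReal_mono inter_subset_left).trans ?_
    rw [hUreal h (Finset.mem_sdiff.1 hh).1, ← hdens]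
    exact mul_le_mul_of_nonneg_left (measureReal_mono hA (P.haar_F_ne_top _)) (P.density_nonneg _)
  have hsubH : shiftH P.r (n + 1) ⊆ H P.r (n + 1) := Finset.filter_subset _ _
  have hbadcard : (((H P.r (n + 1)) \ shiftH P.r (n + 1)).card : ℝ) = 2 * P.r (n + 1) + 1 := by
    rw [Finset.cast_card_sdiff hsubH, hcard, card_shiftH]
    ring
  rw [hsplit, ← Finset.sum_sdiff hsubH, Finset.sum_congr rfl hgood, ← Finset.mul_sum, hcard]
  have heq : ∀ u v : ℝ, u + P.levelMass n / (2 * P.r (n + 1) + 1) ^ 2 * v -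
      P.levelMass n * (v / (2 * P.r (n + 1) + 1) ^ 2) = u := fun u v => by ring
  rw [heq, abs_of_nonneg (Finset.sum_nonneg fun _ _ => measureReal_nonneg)]
  refine (Finset.sum_le_card_nsmul _ _ _ hbad).trans (le_of_eq ?_)
  rw [nsmul_eq_mul, hbadcard]
  field_simp

end Params

/-! ### The approximation error -/

theorem tendsto_const_add_atTop (m : ℕ) : Tendsto (fun j : ℕ => m + j) atTop atTop :=
  tendsto_atTop_mono (fun j => Nat.le_add_left j m) tendsto_id

namespace Params

variable (P : Params)

theorem haar_ne_top_of_subset_F {n : ℕ} {A : Set G} (hA : A ⊆ F P.r n) : G.haar A ≠ ∞ :=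
  ((measure_mono hA).trans_lt (P.haar_F_ne_top n).lt_top).ne

/-- The relative measure of `A` in `F_n`. -/
noncomputable def relMeas (n : ℕ) (A : Set G) : ℝ := G.haar.real A / G.haar.real (F P.r n)

/-- The relative measure which is lost when `A` is replaced by the union of the atoms of `ξ_n`
inside `A ∩ I_n`. -/
noncomputable def approxErr (n : ℕ) (A : Set G) : ℝ := P.relMeas n (A \ P.atomApprox n A)

theorem relMeas_nonneg (n : ℕ) (A : Set G) : 0 ≤ P.relMeas n A := by
  unfold relMeas
  positivity

theorem relMeas_le_one {n : ℕ} {A : Set G} (hA : A ⊆ F P.r n) : P.relMeas n A ≤ 1 :=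
  div_le_one_of_le₀ (measureReal_mono hA (P.haar_F_ne_top n)) measureReal_nonneg

theorem atomApprox_subset_left (n : ℕ) (A : Set G) : P.atomApprox n A ⊆ A :=
  (P.atomApprox_subset n A).trans inter_subset_left

theorem relMeas_atomApprox {n : ℕ} (hn : 1 ≤ n) {A : Set G} (hA : A ⊆ F P.r n) :
    P.relMeas n (P.atomApprox n A) = P.relMeas n A - P.approxErr n A := by
  rw [approxErr, relMeas, relMeas, relMeas, measureReal_sdiff (P.atomApprox_subset_left n A)
    (P.measurableSet_atomApprox hn A) (P.haar_ne_top_of_subset_F hA)]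
  ring

/-- The three terms come from the collar `F_n \ I_n`, from the boundary of `I_n` and from the
boundary of `A`. -/
theorem approxErr_le (n : ℕ) {A : Set G} (hA : A ⊆ F P.r (n + 1)) :
    P.approxErr (n + 1) A ≤ 2 * ((b P.r (n + 1) : ℝ) / a P.r (n + 1)) + 1 / ((n : ℝ) + 1) +
      P.relMeas (n + 1) (bdry (1 / ((n : ℝ) + 1)) A) := by
  have ha := P.a_cast_pos n
  have ha1 : (1 : ℝ) ≤ a P.r (n + 1) := by exact_mod_cast P.a_pos n
  have hF := P.haar_real_F (n + 1)
  have hcast : (((n + 1 : ℕ) : ℝ)) = (n : ℝ) + 1 := by push_cast; rfl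
  have hsub := P.sdiff_atomApprox_subset (n := n + 1) (by omega) hA
  rw [hcast] at hsub
  have hI := P.inner_subset_F (n + 1)
  have hfin : ∀ {E : Set G}, E ⊆ F P.r (n + 1) → G.haar E ≠ ∞ := fun h =>
    P.haar_ne_top_of_subset_F h
  have hbA : bdry (1 / ((n : ℝ) + 1)) A ⊆ F P.r (n + 1) := fun x hx => hA hx.1
  have hbI : bdry (1 / ((n : ℝ) + 1)) (P.inner (n + 1)) ⊆ F P.r (n + 1) := fun x hx => hI hx.1
  have h1 : G.haar.real (F P.r (n + 1) \ P.inner (n + 1)) ≤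
      16 * a P.r (n + 1) * b P.r (n + 1) := by
    rw [measureReal_sdiff hI (measurableSet_box _) (hfin Subset.rfl), hF, inner, G.haar_real_box]
    have hb0 : (0 : ℝ) ≤ b P.r (n + 1) := by positivity
    rcases le_total (b P.r (n + 1)) (a P.r (n + 1)) with h | h
    · rw [Nat.cast_sub h]
      nlinarith [sq_nonneg (b P.r (n + 1) : ℝ)]
    · have h' : (a P.r (n + 1) : ℝ) ≤ b P.r (n + 1) := by exact_mod_cast h
      rw [Nat.sub_eq_zero_of_le h]
      push_cast
      nlinarith [mul_le_mul_of_nonneg_left h' ha.le]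
  have h2 : G.haar.real (bdry (1 / ((n : ℝ) + 1)) (P.inner (n + 1))) ≤
      8 * (a P.r (n + 1) : ℝ) ^ 2 * (1 / ((n : ℝ) + 1)) := by
    have hle := haar_bdry_box_le (δ := 1 / ((n : ℝ) + 1)) (by positivity)
      (a P.r (n + 1) - b P.r (n + 1))
    have := ENNReal.toReal_mono ENNReal.ofReal_ne_top hle
    rw [ENNReal.toReal_ofReal (by positivity)] at this
    refine this.trans ?_
    gcongr
    have : ((a P.r (n + 1) - b P.r (n + 1) : ℕ) : ℝ) ≤ a P.r (n + 1) := by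
      exact_mod_cast Nat.sub_le _ _
    nlinarith
  have hmain : G.haar.real (A \ P.atomApprox (n + 1) A) ≤
      16 * a P.r (n + 1) * b P.r (n + 1) + (G.haar.real (bdry (1 / ((n : ℝ) + 1)) A) +
        8 * (a P.r (n + 1) : ℝ) ^ 2 * (1 / ((n : ℝ) + 1))) := by
    refine (measureReal_mono hsub (hfin (union_subset sdiff_subset
      (union_subset hbA hbI)))).trans ?_
    exact (measureReal_union_le _ _).trans (add_le_add h1 ((measureReal_union_le _ _).trans
      (add_le_add le_rfl h2)))
  rw [approxErr, relMeas, relMeas, hF, div_le_iff₀ (by positivity)]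
  refine hmain.trans (le_of_eq ?_)
  field_simp
  ring

theorem approxErr_nonneg (n : ℕ) (A : Set G) : 0 ≤ P.approxErr n A := P.relMeas_nonneg _ _

/-- The relative measure of a boundary layer does not increase from one level to the next, as the
boundary of `A C` is contained in the union of the translates of the boundary of `A`. -/
theorem density_mul_bdry_lift_le (m j : ℕ) (A : Set G) (δ : ℝ) :
    P.density (m + j) * G.haar.real (bdry δ (P.cf.lift m A j)) ≤
      P.density m * G.haar.real (bdry δ (A ∩ F P.r (m + 1))) := by
  induction j with
  | zero => exact le_rfl
  | succ j ih =>
    refine le_trans ?_ ih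
    have hfin : G.haar (bdry δ (P.cf.lift m A j)) ≠ ∞ :=
      P.haar_ne_top_of_subset_F (n := m + j + 1) fun x hx => CFSeq.lift_subset m A j hx.1
    have h := ENNReal.toReal_mono (ENNReal.mul_ne_top (by simp) hfin)
      (haar_bdry_mul_finset_le δ (P.cf.lift m A j) (P.cf.C (m + j)))
    rw [ENNReal.toReal_mul, ENNReal.toReal_natCast] at h
    have hc : (P.cf.C (m + j)).card = (H P.r (m + j + 1)).card := P.card_Cnext (m + j)
    rw [hc] at h
    have hd := P.density_succ (m + j)
    rw [← hd, mul_assoc]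
    exact mul_le_mul_of_nonneg_left h (P.density_nonneg _)

theorem tendsto_relMeas_bdry_lift (m : ℕ) {A : Set G} (hA : A ∈ thinBdry) :
    Tendsto (fun j => P.relMeas (m + j + 1) (bdry (1 / (((m + j : ℕ) : ℝ) + 1))
      (P.cf.lift m A j))) atTop (𝓝 0) := by
  have hAF := inter_mem_thinBdry hA (box_mem_thinBdry (a P.r (m + 1)))
  have hshift := tendsto_const_add_atTop m
  have h1 := (ENNReal.tendsto_toReal ENNReal.zero_ne_top).comp (hAF.2.comp hshift)
  rw [ENNReal.toReal_zero] at h1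
  have h2 := (h1.const_mul (P.density m)).div (P.tendsto_levelMass.comp hshift) one_ne_zero
  rw [mul_zero, zero_div] at h2
  have hpos : ∀ᶠ j in atTop, 0 < P.levelMass (m + j) :=
    (P.tendsto_levelMass.comp hshift).eventually (lt_mem_nhds one_pos)
  refine tendsto_of_tendsto_of_tendsto_of_le_of_le' tendsto_const_nhds h2
    (Eventually.of_forall fun j => P.relMeas_nonneg _ _) ?_
  filter_upwards [hpos] with j hj
  simp only [Pi.div_apply, Function.comp_apply]
  have hle := P.density_mul_bdry_lift_le m j A (1 / (((m + j : ℕ) : ℝ) + 1))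
  have hF := P.haar_real_F_pos (m + j)
  rw [levelMass_eq] at hj ⊢
  rw [relMeas, div_le_div_iff₀ hF hj]
  have := mul_le_mul_of_nonneg_right hle hF.le
  refine le_trans (le_of_eq ?_) this
  ring

theorem tendsto_approxErr_of_bdry {f : ℕ → ℕ} (hf : Tendsto f atTop atTop) {A : ℕ → Set G}
    (hA : ∀ j, A j ⊆ F P.r (f j + 1))
    (h : Tendsto (fun j => P.relMeas (f j + 1) (bdry (1 / ((f j : ℝ) + 1)) (A j))) atTop (𝓝 0)) :
    Tendsto (fun j => P.approxErr (f j + 1) (A j)) atTop (𝓝 0) := by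
  have h1 := ((P.tendsto_b_div_a.const_mul 2).add
    (tendsto_one_div_add_atTop_nhds_zero_nat (𝕜 := ℝ))).comp hf
  have h2 := h1.add h
  simp only [mul_zero, add_zero] at h2
  exact tendsto_of_tendsto_of_tendsto_of_le_of_le tendsto_const_nhds h2
    (fun j => P.approxErr_nonneg _ _) fun j => P.approxErr_le (f j) (hA j)

theorem tendsto_approxErr_lift (m : ℕ) {A : Set G} (hA : A ∈ thinBdry) :
    Tendsto (fun j => P.approxErr (m + j + 1) (P.cf.lift m A j)) atTop (𝓝 0) :=
  P.tendsto_approxErr_of_bdry (tendsto_const_add_atTop m)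
    (fun j => CFSeq.lift_subset m A j) (P.tendsto_relMeas_bdry_lift m hA)

/-! ### Overlaps of sets and of their approximations -/

theorem atomApprox_mul_subset {n : ℕ} (A : Set G) : ∀ x ∈ S P.r n,
    P.atomApprox n A * {x} ⊆ F P.r n := fun _ hx =>
  (Set.mul_subset_mul ((P.atomApprox_subset n A).trans inter_subset_right)
    (singleton_subset_iff.2 hx)).trans (P.inner_mul_S_subset n)

/-- The defining property of `D_n`, for unions of atoms in `I_n`. -/
theorem abs_avgD_sub_avgS_atomApprox_lt (n : ℕ) (A B : Set G) :
    |avgD (P.D (n + 1)) (overlap P.r (n + 1) (P.atomApprox (n + 1) A) (P.atomApprox (n + 1) B)) -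
      avgS P.r (n + 1) (overlap P.r (n + 1) (P.atomApprox (n + 1) A) (P.atomApprox (n + 1) B))| <
      1 / ((n : ℝ) + 1) := by
  have h1F : (1 : G) ∈ F P.r (n + 1) := one_mem_box (P.a_pos n)
  have hone : ∀ E : Set G, E * {(1 : G)} = E := fun E => by
    rw [Set.singleton_one, mul_one]
  have hsub : ∀ E : Set G, P.atomApprox (n + 1) E * {1} * S P.r (n + 1) ⊆ F P.r (n + 1) := by
    intro E
    rw [hone]
    exact (Set.mul_subset_mul_right ((P.atomApprox_subset _ E).trans inter_subset_right)).trans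
      (P.inner_mul_S_subset _)
  have h := P.D_approx (n + 1) (by omega) _ _ (P.partMeas_atomApprox (n + 1) A)
    (P.partMeas_atomApprox (n + 1) B) 1 h1F 1 h1F (hsub A) (hsub B)
  simp only [hone] at h
  push_cast at h
  exact h

theorem overlap_mono {n : ℕ} {A A' B B' : Set G} (hA : A ⊆ F P.r n) (hA' : A' ⊆ A) (hB' : B' ⊆ B)
    (x y : G) : overlap P.r n A' B' x y ≤ overlap P.r n A B x y := by
  refine div_le_div_of_nonneg_right (ENNReal.toReal_mono ?_ (measure_mono (inter_subset_inter
    (Set.mul_subset_mul_right hA') (Set.mul_subset_mul_right hB')))) ENNReal.toReal_nonneg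
  refine ((measure_mono inter_subset_left).trans_lt ?_).ne
  rw [CFSeq.measure_mul_singleton]
  exact (P.haar_ne_top_of_subset_F hA).lt_top

theorem overlap_le_relMeas {n : ℕ} {A : Set G} (hA : A ⊆ F P.r n) (B : Set G) (x y : G) :
    overlap P.r n A B x y ≤ P.relMeas n A := by
  refine div_le_div_of_nonneg_right (ENNReal.toReal_mono (P.haar_ne_top_of_subset_F hA) ?_)
    ENNReal.toReal_nonneg
  refine (measure_mono inter_subset_left).trans ?_
  rw [CFSeq.measure_mul_singleton]

theorem overlap_le_add_approxErr {n : ℕ} {A B : Set G} (hA : A ⊆ F P.r n) (hB : B ⊆ F P.r n)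
    (x y : G) : overlap P.r n A B x y ≤
      overlap P.r n (P.atomApprox n A) (P.atomApprox n B) x y +
        (P.approxErr n A + P.approxErr n B) := by
  set A' := P.atomApprox n A
  set B' := P.atomApprox n B
  have hsub : A * {x} ∩ (B * {y}) ⊆
      A' * {x} ∩ (B' * {y}) ∪ ((A \ A') * {x} ∪ (B \ B') * {y}) := by
    intro z hz
    simp only [mem_union, mem_inter_iff, mem_mul_singleton_iff, Set.mem_sdiff] at hz ⊢
    tauto
  have hmul : ∀ (E : Set G) x, G.haar.real (E * {x}) = G.haar.real E := fun E x => by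
    rw [measureReal_def, CFSeq.measure_mul_singleton, measureReal_def]
  have hfin : ∀ {E : Set G} {x}, E ⊆ F P.r n → G.haar (E * {x}) ≠ ∞ := fun h => by
    rw [CFSeq.measure_mul_singleton]
    exact P.haar_ne_top_of_subset_F h
  have hle : G.haar.real (A * {x} ∩ (B * {y})) ≤ G.haar.real (A' * {x} ∩ (B' * {y})) +
      (G.haar.real (A \ A') + G.haar.real (B \ B')) := by
    refine (measureReal_mono hsub ?_).trans ((measureReal_union_le _ _).trans
      (add_le_add le_rfl ((measureReal_union_le _ _).trans ?_)))
    · refine measure_union_ne_top ?_ (measure_union_ne_top (hfin (sdiff_subset.trans hA))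
        (hfin (sdiff_subset.trans hB)))
      exact ((measure_mono inter_subset_left).trans_lt
        (hfin ((P.atomApprox_subset_left n A).trans hA)).lt_top).ne
    · rw [hmul, hmul]
  change G.haar.real (A * {x} ∩ (B * {y})) / G.haar.real (F P.r n) ≤
    G.haar.real (A' * {x} ∩ (B' * {y})) / G.haar.real (F P.r n) +
      (G.haar.real (A \ A') / G.haar.real (F P.r n) + G.haar.real (B \ B') / G.haar.real (F P.r n))
  rw [← add_div, ← add_div]
  exact div_le_div_of_nonneg_right hle measureReal_nonneg

end Params

/-! ### Balance between the two cosets of `ℤ × ℝ` -/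

theorem haar_real_sheet_box (ε : ZMod 2) (N : ℕ) :
    G.haar.real (sheet ε (box N)) = 4 * (N : ℝ) ^ 2 := by
  have h : sheet ε (box N) = {g : G | g.z ∈ Finset.Ioc (-(N : ℤ)) N ∧
      g.e ∈ ({ε} : Finset (ZMod 2)) ∧ g.t ∈ Ioc (-(N : ℝ)) N} := by
    ext g
    simp [sheet, box]
    tauto
  have hz : ((N : ℤ) - -(N : ℤ)).toNat = 2 * N := by omega
  rw [measureReal_def, h, G.haar_slab _ _ measurableSet_Ioc, Real.volume_Ioc, Int.card_Ioc, hz,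
    ENNReal.toReal_mul, ENNReal.toReal_ofReal (by linarith [(Nat.cast_nonneg N : (0 : ℝ) ≤ N)])]
  simp
  ring

theorem haar_real_sheet_add {A : Set G} (hA : MeasurableSet A) (hfin : G.haar A ≠ ∞) :
    G.haar.real (sheet 0 A) + G.haar.real (sheet 1 A) = G.haar.real A := by
  have h1 : sheet 1 A = A \ sheet 0 A := by
    ext x
    have := sgn_cases x.e
    simp only [sheet, mem_inter_iff, mem_ofPred_eq, Set.mem_sdiff]
    have h01 : (0 : ZMod 2) ≠ 1 := by decide
    rcases this with ⟨h, -⟩ | ⟨h, -⟩ <;> simp [h]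
  rw [h1, measureReal_sdiff (show sheet 0 A ⊆ A from inter_subset_left)
    (measurableSet_sheet 0 hA) hfin]
  ring

theorem bdry_sheet_subset (δ : ℝ) (ε : ZMod 2) (A : Set G) : bdry δ (sheet ε A) ⊆ bdry δ A := by
  rintro x ⟨⟨hA, he⟩, y, hy, h⟩
  exact ⟨hA, y, fun hyA => hy ⟨hyA, h.2.1.trans he⟩, h⟩

/-- The indicator function of `{x | x.e = ε}`. -/
noncomputable def ind (ε : ZMod 2) (x : G) : ℝ := if x.e = ε then 1 else 0

theorem ind_nonneg (ε : ZMod 2) (x : G) : 0 ≤ ind ε x := by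
  unfold ind
  split_ifs <;> norm_num

theorem ind_le_one (ε : ZMod 2) (x : G) : ind ε x ≤ 1 := by
  unfold ind
  split_ifs <;> norm_num

theorem ind_add (x : G) : ind 0 x + ind 1 x = 1 := by
  rcases sgn_cases x.e with ⟨h, _⟩ | ⟨h, _⟩ <;> simp [ind, h]

theorem avgD_mul (D : Finset G) (u w : G → ℝ) : avgD D (fun x y => u x * w y) =
    ((∑ x ∈ D, u x) / D.card) * ((∑ x ∈ D, w x) / D.card) := by
  rw [avgD, ← Finset.sum_mul_sum]
  ring

namespace Params

variable (P : Params)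

/-- The proportion of the elements of `D_n` in the coset of `ℤ × ℝ` given by `ε`. -/
noncomputable def fracD (n : ℕ) (ε : ZMod 2) : ℝ := (∑ x ∈ P.D n, ind ε x) / (P.D n).card

theorem fracD_add {n : ℕ} (hn : 1 ≤ n) : P.fracD n 0 + P.fracD n 1 = 1 := by
  have : ((P.D n).card : ℝ) ≠ 0 := by exact_mod_cast (P.D_nonempty hn).card_pos.ne'
  rw [fracD, fracD, ← add_div, ← Finset.sum_add_distrib]
  simp only [ind_add, Finset.sum_const, nsmul_eq_mul, mul_one]
  exact div_self this

theorem avgD_ind {n : ℕ} (hn : 1 ≤ n) (ε : ZMod 2) :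
    avgD (P.D n) (fun x _ => ind ε x) = P.fracD n ε := by
  have h := avgD_mul (P.D n) (ind ε) fun _ => 1
  have hc : ((P.D n).card : ℝ) ≠ 0 := by exact_mod_cast (P.D_nonempty hn).card_pos.ne'
  simp only [mul_one, Finset.sum_const, nsmul_eq_mul, div_self hc] at h
  exact h

/-- The error in the balance of `D_n` between the two cosets of `ℤ × ℝ`: a bound for `1/4 - p q`,
where `p` and `q` are the proportions of `D_n` in the two cosets. -/
noncomputable def balanceErr (n : ℕ) : ℝ :=
  P.approxErr n (sheet 0 (F P.r n)) + P.approxErr n (sheet 1 (F P.r n)) + 1 / n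

theorem relMeas_sheet_F (n : ℕ) (ε : ZMod 2) :
    P.relMeas (n + 1) (sheet ε (F P.r (n + 1))) = 1 / 2 := by
  have ha := P.a_cast_pos n
  rw [relMeas, haar_real_F, F, haar_real_sheet_box]
  field_simp
  norm_num

/-- The overlap of the two cosets, translated by `x` and by `y`, is `0` if `x` and `y` lie in the
same coset and is about `1/2` otherwise. Its average over `D_n × D_n` is thus the product of the
proportions of `D_n` in the two cosets, whereas its average over `S_n × S_n` is about `1/4`. -/
theorem fracD_mul_ge (n : ℕ) :
    1 / 4 - P.balanceErr (n + 1) ≤ P.fracD (n + 1) 0 * P.fracD (n + 1) 1 := by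
  set E : ZMod 2 → Set G := fun ε => sheet ε (F P.r (n + 1)) with hE
  set E' : ZMod 2 → Set G := fun ε => P.atomApprox (n + 1) (E ε) with hE'
  have hEF : ∀ ε, E ε ⊆ F P.r (n + 1) := fun ε => inter_subset_left
  have hE'E : ∀ ε, E' ε ⊆ E ε := fun ε => P.atomApprox_subset_left _ _
  have hE'm : ∀ ε, MeasurableSet (E' ε) := fun ε => P.measurableSet_atomApprox (by omega) _
  have hhalf : ∀ ε, P.relMeas (n + 1) (E ε) = 1 / 2 := P.relMeas_sheet_F n
  -- The average over `D × D`.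
  have hD : avgD (P.D (n + 1)) (overlap P.r (n + 1) (E' 0) (E' 1)) ≤
      P.fracD (n + 1) 0 * P.fracD (n + 1) 1 := by
    have hle : avgD (P.D (n + 1)) (overlap P.r (n + 1) (E' 0) (E' 1)) ≤
        avgD (P.D (n + 1)) (fun x y => 1 / 2 * (ind 0 x * ind 1 y + ind 1 x * ind 0 y)) := by
      refine avgD_mono fun x _ y _ => ?_
      have hup := (P.overlap_mono (hEF 0) (hE'E 0) (hE'E 1) x y).trans
        (P.overlap_le_relMeas (hEF 0) (E 1) x y)
      rw [hhalf] at hup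
      have hsame : x.e = y.e → overlap P.r (n + 1) (E' 0) (E' 1) x y = 0 := by
        intro hxy
        have hempty : E' 0 * {x} ∩ (E' 1 * {y}) = ∅ := by
          refine eq_empty_of_forall_notMem ?_
          rintro _ ⟨⟨u, hu, _, rfl, rfl⟩, w, hw, _, rfl, hwu⟩
          have h0 : u.e = 0 := (hE'E 0 hu).2
          have h1 : w.e = 1 := (hE'E 1 hw).2
          have he := congrArg G.e hwu
          simp only [G.mul_e, h0, h1, hxy] at he
          have := add_right_cancel he
          exact absurd this (by decide)
        rw [overlap, hempty, measure_empty, ENNReal.toReal_zero, zero_div]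
      rcases sgn_cases x.e with ⟨hx, _⟩ | ⟨hx, _⟩ <;> rcases sgn_cases y.e with ⟨hy, _⟩ | ⟨hy, _⟩
      · rw [hsame (hx.trans hy.symm)]
        simp [ind, hx, hy]
      · simpa [ind, hx, hy] using hup
      · simpa [ind, hx, hy] using hup
      · rw [hsame (hx.trans hy.symm)]
        simp [ind, hx, hy]
    refine hle.trans (le_of_eq ?_)
    have h1 := avgD_mul (P.D (n + 1)) (ind 0) (ind 1)
    have h2 := avgD_mul (P.D (n + 1)) (ind 1) (ind 0)
    have h3 : avgD (P.D (n + 1)) (fun x y => 1 / 2 * (ind 0 x * ind 1 y + ind 1 x * ind 0 y)) =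
        1 / 2 * (avgD (P.D (n + 1)) (fun x y => ind 0 x * ind 1 y) +
          avgD (P.D (n + 1)) (fun x y => ind 1 x * ind 0 y)) := by
      simp only [avgD, ← Finset.mul_sum, Finset.sum_add_distrib]
      ring
    rw [h3, h1, h2, fracD, fracD]
    ring
  -- The average over `S × S`, by the general lower bound with the constant `1 / 2`.
  have hSpos : 0 < G.haar.real (S P.r (n + 1)) := by
    rw [S, G.haar_real_box, b_cast_succ]
    have := P.ta_cast_pos n
    positivity
  have hK : ∀ z, G.haar.real ({y | z * y⁻¹ ∈ E' 1} ∩ S P.r (n + 1)) ≤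
      1 / 2 * G.haar.real (S P.r (n + 1)) := by
    intro z
    have hsub : {y | z * y⁻¹ ∈ E' 1} ∩ S P.r (n + 1) ⊆ sheet (z.e - 1) (S P.r (n + 1)) := by
      rintro y ⟨hy, hyS⟩
      refine ⟨hyS, ?_⟩
      have h1 : (z * y⁻¹).e = 1 := (hE'E 1 hy).2
      have h2 : z.e = 1 + y.e := by
        rw [← h1, ← G.mul_e, inv_mul_cancel_right]
      rw [mem_ofPred_eq, h2, add_sub_cancel_left]
    refine (measureReal_mono hsub ((measure_mono inter_subset_left).trans_lt
      (G.haar_box_ne_top _).lt_top).ne).trans (le_of_eq ?_)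
    rw [S, haar_real_sheet_box, G.haar_real_box]
    ring
  have hS := (avgS_overlap_mem_Icc (hE'm 0) (hE'm 1) (P.atomApprox_mul_subset _)
    (P.atomApprox_mul_subset _) hSpos (by norm_num) hK).1
  have h0 := P.relMeas_atomApprox (n := n + 1) (by omega) (hEF 0)
  have h1 := P.relMeas_atomApprox (n := n + 1) (by omega) (hEF 1)
  rw [hhalf] at h0 h1
  have hF := P.haar_real_F_pos n
  have hS' : (G.haar.real (E' 1) - 1 / 2 * (G.haar.real (F P.r (n + 1)) - G.haar.real (E' 0))) /
      G.haar.real (F P.r (n + 1)) =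
      P.relMeas (n + 1) (E' 1) - 1 / 2 * (1 - P.relMeas (n + 1) (E' 0)) := by
    rw [relMeas, relMeas]
    field_simp
  rw [hS'] at hS
  have hcmp := abs_lt.1 (P.abs_avgD_sub_avgS_atomApprox_lt n (E 0) (E 1))
  have he0 := P.approxErr_nonneg (n + 1) (E 0)
  have hdef : P.balanceErr (n + 1) = P.approxErr (n + 1) (E 0) + P.approxErr (n + 1) (E 1) +
      1 / ((n : ℝ) + 1) := by
    simp only [balanceErr, hE]
    push_cast
    rfl
  rw [hdef]
  have h0' : P.relMeas (n + 1) (E' 0) = 1 / 2 - P.approxErr (n + 1) (E 0) := h0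
  have h1' : P.relMeas (n + 1) (E' 1) = 1 / 2 - P.approxErr (n + 1) (E 1) := h1
  rw [h0', h1'] at hS
  linarith [hcmp.1, hcmp.2]

/-- If `p (1 - p) ≥ 1/4 - ε`, then `(p - 1/2)² ≤ ε`. -/
theorem fracD_le (n : ℕ) (ε : ZMod 2) :
    P.fracD (n + 1) ε ≤ 1 / 2 + Real.sqrt (P.balanceErr (n + 1)) := by
  have h := P.fracD_mul_ge n
  have hadd := P.fracD_add (n := n + 1) (by omega)
  have hsq : (P.fracD (n + 1) ε - 1 / 2) ^ 2 ≤ P.balanceErr (n + 1) := by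
    rcases sgn_cases ε with ⟨rfl, _⟩ | ⟨rfl, _⟩
    · have : P.fracD (n + 1) 1 = 1 - P.fracD (n + 1) 0 := by linarith
      rw [this] at h
      nlinarith
    · have : P.fracD (n + 1) 0 = 1 - P.fracD (n + 1) 1 := by linarith
      rw [this] at h
      nlinarith
  have := le_of_abs_le (Real.abs_le_sqrt hsq)
  linarith

/-- A bound for the excess over `1/2` of the proportion of `h ∈ H_n` with `s_n(h)` in a given coset
of `ℤ × ℝ`. -/
noncomputable def imbalance (n : ℕ) : ℝ :=
  Real.sqrt (P.balanceErr n) + 1 / n + 2 * (1 / (2 * P.r n + 1))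

/-- The balance of `D_n` passes to the values of `s_n` by equidistribution; the last column of
`H_n`, which `shiftH` omits, is estimated trivially. -/
theorem sum_ind_le (n : ℕ) (ε : ZMod 2) :
    ∑ h ∈ H P.r (n + 1), ind ε (P.s (n + 1) h) ≤
      (1 / 2 + P.imbalance (n + 1)) * (H P.r (n + 1)).card := by
  have hrow := P.abs_sum_shiftH_sub_avgD_le (n := n + 1) (by omega) (f := fun x _ => ind ε x)
    (fun x _ => ind_nonneg ε x) fun x _ => ind_le_one ε x
  rw [avgD_ind P (by omega)] at hrow
  have hfrac := P.fracD_le n ε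
  have hsubH : shiftH P.r (n + 1) ⊆ H P.r (n + 1) := Finset.filter_subset _ _
  have hR : (0 : ℝ) < 2 * P.r (n + 1) + 1 := by positivity
  have hcard : (((H P.r (n + 1)).card : ℕ) : ℝ) = (2 * P.r (n + 1) + 1) ^ 2 := by
    rw [card_H]
    push_cast
    rfl
  have hbad : ∑ h ∈ H P.r (n + 1) \ shiftH P.r (n + 1), ind ε (P.s (n + 1) h) ≤
      2 * P.r (n + 1) + 1 := by
    refine (Finset.sum_le_card_nsmul _ _ 1 fun h _ => ind_le_one ε _).trans (le_of_eq ?_)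
    rw [nsmul_eq_mul, mul_one, Finset.cast_card_sdiff hsubH, hcard, card_shiftH]
    ring
  have hpos : (0 : ℝ) < (H P.r (n + 1)).card := by
    rw [hcard]
    positivity
  have hgood := (abs_le.1 hrow).2
  rw [sub_le_iff_le_add, div_le_iff₀ hpos] at hgood
  rw [← Finset.sum_sdiff hsubH]
  have hsplit : (2 * P.r (n + 1) + 1 : ℝ) =
      1 / (2 * P.r (n + 1) + 1) * (H P.r (n + 1)).card := by
    rw [hcard]
    field_simp
  have hle := mul_le_mul_of_nonneg_right hfrac hpos.le
  rw [hsplit] at hbad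
  rw [imbalance]
  linarith

/-- After one step of the construction a set is distributed almost evenly over the two cosets of
`ℤ × ℝ`. -/
theorem haar_real_sheet_mul_Cnext_le (n : ℕ) {A : Set G} (hAm : MeasurableSet A)
    (hA : A ⊆ F P.r (n + 1)) (ε : ZMod 2) :
    G.haar.real (sheet ε (A * (Cnext P.r P.s (n + 1) : Set G))) ≤
      (1 / 2 + P.imbalance (n + 1)) *
        G.haar.real (A * (Cnext P.r P.s (n + 1) : Set G)) := by
  have hAfin := P.haar_ne_top_of_subset_F hA
  have hsub : sheet ε (A * (Cnext P.r P.s (n + 1) : Set G)) ⊆ ⋃ h ∈ H P.r (n + 1),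
      sheet (ε - (P.s (n + 1) h).e) A * {P.shiftElt (n + 1) h} := by
    rintro z ⟨hz, he⟩
    rw [mul_Cnext] at hz
    obtain ⟨h, hh, x, hx, _, rfl, rfl⟩ := mem_iUnion₂.1 hz
    refine mem_iUnion₂.2 ⟨h, hh, x, ⟨hx, ?_⟩, _, rfl, rfl⟩
    have he' : x.e + ((P.s (n + 1) h).e + 0) = ε := he
    change x.e = ε - (P.s (n + 1) h).e
    rw [← he', add_zero, add_sub_cancel_right]
  have hfin : ∀ δ, G.haar (sheet δ A) ≠ ∞ := fun δ =>
    ((measure_mono inter_subset_left).trans_lt hAfin.lt_top).ne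
  have hcardA : G.haar.real (A * (Cnext P.r P.s (n + 1) : Set G)) =
      (H P.r (n + 1)).card * G.haar.real A := by
    have h := CFSeq.measure_mul_C (Q := P.cf) (lam := G.haar) (n := n) hAm hA
    have hc : (P.cf.C n).card = (H P.r (n + 1)).card := P.card_Cnext n
    rw [hc] at h
    change G.haar (A * (Cnext P.r P.s (n + 1) : Set G)) = _ at h
    rw [measureReal_def, h, ENNReal.toReal_mul, ENNReal.toReal_natCast, measureReal_def]
  have hmul : ∀ (E : Set G) x, G.haar.real (E * {x}) = G.haar.real E := fun E x => by
    rw [measureReal_def, CFSeq.measure_mul_singleton, measureReal_def]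
  have hterm : ∀ h, G.haar.real (sheet (ε - (P.s (n + 1) h).e) A) =
      ind ε (P.s (n + 1) h) * G.haar.real (sheet 0 A) +
        ind (ε - 1) (P.s (n + 1) h) * G.haar.real (sheet 1 A) := by
    intro h
    rcases sgn_cases (P.s (n + 1) h).e with ⟨hs, _⟩ | ⟨hs, _⟩ <;>
      rcases sgn_cases ε with ⟨rfl, _⟩ | ⟨rfl, _⟩ <;> simp [ind, hs]
  calc G.haar.real (sheet ε (A * (Cnext P.r P.s (n + 1) : Set G)))
      ≤ ∑ h ∈ H P.r (n + 1), G.haar.real (sheet (ε - (P.s (n + 1) h).e) A) := by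
        refine (measureReal_mono hsub ?_).trans ((measureReal_biUnion_finset_le _ _).trans
          (le_of_eq (Finset.sum_congr rfl fun h _ => hmul _ _)))
        refine ((measure_biUnion_finset_le _ _).trans_lt (ENNReal.sum_lt_top.2 fun h _ => ?_)).ne
        rw [CFSeq.measure_mul_singleton]
        exact (hfin _).lt_top
    _ = (∑ h ∈ H P.r (n + 1), ind ε (P.s (n + 1) h)) * G.haar.real (sheet 0 A) +
          (∑ h ∈ H P.r (n + 1), ind (ε - 1) (P.s (n + 1) h)) * G.haar.real (sheet 1 A) := by
        simp only [hterm, Finset.sum_add_distrib, Finset.sum_mul]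
    _ ≤ (1 / 2 + P.imbalance (n + 1)) * (H P.r (n + 1)).card * G.haar.real (sheet 0 A) +
          (1 / 2 + P.imbalance (n + 1)) * (H P.r (n + 1)).card * G.haar.real (sheet 1 A) :=
        add_le_add (mul_le_mul_of_nonneg_right (P.sum_ind_le n _) measureReal_nonneg)
          (mul_le_mul_of_nonneg_right (P.sum_ind_le n _) measureReal_nonneg)
    _ = _ := by
        rw [← mul_add, haar_real_sheet_add hAm hAfin, hcardA, mul_assoc]

theorem tendsto_approxErr_sheet (ε : ZMod 2) :
    Tendsto (fun n => P.approxErr (n + 1) (sheet ε (F P.r (n + 1)))) atTop (𝓝 0) := by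
  refine P.tendsto_approxErr_of_bdry (f := id) tendsto_id (fun n => inter_subset_left) ?_
  refine tendsto_of_tendsto_of_tendsto_of_le_of_le tendsto_const_nhds
    (tendsto_one_div_add_atTop_nhds_zero_nat (𝕜 := ℝ)) (fun n => P.relMeas_nonneg _ _) fun n => ?_
  have ha1 : (1 : ℝ) ≤ a P.r (n + 1) := by exact_mod_cast P.a_pos n
  have hF := P.haar_real_F_pos n
  have h1 : G.haar.real (bdry (1 / ((n : ℝ) + 1)) (sheet ε (F P.r (n + 1)))) ≤
      8 * a P.r (n + 1) * (1 / ((n : ℝ) + 1)) := by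
    have hle := (measure_mono (bdry_sheet_subset (1 / ((n : ℝ) + 1)) ε (F P.r (n + 1)))).trans
      (haar_bdry_box_le (δ := 1 / ((n : ℝ) + 1)) (by positivity) (a P.r (n + 1)))
    have := ENNReal.toReal_mono ENNReal.ofReal_ne_top hle
    rwa [ENNReal.toReal_ofReal (by positivity)] at this
  change G.haar.real (bdry (1 / ((n : ℝ) + 1)) (sheet ε (F P.r (n + 1)))) /
    G.haar.real (F P.r (n + 1)) ≤ 1 / ((n : ℝ) + 1)
  rw [div_le_iff₀ hF, haar_real_F]
  refine h1.trans ?_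
  have h2 : 0 ≤ 1 / ((n : ℝ) + 1) := by positivity
  have h3 : (8 * a P.r (n + 1) : ℝ) ≤ 8 * (a P.r (n + 1) : ℝ) ^ 2 := by nlinarith
  linarith [mul_le_mul_of_nonneg_right h3 h2]

theorem tendsto_imbalance : Tendsto (fun n => P.imbalance (n + 1)) atTop (𝓝 0) := by
  have h1 : Tendsto (fun n : ℕ => 1 / (((n + 1 : ℕ) : ℝ))) atTop (𝓝 0) := by
    have := tendsto_one_div_add_atTop_nhds_zero_nat (𝕜 := ℝ)
    simpa using this
  have h2 : Tendsto (fun n => P.balanceErr (n + 1)) atTop (𝓝 0) := by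
    have := ((P.tendsto_approxErr_sheet 0).add (P.tendsto_approxErr_sheet 1)).add h1
    rw [add_zero, add_zero] at this
    exact this
  have h3 := (Real.continuous_sqrt.tendsto 0).comp h2
  have h4 := P.tendsto_one_div_r.comp (tendsto_add_atTop_nat 1)
  have := (h3.add h1).add (h4.const_mul 2)
  rw [Real.sqrt_zero, mul_zero, add_zero, add_zero] at this
  exact this

end Params

/-! ### Mixing along `φ_n(1, 0)` -/

namespace Params

variable (P : Params)

theorem haar_real_S (n : ℕ) :
    G.haar.real (S P.r (n + 1)) = 8 * ((2 * n + 1) * ta P.r n) ^ 2 := by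
  rw [S, G.haar_real_box, b_cast_succ]

theorem haar_real_S_pos (n : ℕ) : 0 < G.haar.real (S P.r (n + 1)) := by
  have := P.ta_cast_pos n
  rw [haar_real_S]
  positivity

/-- If every translate of `B` has relative measure at most `K` in `S_{n+1}`, then the average
overlap of `A` and `B` along `H_{n+1}` is squeezed between quantities which both are close to
`μ(A) μ(B)` when `K` is close to `μ(B)`. -/
theorem sum_overlap_div_card_mem_Icc (n : ℕ) {A B : Set G} (hA : A ⊆ F P.r (n + 1))
    (hB : B ⊆ F P.r (n + 1)) {K : ℝ} (hK0 : 0 ≤ K)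
    (hK : ∀ z, G.haar.real ({y | z * y⁻¹ ∈ B} ∩ S P.r (n + 1)) ≤
      K * G.haar.real (S P.r (n + 1))) :
    (∑ h ∈ shiftH P.r (n + 1), overlap P.r (n + 1) A B (P.s (n + 1) h)
        (P.s (n + 1) (h + (1, 0)))) / (H P.r (n + 1)).card ∈
      Icc (P.relMeas (n + 1) B - P.approxErr (n + 1) B -
          K * (1 - P.relMeas (n + 1) A + P.approxErr (n + 1) A) -
          (2 * (1 / ((n : ℝ) + 1)) + 1 / (2 * P.r (n + 1) + 1)))
        (K * P.relMeas (n + 1) A + (P.approxErr (n + 1) A + P.approxErr (n + 1) B) +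
          (2 * (1 / ((n : ℝ) + 1)) + 1 / (2 * P.r (n + 1) + 1))) := by
  set A' := P.atomApprox (n + 1) A
  set B' := P.atomApprox (n + 1) B
  have hD := (P.D_nonempty (n := n + 1) (by omega))
  have hrow := P.abs_sum_shiftH_sub_avgD_le (n := n + 1) (by omega)
    (f := overlap P.r (n + 1) A B) (fun x y => P.overlap_nonneg _ A B x y)
    fun x y => (P.overlap_le_relMeas hA B x y).trans (P.relMeas_le_one hA)
  push_cast at hrow
  have hlow : avgD (P.D (n + 1)) (overlap P.r (n + 1) A' B') ≤
      avgD (P.D (n + 1)) (overlap P.r (n + 1) A B) :=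
    avgD_mono fun x _ y _ => P.overlap_mono hA (P.atomApprox_subset_left _ _)
      (P.atomApprox_subset_left _ _) x y
  have hup : avgD (P.D (n + 1)) (overlap P.r (n + 1) A B) ≤
      avgD (P.D (n + 1)) (overlap P.r (n + 1) A' B') +
        (P.approxErr (n + 1) A + P.approxErr (n + 1) B) := by
    rw [← avgD_add_const hD]
    exact avgD_mono fun x _ y _ => P.overlap_le_add_approxErr hA hB x y
  have hcmp := abs_lt.1 (P.abs_avgD_sub_avgS_atomApprox_lt n A B)
  have hK' : ∀ z, G.haar.real ({y | z * y⁻¹ ∈ B'} ∩ S P.r (n + 1)) ≤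
      K * G.haar.real (S P.r (n + 1)) := fun z => by
    refine (measureReal_mono ?_ ?_).trans (hK z)
    · exact inter_subset_inter_left _ fun y (hy : z * y⁻¹ ∈ B') =>
        P.atomApprox_subset_left (n + 1) B hy
    · exact ((measure_mono inter_subset_right).trans_lt (G.haar_box_ne_top _).lt_top).ne
  obtain ⟨hS1, hS2⟩ := avgS_overlap_mem_Icc (P.measurableSet_atomApprox (by omega) A)
    (P.measurableSet_atomApprox (by omega) B) (P.atomApprox_mul_subset A)
    (P.atomApprox_mul_subset B) (P.haar_real_S_pos n) hK0 hK'
  have hF := P.haar_real_F_pos n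
  have h1 : (G.haar.real B' - K * (G.haar.real (F P.r (n + 1)) - G.haar.real A')) /
      G.haar.real (F P.r (n + 1)) =
      P.relMeas (n + 1) B' - K * (1 - P.relMeas (n + 1) A') := by
    rw [relMeas, relMeas]
    field_simp
  have h2 : K * G.haar.real A' / G.haar.real (F P.r (n + 1)) = K * P.relMeas (n + 1) A' :=
    mul_div_assoc _ _ _
  have hA' : P.relMeas (n + 1) A' = _ := P.relMeas_atomApprox (by omega) hA
  have hB' : P.relMeas (n + 1) B' = _ := P.relMeas_atomApprox (by omega) hB
  rw [h1, hA', hB'] at hS1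
  rw [h2, hA'] at hS2
  have heA := mul_nonneg hK0 (P.approxErr_nonneg (n + 1) A)
  obtain ⟨hr1, hr2⟩ := abs_le.1 hrow
  constructor <;> linarith [hcmp.1, hcmp.2]

/-- For `k = n + 2` and `B ⊆ F_k` which itself has the form `A C_k`, an upper bound for the
proportion of the `y ∈ S_{k+1}` with `z ∈ B C_{k+1} y`. The factors come from the imbalance between
the two cosets, from the quotient of the number `(2 k + 2)²` of windows by
`(b_{k+1} / ã_k)² = (2 k + 1)²`, and from the quotient of the sizes of `F_k` and of a window. -/
noncomputable def hitBound (n : ℕ) (B : Set G) : ℝ :=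
  (1 + 2 * P.imbalance (n + 1)) * (1 + 1 / (2 * (n + 2 : ℝ) + 1)) ^ 2 /
    (ta P.r (n + 2) / a P.r (n + 2) : ℝ) ^ 2 * P.relMeas (n + 2) B

theorem imbalance_nonneg (n : ℕ) : 0 ≤ P.imbalance n := by
  unfold imbalance
  positivity

theorem hitBound_nonneg (n : ℕ) (B : Set G) : 0 ≤ P.hitBound n B := by
  have := P.imbalance_nonneg (n + 1)
  have := P.relMeas_nonneg (n + 2) B
  unfold hitBound
  positivity

theorem haar_real_hit_lift_le (m j : ℕ) {B : Set G} (hB : MeasurableSet B) (z : G) :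
    G.haar.real ({y | z * y⁻¹ ∈ P.cf.lift m B (j + 2)} ∩ S P.r (m + j + 3)) ≤
      P.hitBound (m + j) (P.cf.lift m B (j + 1)) * G.haar.real (S P.r (m + j + 3)) := by
  have h := P.haar_real_hit_le (m + j + 1) (A := P.cf.lift m B (j + 1))
    (CFSeq.lift_subset m B (j + 1)) (fun ε => P.haar_real_sheet_mul_Cnext_le (m + j)
      (CFSeq.measurableSet_lift m hB j) (CFSeq.lift_subset m B j) ε) z
  refine h.trans (le_of_eq ?_)
  have ha := P.a_cast_pos (m + j + 1)
  have ht := P.ta_cast_pos (m + j + 2)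
  have hd : (2 * ((m + j : ℕ) + 2 : ℝ) + 1) ≠ 0 := by positivity
  rw [P.haar_real_S (m + j + 2), hitBound, relMeas, haar_real_F]
  change 2 * (2 * (((m + j + 1 : ℕ) : ℝ) + 2)) ^ 2 * ((1 / 2 + P.imbalance (m + j + 1)) *
    G.haar.real (P.cf.lift m B (j + 1))) = _
  have h1 : (((m + j + 1 : ℕ) : ℝ)) = ((m + j : ℕ) : ℝ) + 1 := by push_cast; rfl
  have h2 : (((m + j + 2 : ℕ) : ℝ)) = ((m + j : ℕ) : ℝ) + 2 := by push_cast; rfl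
  rw [h1, h2]
  generalize ((m + j : ℕ) : ℝ) = x at *
  field_simp
  ring

theorem tendsto_relMeas_lift (m : ℕ) {A : Set G} (hA : MeasurableSet A) :
    Tendsto (fun j => P.relMeas (m + j + 1) (P.cf.lift m A j)) atTop
      (𝓝 (P.μ.real (P.cf.cyl m A))) := by
  have hv := P.tendsto_levelMass.comp (tendsto_const_add_atTop m)
  have h := (tendsto_const_nhds (x := P.μ.real (P.cf.cyl m A))).div hv one_ne_zero
  rw [div_one] at h
  refine h.congr' ?_
  filter_upwards [hv.eventually (lt_mem_nhds one_pos)] with j hj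
  simp only [Function.comp_apply, Pi.div_apply] at hj ⊢
  rw [← CFSeq.cyl_lift m A j, P.μ_real_cyl_eq (m + j) (CFSeq.measurableSet_lift m hA j)
    (CFSeq.lift_subset m A j), relMeas, mul_div_cancel_left₀ _ hj.ne']

theorem tendsto_hitBound (m : ℕ) {B : Set G} (hB : MeasurableSet B) :
    Tendsto (fun j => P.hitBound (m + j) (P.cf.lift m B (j + 1))) atTop
      (𝓝 (P.μ.real (P.cf.cyl m B))) := by
  have hm := tendsto_const_add_atTop m
  have h1 : Tendsto (fun j => 1 + 2 * P.imbalance (m + j + 1)) atTop (𝓝 (1 + 2 * 0)) :=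
    ((P.tendsto_imbalance.comp hm).const_mul 2).const_add 1
  have h2 : Tendsto (fun j : ℕ => 1 + 1 / (2 * (((m + j : ℕ) : ℝ) + 2) + 1)) atTop
      (𝓝 (1 + 0)) := by
    refine Tendsto.const_add 1 ?_
    refine tendsto_of_tendsto_of_tendsto_of_le_of_le tendsto_const_nhds
      (tendsto_one_div_add_atTop_nhds_zero_nat (𝕜 := ℝ)) (fun j => by positivity) fun j => ?_
    refine one_div_le_one_div_of_le (by positivity) ?_
    have : (0 : ℝ) ≤ m := Nat.cast_nonneg m
    have : (0 : ℝ) ≤ j := Nat.cast_nonneg j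
    push_cast
    linarith
  have h3 : Tendsto (fun j => (ta P.r (m + j + 2) : ℝ) / a P.r (m + j + 2)) atTop (𝓝 1) :=
    (P.tendsto_ta_div_a.comp (tendsto_add_atTop_nat 1)).comp hm
  have h4 : Tendsto (fun j => P.relMeas (m + j + 2) (P.cf.lift m B (j + 1))) atTop
      (𝓝 (P.μ.real (P.cf.cyl m B))) :=
    (P.tendsto_relMeas_lift m hB).comp (tendsto_add_atTop_nat 1)
  have h := ((h1.mul (h2.pow 2)).div (h3.pow 2) (by norm_num)).mul h4
  rw [mul_zero, add_zero, one_pow, mul_one, div_one, one_mul] at h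
  exact h

theorem tendsto_sum_overlap_lift (m : ℕ) {A B : Set G} (hA : A ∈ thinBdry) (hB : B ∈ thinBdry) :
    Tendsto (fun j => (∑ h ∈ shiftH P.r (m + j + 3), overlap P.r (m + j + 3)
        (P.cf.lift m A (j + 2)) (P.cf.lift m B (j + 2)) (P.s (m + j + 3) h)
        (P.s (m + j + 3) (h + (1, 0)))) / (H P.r (m + j + 3)).card) atTop
      (𝓝 (P.μ.real (P.cf.cyl m A) * P.μ.real (P.cf.cyl m B))) := by
  have h2 := tendsto_add_atTop_nat 2
  have hκA : Tendsto (fun j => P.relMeas (m + j + 3) (P.cf.lift m A (j + 2))) atTop _ :=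
    (P.tendsto_relMeas_lift m hA.1).comp h2
  have hκB : Tendsto (fun j => P.relMeas (m + j + 3) (P.cf.lift m B (j + 2))) atTop _ :=
    (P.tendsto_relMeas_lift m hB.1).comp h2
  have heA : Tendsto (fun j => P.approxErr (m + j + 3) (P.cf.lift m A (j + 2))) atTop _ :=
    (P.tendsto_approxErr_lift m hA).comp h2
  have heB : Tendsto (fun j => P.approxErr (m + j + 3) (P.cf.lift m B (j + 2))) atTop _ :=
    (P.tendsto_approxErr_lift m hB).comp h2
  have hK := P.tendsto_hitBound m hB.1
  have hr : Tendsto (fun j : ℕ => 2 * (1 / (((m + j + 2 : ℕ) : ℝ) + 1)) +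
      1 / (2 * (P.r (m + j + 3) : ℝ) + 1)) atTop (𝓝 (2 * 0 + 0)) :=
    (((tendsto_one_div_add_atTop_nhds_zero_nat (𝕜 := ℝ)).comp
      (h2.comp (tendsto_const_add_atTop m))).const_mul 2).add
      (P.tendsto_one_div_r.comp ((tendsto_add_atTop_nat 3).comp (tendsto_const_add_atTop m)))
  have hlo := ((hκB.sub heB).sub (hK.mul ((hκA.const_sub 1).add heA))).sub hr
  have hhi := ((hK.mul hκA).add (heA.add heB)).add hr
  set p := P.μ.real (P.cf.cyl m A)
  set q := P.μ.real (P.cf.cyl m B)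
  have e1 : q - 0 - q * (1 - p + 0) - (2 * 0 + 0) = p * q := by ring
  have e2 : q * p + (0 + 0) + (2 * 0 + 0) = p * q := by ring
  rw [e1] at hlo
  rw [e2] at hhi
  have hmem := fun j => P.sum_overlap_div_card_mem_Icc (m + j + 2)
    (CFSeq.lift_subset (Q := P.cf) m A (j + 2)) (CFSeq.lift_subset (Q := P.cf) m B (j + 2))
    (P.hitBound_nonneg (m + j) (P.cf.lift m B (j + 1))) (P.haar_real_hit_lift_le m j hB.1)
  exact tendsto_of_tendsto_of_tendsto_of_le_of_le hlo hhi (fun j => (hmem j).1)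
    fun j => (hmem j).2

theorem tendsto_μ_real_shift_cyl (m : ℕ) {A B : Set G} (hA : A ∈ thinBdry) (hB : B ∈ thinBdry) :
    Tendsto (fun n => P.μ.real (P.T (phi P.r n (1, 0)) '' P.cf.cyl m A ∩ P.cf.cyl m B)) atTop
      (𝓝 (P.μ.real (P.cf.cyl m A) * P.μ.real (P.cf.cyl m B))) := by
  rw [← tendsto_add_atTop_iff_nat (m + 3)]
  have hm2 : Tendsto (fun j : ℕ => m + (j + 2)) atTop atTop :=
    (tendsto_const_add_atTop m).comp (tendsto_add_atTop_nat 2)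
  have hv := P.tendsto_levelMass.comp hm2
  have hr := P.tendsto_one_div_r.comp ((tendsto_add_atTop_nat 1).comp hm2)
  have hmain := hv.mul (P.tendsto_sum_overlap_lift m hA hB)
  rw [one_mul] at hmain
  have herr := hv.mul hr
  rw [mul_zero] at herr
  refine tendsto_of_tendsto_of_dist hmain (squeeze_zero (fun _ => dist_nonneg) (fun j => ?_) herr)
  have h := P.abs_μ_real_shift_sub_le (m + (j + 2))
    (CFSeq.measurableSet_lift m hA.1 (j + 2)) (CFSeq.measurableSet_lift m hB.1 (j + 2))
    (CFSeq.lift_subset (Q := P.cf) m A (j + 2)) (CFSeq.lift_subset (Q := P.cf) m B (j + 2))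
  rw [CFSeq.cyl_lift, CFSeq.cyl_lift] at h
  rw [dist_comm, Real.dist_eq, show j + (m + 3) = m + (j + 2) + 1 by omega]
  exact h

theorem T_image (g : G) (E : Set P.X) : P.T g '' E = P.T g⁻¹ ⁻¹' E :=
  CFSeq.act_image_eq_preimage g E

theorem tendsto_μ_real_shift {A B : Set P.X} (hA : MeasurableSet A) (hB : MeasurableSet B) :
    Tendsto (fun n => P.μ.real (P.T (phi P.r n (1, 0)) '' A ∩ B)) atTop
      (𝓝 (P.μ.real A * P.μ.real B)) := by
  have hF : ∀ n, ∀ A ∈ thinBdry, A ∩ P.cf.F n ∈ thinBdry := fun n A hA =>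
    inter_mem_thinBdry hA (box_mem_thinBdry _)
  have hC : ∀ n, ∀ A ∈ thinBdry, A * (P.cf.C n : Set G) ∈ thinBdry := fun n A hA =>
    mul_finset_mem_thinBdry hA _
  simp only [T_image]
  refine tendsto_measureReal_preimage_inter_of_piSystem (fun n => P.measurePreserving_T _)
    (CFSeq.measurableSpace_eq_generateFrom generateFrom_thinBdry univ_mem_thinBdry)
    (CFSeq.isPiSystem_cyl hF hC fun A hA B hB => inter_mem_thinBdry hA hB) ?_ hA hB
  rintro _ ⟨m, A, hA, rfl⟩ _ ⟨n, B, hB, rfl⟩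
  obtain ⟨A', hA', -, h1⟩ := CFSeq.exists_cyl_eq_of_le hF hC (le_max_left m n) hA
  obtain ⟨B', hB', -, h2⟩ := CFSeq.exists_cyl_eq_of_le hF hC (le_max_right m n) hB
  rw [h1, h2]
  simp only [← T_image]
  exact P.tendsto_μ_real_shift_cyl _ hA' hB'

theorem isMixingSequence_phi : IsMixingSequence P.T P.μ fun n => phi P.r n (1, 0) := by
  intro A B hA hB
  rw [← ENNReal.tendsto_toReal_iff (fun n => measure_ne_top _ _)
    (ENNReal.mul_ne_top (measure_ne_top _ _) (measure_ne_top _ _)), ENNReal.toReal_mul]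
  exact P.tendsto_μ_real_shift hA hB

theorem T_iterate (k : ℕ) : (P.T ⟨1, 0, 0⟩)^[k] = P.T ⟨k, 0, 0⟩ := by
  induction k with
  | zero =>
    funext x
    exact (CFSeq.act_one P.cf x).symm
  | succ k ih =>
    funext x
    rw [Function.iterate_succ_apply', ih]
    change P.cf.act _ (P.cf.act _ x) = P.cf.act _ x
    rw [← CFSeq.act_mul]
    congr 1
    ext
    · simp [add_comm]
    · simp
    · simp

theorem weaklyMixing_T : WeaklyMixing (P.T ⟨1, 0, 0⟩) P.μ := by
  refine ⟨P.measurePreserving_T _, ergodic_prodMap_of_tendsto (P.measurePreserving_T _)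
    (fun n => 2 * ta P.r n) fun A B hA hB => ?_⟩
  have h := P.tendsto_μ_real_shift hB hA
  rw [mul_comm] at h
  refine h.congr fun n => ?_
  have hg : (⟨((2 * ta P.r n : ℕ) : ℤ), 0, 0⟩ : G) = phi P.r n (1, 0) := by
    rw [phi_one_zero]
    push_cast
    rfl
  rw [T_iterate, hg]
  set g := phi P.r n (1, 0)
  have hpre : P.T g ⁻¹' (P.T g '' B ∩ A) = P.T g ⁻¹' A ∩ B := by
    have hinv : P.T g ⁻¹' (P.T g '' B) = B := by
      refine preimage_image_eq _ (Function.LeftInverse.injective (g := P.cf.act g⁻¹) fun x => ?_)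
      change P.cf.act g⁻¹ (P.cf.act g x) = x
      rw [← CFSeq.act_mul, inv_mul_cancel, CFSeq.act_one]
    rw [preimage_inter, hinv, inter_comm]
  have hm : MeasurableSet (P.T g '' B ∩ A) := by
    rw [T_image]
    exact ((P.measurePreserving_T _).measurable hB).inter hA
  rw [measureReal_def, measureReal_def, ← hpre,
    (P.measurePreserving_T g).measure_preimage hm.nullMeasurableSet]

end Params

end CFMix

theorem mainTheorem4 (P : CFMix.Params) :
    MeasureTheory.IsProbabilityMeasure P.μ ∧
    (∀ g : CFMix.G, MeasureTheory.MeasurePreserving (P.T g) P.μ P.μ) ∧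
    CFMix.WeaklyMixing (P.T ⟨1, 0, 0⟩) P.μ ∧
    CFMix.IsMixingSequence P.T P.μ (fun n => CFMix.phi P.r n (1, 0)) := by
  exact ⟨inferInstance, P.measurePreserving_T, P.weaklyMixing_T, P.isMixingSequence_phi⟩
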